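/- **Setting.** Let $f:\mathbb R^d\to\mathbb R$. The Clarke subdifferential $\partial f(x)$ is the convex hull of all limits $\lim\nabla f(x_i)$ with $x_i\to x$ and $f$ differentiable at $x_i$; $\partial_\sigma f(x)=\mathrm{conv}\bigcup_{\|y-x\|\le\sigma}\partial f(y)$. Assume $f$ is locally Lipschitz with local minimizer $\bar x$ and: * (quadratic growth) $f(x)-f(\bar x)\ge\frac\gamma2\|x-\bar x\|^2$ for $x$ near $\bar x$, where $\gamma>0$; * (active manifold) $0\in\partial f(\bar x)$, $\bar x\in\mathcal M$, and near $\bar x$ the set $\mathcal M$ is the zero set of a $C^4$ map $F$ with surjective derivative; $f|_{\mathcal M}$ is $C^4$ near $\bar x$ (it agrees on $\mathcal M$ with a $C^4$ function); and $\inf\{\|v\|:v\in\partial f(x),\,x\in V\setminus\mathcal M\}>0$ for some neighborhood $V$ of $\bar x$; * (strong (a)) for some $C_{(a)}>0$, $\|P_{T_{\mathcal M}(y)}(v-\nabla_{\mathcal M}f(y))\|\le C_{(a)}\|x-y\|$ for all $x$ and $y\in\mathcal M$ near $\bar x$ and $v\in\partial f(x)$; * ($b_\le$) for some $o:\mathbb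 R\to\mathbb R$ with $o(t)/t\to0$ as $t\to0$, $f(y)\ge f(x)+\langle v,y-x\rangle+o(\|y-x\|)$ for all $x$ and $y\in\mathcal M$ near $\bar x$ and $v\in\partial f(x)$; * $\mathcal M$ is not a neighborhood of $\bar x$. Here $P_{\mathcal M}$ is the nearest-point projection, $T_{\mathcal M}(y)=\ker\nabla F(y)$, $f_{\mathcal M}=f\circ P_{\mathcal M}$, $\nabla_{\mathcal M}f=\nabla f_{\mathcal M}$ on $\mathcal M$. Write $\mathrm{lip}_H(\bar x)=\limsup_{x\ne x'\to\bar x}\|H(x)-H(x')\|/\|x-x'\|$ (operator norm for matrices). Put $$\mu=\tfrac14\liminf_{x'\to\bar x,\,x'\notin\mathcal M}\mathrm{dist}(0,\partial f(x')),\qquad L=2\,\mathrm{lip}_f(\bar x),$$ and fix any reals $\beta>\mathrm{lip}_{\nabla f_{\mathcal M}}(\bar x)$ and $C_{\mathcal M}>\mathrm{lip}_{\nabla P_{\mathcal M}}(\bar x)$ (for instance twice these moduli, when they are positive). Fix $x_0$, $0\ne g_0\in\partial f(x_0)$, $c_0\in(0,1]$, and let $s_{\rm lb}=c_0\|g_0\|$.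 **Regularity radius.** $\delta_A>0$ is a *regularity radius* if on $B_{2\delta_A}(\bar x)$ nearest points in $\mathcal M$ exist, are unique and lie where $F$ describes $\mathcal M$, $P_{\mathcal M}$ is $C^3$ with Lipschitz Jacobian, $f_{\mathcal M}$ is $C^3$ with Lipschitz gradient, the growth bound holds on $\overline B_{2\delta_A}(\bar x)$, and for all $x\in B_{\delta_A}(\bar x)$, $x'\in B_{2\delta_A}(\bar x)$, $0<\sigma\le\delta_A$, $v\in\partial f(x)$, $g,g'\in\partial_\sigma f(x)$, with $y=P_{\mathcal M}(x)$, $D=\mathrm{dist}(x,\mathcal M)$, $P_T=P_{T_{\mathcal M}(y)}$: $$\|P_{\mathcal M}(x')-y-P_T(x'-x)\|\le C_{\mathcal M}(D^2+\|x-x'\|^2),\qquad \tfrac\gamma2\|y-\bar x\|\le\|\nabla_{\mathcal M}f(y)\|\le\beta\|y-\bar x\|,$$ $$\|P_T(g-\nabla_{\mathcal M}f(y))\|\le C_{(a)}(D+\sigma),\quad \|P_Tg\|\le C_{(a)}(D+\sigma)+\beta\|y-\bar x\|,\quad \|P_T(g-g')\|\le2C_{(a)}(D+\sigma),$$ $$\langle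 v,x-y\rangle\ge\mu D,\qquad\|g\|\le L,\qquad f(x)-f(\bar x)\le LD+\tfrac\beta2\|y-\bar x\|^2 .$$ **Constants.** For a regularity radius $\delta_A$ let $D_1=\frac{\mu}{8(\mu+L)}$, $D_2=\frac\mu2$, $C_1=\frac\gamma4$, $C_2=\min\{\frac{\gamma}{8C_{(a)}},\frac{\min\{1,1/\delta_A\}}2\}$, $C_3=\frac{C_1^2}{8L}$, $C_4=\min\{\frac{\beta}{C_{(a)}(1+\delta_A)},\frac{\min\{\mu/\delta_A,\;C_3D_2/\beta\}}{4(1+(1+\delta_A)C_{\mathcal M})(\mu+L)},\frac12\}$, $C_5=\min\{\frac{\beta}{2C_{(a)}},\frac{C_3D_2}{32C_{(a)}\beta},C_4,\frac{C_2}4\}$, $\delta_{GI}=\min\{\frac{\delta_A}4,\frac{D_1}{C_{\mathcal M}}\}$, $\delta_{ND}=\min\{\delta_{GI},\frac{D_2}{D_1L\sqrt{128}}\}$, $\delta_{\rm Grid}=\min\{\frac{\delta_A}2,\frac1{C_{\mathcal M}(D_1^{-1}+1)},\frac{\mu}{8(C_{(a)}+\beta)}\}$, $a_1=\min\{D_1,\frac{D_2}L\}$,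 $a_2=\frac12\min\{\frac{C_1}L,C_5\}$, $$\delta_{LS}=\min\Big\{\tfrac{\delta_A}2,\delta_{GI},\delta_{ND},\delta_{\rm Grid},\tfrac1{2(a_1+2a_2)},\tfrac{\gamma D_1^2\min\{\delta_{\rm Grid}/2,1/4\}^2}{2L},1\Big\},$$ $$C_6=\max\Big\{1,\tfrac{8(C_{(a)}+2\beta+2C_{(a)}D_1^{-1})}{s_{\rm lb}},2D_1^{-1},\tfrac{4\gamma D_1}{s_{\rm lb}}\Big\},$$ $$\epsilon_{1,T}=\max\Big\{\tfrac{(C_5^2L+\beta)L}{C_3}\big(1-\tfrac{3\mu^2}{256L^2}\big)^{T/2},\ \big(1-\tfrac{\mu^2}{64L^2}\big)^{T/2}L\Big\},$$ $$\epsilon_{2,G}=\max\Big\{\tfrac{L}{\min\{1,a_1\}}+\tfrac{\beta}{2\min\{1,a_1\}a_2^2},\,8C_{(a)},\,L\Big\}2^{-G},$$ $$\rho=1-\tfrac18\min\Big\{\tfrac{\gamma a_2}{8\max\{4La_2^2,\beta\}},\tfrac{\mu a_1}{4\max\{2L,\beta/a_2^2\}}\Big\}.$$ **Algorithms.** For fixed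 $x$, $\sigma$, a vector $g$ *continues* if $g\ne0$ and $f(x)-f(x-\sigma g/\|g\|)\le\frac\sigma8\|g\|$. Both loops below start at a given $g$ and, for at most $T$ passes and while the current $g$ continues, choose a vector $\hat g$ and replace $g$ by the minimal norm element of $[g,\hat g]$; they return the last $g$. * $\mathtt{TDescent}(x,g,\sigma,T)$: $\hat g$ is any element of $\partial f(x-\sigma g/\|g\|)$. * $\mathtt{NDescent}(x,g,\sigma,T)$: choose any $r\in(0,\sigma\|g\|)$ (it may depend on the past), sample $\zeta$ uniformly from the ball $B_r(g)$, then $z$ uniformly from the segment $[x,x-\sigma\zeta/\|\zeta\|]$ (fresh samples, independent of the past), and take $\hat g\in\partial f(z)$, with $\hat g=\nabla f(z)$ when $f$ is differentiable at $z$. * $\mathtt{linesearch}(x,g,s,G,T)$: put $v_0=g$; for $i=0,\dots,G-1$ let $\sigma_i=2^{-(G-i)}$, $u_i=\mathtt{TDescent}(x,v_i,\sigma_i,T)$, $v_{i+1}=\mathtt{NDescent}(x,u_i,\sigma_i,T)$; return any minimizer $\tilde x$ of $f$ over $\{x\}\cup\{x-\sigma_iv_{i+1}/\|v_{i+1}\|:0\le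 i<G,\ \sigma_i\le\|v_{i+1}\|/s\}$. **Proposition (one step improvement).** Regularity radii exist. For every regularity radius $\delta_A$, with the constants above, the following holds for all $x\in B_{\delta_{LS}}(\bar x)$, $g\in\partial f(x)$, integers $G\ge 0$ with $G>\lceil\log_2(1/\delta_{\rm Grid})\rceil$, $s\in[s_{\rm lb},L]$, $p\in(0,1)$ and integers $T\ge\lceil256L^2/\mu^2\rceil\lceil2\log(1/p)\rceil$: for every random run $\tilde x=\mathtt{linesearch}(x,g,s,G,T)$ (with any admissible choices), with probability at least $1-p$ both $$f(\tilde x)-f(\bar x)\le\max\{\rho(f(x)-f(\bar x)),\ \epsilon_{1,T},\ \epsilon_{2,G}\}$$ and $$\|\tilde x-x\|\le C_6\max\Big\{\frac{\epsilon_{1,T}}{s_{\rm lb}},\ \frac{\epsilon_{2,G}}{s_{\rm lb}},\ \sqrt{\frac{2(f(x)-f(\bar x))}{\min\{s_{\rm lb},\gamma\}}}\Big\}.$$ -/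

import Mathlib

open Set Filter Topology MeasureTheory ProbabilityTheory
open scoped ENNReal NNReal

noncomputable section

namespace NTDescent

/-! ### Clarke and Goldstein subdifferentials -/

/-- Clarke subdifferential: convex hull of limits of gradients at nearby points of
differentiability. -/
def clarke {d : ℕ} (f : EuclideanSpace ℝ (Fin d) → ℝ) (x : EuclideanSpace ℝ (Fin d)) :
    Set (EuclideanSpace ℝ (Fin d)) :=
  convexHull ℝ {v | ∃ z : ℕ → EuclideanSpace ℝ (Fin d), (∀ n, DifferentiableAt ℝ f (z n)) ∧
    Tendsto z atTop (𝓝 x) ∧ Tendsto (fun n => gradient f (z n)) atTop (𝓝 v)}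

/-- Goldstein `σ`-subdifferential. -/
def goldstein {d : ℕ} (f : EuclideanSpace ℝ (Fin d) → ℝ) (σ : ℝ)
    (x : EuclideanSpace ℝ (Fin d)) : Set (EuclideanSpace ℝ (Fin d)) :=
  convexHull ℝ (⋃ y ∈ Metric.closedBall x σ, clarke f y)

/-! ### Projections, moduli, sharpness -/

/-- `y` is a nearest point of `M` to `x`. -/
def IsNearest {d : ℕ} (M : Set (EuclideanSpace ℝ (Fin d))) (x y : EuclideanSpace ℝ (Fin d)) :
    Prop :=
  y ∈ M ∧ ∀ z ∈ M, ‖y - x‖ ≤ ‖z - x‖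

open Classical in
/-- The projection `P_M` (a nearest point of `M`; the default value `x` is used only at points `x`
that have no nearest point). -/
def proj {d : ℕ} (M : Set (EuclideanSpace ℝ (Fin d))) (x : EuclideanSpace ℝ (Fin d)) :
    EuclideanSpace ℝ (Fin d) :=
  if h : ∃ y, IsNearest M x y then h.choose else x

/-- The smooth extension `f_M = f ∘ P_M` of the restriction of `f` to `M`. Its gradient at points
of `M` is the covariant gradient of `f` along `M`. -/
def extension {d : ℕ} (f : EuclideanSpace ℝ (Fin d) → ℝ) (M : Set (EuclideanSpace ℝ (Fin d)))
    (x : EuclideanSpace ℝ (Fin d)) : ℝ :=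
  f (proj M x)

/-- The covariant gradient `∇_M f(y) = ∇ f_M(y)`. -/
def covGrad {d : ℕ} (f : EuclideanSpace ℝ (Fin d) → ℝ) (M : Set (EuclideanSpace ℝ (Fin d)))
    (y : EuclideanSpace ℝ (Fin d)) : EuclideanSpace ℝ (Fin d) :=
  gradient (extension f M) y

/-- The Lipschitz modulus `limsup_{x, x' → x̄, x ≠ x'} ‖H x - H x'‖ / ‖x - x'‖`. -/
def lipMod {d : ℕ} {Y : Type*} [PseudoEMetricSpace Y] (H : EuclideanSpace ℝ (Fin d) → Y)
    (xbar : EuclideanSpace ℝ (Fin d)) : ℝ≥0∞ :=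
  limsup (fun z : EuclideanSpace ℝ (Fin d) × EuclideanSpace ℝ (Fin d) =>
      edist (H z.1) (H z.2) / edist z.1 z.2)
    (𝓝 (xbar, xbar) ⊓ 𝓟 {z | z.1 ≠ z.2})

/-- `L = 2 lip_f(x̄)`. -/
def lipConst {d : ℕ} (f : EuclideanSpace ℝ (Fin d) → ℝ) (xbar : EuclideanSpace ℝ (Fin d)) : ℝ :=
  2 * (lipMod f xbar).toReal

/-- `μ = (1/4) liminf_{x' → x̄, x' ∉ M} dist(0, ∂f(x'))`. -/
def sharpConst {d : ℕ} (f : EuclideanSpace ℝ (Fin d) → ℝ) (M : Set (EuclideanSpace ℝ (Fin d)))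
    (xbar : EuclideanSpace ℝ (Fin d)) : ℝ :=
  (1 / 4) * (liminf (fun x' => Metric.infEDist 0 (clarke f x')) (𝓝[Mᶜ] xbar)).toReal

/-- Tangent space `T_M(y) = ker ∇F(y)`, where `F` is a local defining map of `M`. -/
def tangent {d m : ℕ} (F : EuclideanSpace ℝ (Fin d) → EuclideanSpace ℝ (Fin m))
    (y : EuclideanSpace ℝ (Fin d)) : Submodule ℝ (EuclideanSpace ℝ (Fin d)) :=
  LinearMap.ker (fderiv ℝ F y).toLinearMap

/-! ### The standing assumption -/

/-- `M` is a `C^p`-smooth manifold around `x̄`, with local defining map `F` on the open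
neighborhood `U` of `x̄`. -/
structure IsManifoldAround {d m : ℕ} (p : ℕ∞) (M U : Set (EuclideanSpace ℝ (Fin d)))
    (F : EuclideanSpace ℝ (Fin d) → EuclideanSpace ℝ (Fin m))
    (xbar : EuclideanSpace ℝ (Fin d)) : Prop where
  isOpen : IsOpen U
  mem : xbar ∈ U
  smooth : ContDiffOn ℝ p F U
  surj : ∀ z ∈ U, Function.Surjective (fderiv ℝ F z)
  eq_zero : M ∩ U = {z ∈ U | F z = 0}

/-- `M` is an active `C^p`-manifold of `f` around `x̄`. -/
structure IsActiveManifold {d m : ℕ} (p : ℕ∞) (f : EuclideanSpace ℝ (Fin d) → ℝ)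
    (M U : Set (EuclideanSpace ℝ (Fin d)))
    (F : EuclideanSpace ℝ (Fin d) → EuclideanSpace ℝ (Fin m))
    (xbar : EuclideanSpace ℝ (Fin d)) : Prop where
  mem : xbar ∈ M
  critical : 0 ∈ clarke f xbar
  manifold : IsManifoldAround p M U F xbar
  smooth_on : ∃ V : Set (EuclideanSpace ℝ (Fin d)), ∃ fhat : EuclideanSpace ℝ (Fin d) → ℝ,
    IsOpen V ∧ xbar ∈ V ∧ ContDiffOn ℝ p fhat V ∧ ∀ z ∈ V ∩ M, fhat z = f z
  sharp : ∃ V ∈ 𝓝 xbar, ∃ c > 0, ∀ x ∈ V \ M, ∀ v ∈ clarke f x, c ≤ ‖v‖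

/-- The main assumption on `f` at `x̄`: locally Lipschitz with local minimizer `x̄`, quadratic
growth with constant `γ`, a `C⁴` active manifold, strong-(a) regularity with constant `Ca`, and
`(b_≤)`-regularity. -/
structure MainAssumption {d m : ℕ} (f : EuclideanSpace ℝ (Fin d) → ℝ)
    (xbar : EuclideanSpace ℝ (Fin d)) (M U : Set (EuclideanSpace ℝ (Fin d)))
    (F : EuclideanSpace ℝ (Fin d) → EuclideanSpace ℝ (Fin m)) (γ Ca : ℝ) : Prop where
  locLip : LocallyLipschitz f
  localMin : IsLocalMin f xbar
  γ_pos : 0 < γ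
  growth : ∀ᶠ x in 𝓝 xbar, γ / 2 * ‖x - xbar‖ ^ 2 ≤ f x - f xbar
  active : IsActiveManifold 4 f M U F xbar
  Ca_pos : 0 < Ca
  strong_a : ∀ᶠ z in 𝓝 (xbar, xbar), z.2 ∈ M → ∀ v ∈ clarke f z.1,
    ‖(tangent F z.2).starProjection (v - covGrad f M z.2)‖ ≤ Ca * ‖z.1 - z.2‖
  b_le : ∃ o : ℝ → ℝ, Tendsto (fun t => o t / t) (𝓝[≠] 0) (𝓝 0) ∧
    ∀ᶠ z in 𝓝 (xbar, xbar), z.2 ∈ M → ∀ v ∈ clarke f z.1,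
      f z.1 + inner ℝ v (z.2 - z.1) + o ‖z.2 - z.1‖ ≤ f z.2

/-! ### The constants -/

/-- A list of the basic constants from which all the others are computed. -/
structure Consts where
  γ : ℝ
  Ca : ℝ
  β : ℝ
  CM : ℝ
  μ : ℝ
  L : ℝ
  δA : ℝ

namespace Consts

def D₁ (c : Consts) : ℝ := c.μ / (8 * (c.μ + c.L))

def D₂ (c : Consts) : ℝ := c.μ / 2

def C₁ (c : Consts) : ℝ := c.γ / 4

def C₂ (c : Consts) : ℝ := min (c.γ / (8 * c.Ca)) (min 1 (1 / c.δA) / 2)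

def C₃ (c : Consts) : ℝ := c.C₁ ^ 2 / (8 * c.L)

def C₄ (c : Consts) : ℝ :=
  min (c.β / (c.Ca * (1 + c.δA)))
    (min (min (c.μ / c.δA) (c.C₃ * c.D₂ / c.β) /
        (4 * (1 + (1 + c.δA) * c.CM) * (c.μ + c.L)))
      (1 / 2))

def C₅ (c : Consts) : ℝ :=
  min (min (c.β / (2 * c.Ca)) (c.C₃ * c.D₂ / (32 * c.Ca * c.β))) (min c.C₄ (c.C₂ / 4))

def δGI (c : Consts) : ℝ := min (c.δA / 4) (c.D₁ / c.CM)

def δND (c : Consts) : ℝ := min c.δGI (c.D₂ / (c.D₁ * c.L * √128))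

def δGrid (c : Consts) : ℝ :=
  min (c.δA / 2) (min (1 / (c.CM * (1 / c.D₁ + 1))) (c.μ / (8 * (c.Ca + c.β))))

def a₁ (c : Consts) : ℝ := min c.D₁ (c.D₂ / c.L)

def a₂ (c : Consts) : ℝ := min (c.C₁ / c.L) c.C₅ / 2

def δLS (c : Consts) : ℝ :=
  min (min (min (c.δA / 2) c.δGI) (min c.δND c.δGrid))
    (min (min (1 / (2 * (c.a₁ + 2 * c.a₂)))
        (c.γ * c.D₁ ^ 2 * (min (c.δGrid / 2) (1 / 4)) ^ 2 / (2 * c.L)))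
      1)

def C₆ (c : Consts) (slb : ℝ) : ℝ :=
  max (max 1 (8 * (c.Ca + 2 * c.β + 2 * c.Ca * (1 / c.D₁)) / slb))
    (max (2 * (1 / c.D₁)) (4 * c.γ * c.D₁ / slb))

def ε₁ (c : Consts) (T : ℕ) : ℝ :=
  max ((c.C₅ ^ 2 * c.L + c.β) * c.L / c.C₃ *
      (1 - 3 * c.μ ^ 2 / (256 * c.L ^ 2)) ^ ((T : ℝ) / 2))
    ((1 - c.μ ^ 2 / (64 * c.L ^ 2)) ^ ((T : ℝ) / 2) * c.L)

def ε₂ (c : Consts) (G : ℕ) : ℝ :=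
  max (max (c.L / min 1 c.a₁ + c.β / (2 * min 1 c.a₁ * c.a₂ ^ 2)) (8 * c.Ca)) c.L *
    (1 / 2) ^ G

def ρ (c : Consts) : ℝ :=
  1 - 1 / 8 * min (c.γ * c.a₂ / (8 * max (4 * c.L * c.a₂ ^ 2) c.β))
    (c.μ * c.a₁ / (4 * max (2 * c.L) (c.β / c.a₂ ^ 2)))

end Consts

/-- The constants attached to `f`, `x̄`, `M`: here `μ` and `L` are computed from `f`. -/
def consts {d : ℕ} (f : EuclideanSpace ℝ (Fin d) → ℝ) (xbar : EuclideanSpace ℝ (Fin d))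
    (M : Set (EuclideanSpace ℝ (Fin d))) (γ Ca β CM δA : ℝ) : Consts where
  γ := γ
  Ca := Ca
  β := β
  CM := CM
  μ := sharpConst f M xbar
  L := lipConst f xbar
  δA := δA

/-- `δA` is a radius of regularity: on `B_{2δA}(x̄)` the projection onto `M` is single valued and
`C³` with Lipschitz Jacobian, `f_M` is `C³` with Lipschitz gradient, and the listed estimates hold.
The theorem asserts that such radii exist. -/
structure IsRegularityRadius {d m : ℕ} (f : EuclideanSpace ℝ (Fin d) → ℝ)
    (xbar : EuclideanSpace ℝ (Fin d)) (M U : Set (EuclideanSpace ℝ (Fin d)))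
    (F : EuclideanSpace ℝ (Fin d) → EuclideanSpace ℝ (Fin m)) (c : Consts) : Prop where
  pos : 0 < c.δA
  proj_unique : ∀ x ∈ Metric.ball xbar (2 * c.δA), ∃! y, IsNearest M x y
  proj_mem : ∀ x ∈ Metric.ball xbar (2 * c.δA), proj M x ∈ U
  proj_smooth : ContDiffOn ℝ 3 (proj M) (Metric.ball xbar (2 * c.δA))
  proj_lip : ∃ K : ℝ≥0, LipschitzOnWith K (fderiv ℝ (proj M)) (Metric.ball xbar (2 * c.δA))
  ext_smooth : ContDiffOn ℝ 3 (extension f M) (Metric.ball xbar (2 * c.δA))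
  ext_lip : ∃ K : ℝ≥0,
    LipschitzOnWith K (gradient (extension f M)) (Metric.ball xbar (2 * c.δA))
  growth : ∀ x ∈ Metric.closedBall xbar (2 * c.δA),
    c.γ / 2 * ‖x - xbar‖ ^ 2 ≤ f x - f xbar
  proj_approx : ∀ x ∈ Metric.ball xbar c.δA, ∀ x' ∈ Metric.ball xbar (2 * c.δA),
    ‖proj M x' - proj M x - (tangent F (proj M x)).starProjection (x' - x)‖ ≤
      c.CM * (Metric.infDist x M ^ 2 + ‖x - x'‖ ^ 2)
  covGrad_lower : ∀ x ∈ Metric.ball xbar c.δA,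
    c.γ / 2 * ‖proj M x - xbar‖ ≤ ‖covGrad f M (proj M x)‖
  covGrad_upper : ∀ x ∈ Metric.ball xbar c.δA,
    ‖covGrad f M (proj M x)‖ ≤ c.β * ‖proj M x - xbar‖
  strong_a₁ : ∀ x ∈ Metric.ball xbar c.δA, ∀ σ : ℝ, 0 < σ → σ ≤ c.δA → ∀ g ∈ goldstein f σ x,
    ‖(tangent F (proj M x)).starProjection (g - covGrad f M (proj M x))‖ ≤
      c.Ca * (Metric.infDist x M + σ)
  strong_a₂ : ∀ x ∈ Metric.ball xbar c.δA, ∀ σ : ℝ, 0 < σ → σ ≤ c.δA → ∀ g ∈ goldstein f σ x,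
    ‖(tangent F (proj M x)).starProjection g‖ ≤
      c.Ca * (Metric.infDist x M + σ) + c.β * ‖proj M x - xbar‖
  strong_a₃ : ∀ x ∈ Metric.ball xbar c.δA, ∀ σ : ℝ, 0 < σ → σ ≤ c.δA →
    ∀ g ∈ goldstein f σ x, ∀ g' ∈ goldstein f σ x,
      ‖(tangent F (proj M x)).starProjection (g - g')‖ ≤
        2 * c.Ca * (Metric.infDist x M + σ)
  aiming : ∀ x ∈ Metric.ball xbar c.δA, ∀ v ∈ clarke f x,
    c.μ * Metric.infDist x M ≤ inner ℝ v (x - proj M x)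
  subgrad : ∀ x ∈ Metric.ball xbar c.δA, ∀ σ : ℝ, 0 < σ → σ ≤ c.δA → ∀ g ∈ goldstein f σ x,
    ‖g‖ ≤ c.L
  gap : ∀ x ∈ Metric.ball xbar c.δA,
    f x - f xbar ≤ c.L * Metric.infDist x M + c.β / 2 * ‖proj M x - xbar‖ ^ 2

/-! ### The algorithms -/

/-- The common condition under which the loops of `TDescent` and `NDescent` go on:
`g ≠ 0` and the step along `-g` of length `σ` does not give more than the prescribed descent. -/
def LoopGoesOn {d : ℕ} (f : EuclideanSpace ℝ (Fin d) → ℝ) (x : EuclideanSpace ℝ (Fin d)) (σ : ℝ)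
    (g : EuclideanSpace ℝ (Fin d)) : Prop :=
  0 < ‖g‖ ∧ f x - f (x - (σ / ‖g‖) • g) ≤ σ / 8 * ‖g‖

/-- `z = argmin {‖w‖ : w ∈ [a, b]}`. -/
def IsMinNorm {d : ℕ} (a b z : EuclideanSpace ℝ (Fin d)) : Prop :=
  z ∈ segment ℝ a b ∧ ∀ w ∈ segment ℝ a b, ‖z‖ ≤ ‖w‖

/-- One pass of the loop of `TDescent` from `g` to `g'`; a loop that has ended keeps its
current vector. -/
def TDescentStep {d : ℕ} (f : EuclideanSpace ℝ (Fin d) → ℝ) (x : EuclideanSpace ℝ (Fin d))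
    (σ : ℝ) (g g' : EuclideanSpace ℝ (Fin d)) : Prop :=
  (LoopGoesOn f x σ g → ∃ ghat ∈ clarke f (x - (σ / ‖g‖) • g), IsMinNorm g ghat g') ∧
  (¬ LoopGoesOn f x σ g → g' = g)

/-- The point `y = x - τ σ ζ / ‖ζ‖` of the segment `[x, x - σ ζ / ‖ζ‖]`, where `ζ = g + r ξ`.
It is the random point of `NDescent` when `ξ` is uniform in the unit ball, so that `ζ` is uniform
in the ball of radius `r` around `g`, and `τ` is uniform in `[0, 1]`. -/
def samplePoint {d : ℕ} (x : EuclideanSpace ℝ (Fin d)) (σ r : ℝ) (ξ : EuclideanSpace ℝ (Fin d))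
    (τ : ℝ) (g : EuclideanSpace ℝ (Fin d)) : EuclideanSpace ℝ (Fin d) :=
  x - (τ * σ / ‖g + r • ξ‖) • (g + r • ξ)

/-- One pass of the loop of `NDescent` from `g` to `g'`, with perturbation radius `r` and samples
`ξ`, `τ`. The subgradient taken at the sampled point `y` is the gradient whenever `f` is
differentiable at `y`. -/
def NDescentStep {d : ℕ} (f : EuclideanSpace ℝ (Fin d) → ℝ) (x : EuclideanSpace ℝ (Fin d))
    (σ r : ℝ) (ξ : EuclideanSpace ℝ (Fin d)) (τ : ℝ) (g g' : EuclideanSpace ℝ (Fin d)) : Prop :=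
  (LoopGoesOn f x σ g → (0 < r ∧ r < σ * ‖g‖) ∧
    ∃ ghat ∈ clarke f (samplePoint x σ r ξ τ g),
      (DifferentiableAt ℝ f (samplePoint x σ r ξ τ g) →
        ghat = gradient f (samplePoint x σ r ξ τ g)) ∧
      IsMinNorm g ghat g') ∧
  (¬ LoopGoesOn f x σ g → g' = g)

/-- The grid `σ_i = 2^{-(G-i)}`. -/
def gridσ (G i : ℕ) : ℝ := (1 / 2) ^ (G - i)

/-- The points among which `linesearch` chooses: `x`, and `x - σ_i v_{i+1} / ‖v_{i+1}‖` for those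
`i < G` with `σ_i ≤ ‖v_{i+1}‖ / s`. Here `w i` stands for `v_{i+1}`. -/
def candidates {d : ℕ} (x : EuclideanSpace ℝ (Fin d)) (s : ℝ) (G : ℕ)
    (w : ℕ → EuclideanSpace ℝ (Fin d)) : Set (EuclideanSpace ℝ (Fin d)) :=
  {x} ∪ {z | ∃ i < G, gridσ G i ≤ ‖w i‖ / s ∧ z = x - (gridσ G i / ‖w i‖) • w i}

/-- One execution of `linesearch (x, g, s, G, T)` with output `xt`.
In round `i < G` the vectors `td i 0, …, td i T` are those of `TDescent (x, v_i, σ_i, T)` and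
`nd i 0, …, nd i T` those of `NDescent (x, u_i, σ_i, T)`, so `u_i = td i T`, `v_{i+1} = nd i T`. -/
structure IsExecution {d : ℕ} (f : EuclideanSpace ℝ (Fin d) → ℝ)
    (x g : EuclideanSpace ℝ (Fin d)) (s : ℝ) (G T : ℕ)
    (td nd : ℕ → ℕ → EuclideanSpace ℝ (Fin d)) (r : ℕ → ℕ → ℝ)
    (ξ : ℕ → ℕ → EuclideanSpace ℝ (Fin d)) (τ : ℕ → ℕ → ℝ)
    (xt : EuclideanSpace ℝ (Fin d)) : Prop where
  start : 0 < G → td 0 0 = g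
  tangent_steps : ∀ i < G, ∀ t < T, TDescentStep f x (gridσ G i) (td i t) (td i (t + 1))
  tangent_to_normal : ∀ i < G, nd i 0 = td i T
  normal_steps : ∀ i < G, ∀ t < T,
    NDescentStep f x (gridσ G i) (r i t) (ξ i t) (τ i t) (nd i t) (nd i (t + 1))
  next_round : ∀ i, i + 1 < G → td (i + 1) 0 = nd i T
  output_mem : xt ∈ candidates x s G (fun i => nd i T)
  output_min : ∀ z ∈ candidates x s G (fun i => nd i T), f xt ≤ f z

/-- A random run of `linesearch (x, g, s, G, T)` with output `xt`. The `σ`-algebra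
`ℱ (i * T + t)` holds the history before pass `t` of `NDescent` in round `i`. The current vector
and the radius `r`, which may be chosen in any way that depends on the past, are known then; the
samples of that pass are independent of it. -/
structure IsRandomRun {d : ℕ} {Ω : Type*} [mΩ : MeasurableSpace Ω] (P : Measure Ω)
    (f : EuclideanSpace ℝ (Fin d) → ℝ) (x g : EuclideanSpace ℝ (Fin d)) (s : ℝ) (G T : ℕ)
    (ℱ : Filtration ℕ mΩ)
    (td nd : ℕ → ℕ → Ω → EuclideanSpace ℝ (Fin d)) (r : ℕ → ℕ → Ω → ℝ)
    (ξ : ℕ → ℕ → Ω → EuclideanSpace ℝ (Fin d)) (τ : ℕ → ℕ → Ω → ℝ)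
    (xt : Ω → EuclideanSpace ℝ (Fin d)) : Prop where
  execution : ∀ᵐ ω ∂P, IsExecution f x g s G T (fun i t => td i t ω) (fun i t => nd i t ω)
    (fun i t => r i t ω) (fun i t => ξ i t ω) (fun i t => τ i t ω) (xt ω)
  nd_adapted : ∀ i < G, ∀ t ≤ T, Measurable[ℱ (i * T + t)] (nd i t)
  r_adapted : ∀ i < G, ∀ t < T, Measurable[ℱ (i * T + t)] (r i t)
  sample_meas : ∀ i < G, ∀ t < T, Measurable[ℱ (i * T + t + 1)] (fun ω => (ξ i t ω, τ i t ω))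
  sample_law : ∀ i < G, ∀ t < T, P.map (fun ω => (ξ i t ω, τ i t ω)) =
    (ProbabilityTheory.cond volume (Metric.ball (0 : EuclideanSpace ℝ (Fin d)) 1)).prod
      (volume.restrict (Icc (0 : ℝ) 1))
  sample_indep : ∀ i < G, ∀ t < T,
    Indep (MeasurableSpace.comap (fun ω => (ξ i t ω, τ i t ω)) inferInstance) (ℱ (i * T + t)) P

end NTDescent

end

namespace NTDescent

/-! Write D = dist(x, M), y = P_M(x) and E = ‖y - x̄‖. The gap f(x) - f(x̄) is at most L D + (β/2)
E², so the proof splits according to whether E or D governs it. In each regime one scale σ of the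
grid fits the geometry: σ between a₂E and 2a₂E if D ≤ a₂²E², and σ between a₁D/2 and a₁D otherwise.
At that scale one of the two loops ends with a vector whose step decreases f by at least (σ/8)‖v‖,
and ‖v‖ is at least of order γE, respectively μ; this is a fixed fraction of the gap, whence ρ. If
the fitting scale is below 2^{-G}, the gap is already at most ε₂.

Tangential regime. By strong (a) the tangential parts of all Goldstein subgradients nearly equal the
covariant gradient, whose size is comparable to E. Once the normal part of g is below C₃E², g has a
uniformly positive inner product with every Goldstein subgradient and the step descends
(`Setting.tangent_stops`). Before that, aiming towards M forces the subgradient at the trial point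
to point against the normal part of g, so passing to the minimal norm element contracts this normal
part (`Setting.tangent_contracts`). Either T passes suffice, or E² is so small that ε₁ bounds the
gap.

Normal regime. Goldstein subgradients of radius at most D₁D have norm at least D₂
(`Setting.D₂_le_norm`). If the step along g fails to descend, the average slope along the random
segment is at most ‖g‖²/2 (`integral_samplePoint_le`), so 1/‖g‖² grows on average by a fixed amount
per pass (`IsMinNorm.inv_sq_ge`) although it never exceeds 1/D₂². A potential supported on the event
that the loop still runs therefore decays geometrically in expectation, and Markov's inequality
bounds the failure probability (`IsRandomRun.measureReal_goesOn_le`).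

Step length. At a scale comparable to the square root of the gap, `TDescent` leaves a vector of that
order (`Setting.norm_TDescent_le`). Norms never grow afterwards, so the test σ_i ≤ ‖v_{i+1}‖/s
limits all later steps (`Setting.norm_out_sub_le`).

Regularity radii. Inverting the Lagrange system of the nearest point problem gives the smooth
projection (`eventually_projection`); the quadratic estimates are Taylor bounds; aiming combines
(b_≤) with linear growth off M, which follows by exact penalization (`sharp_growth`). All nonsmooth
calculus rests on `le_sub_of_le_inner_gradient`, which integrates gradients along nearby lines on
which f is differentiable almost everywhere. -/

/-- Euclidean space of dimension `d`. -/
abbrev Vec (d : ℕ) := EuclideanSpace ℝ (Fin d)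

/-! ### Calculus of locally Lipschitz functions through gradients on generic lines. -/

section Clarke

variable {d : ℕ} {f : Vec d → ℝ}

lemma exists_lipschitzOnWith_closedBall (hf : LocallyLipschitz f) (x : Vec d) (R : ℝ) :
    ∃ K : ℝ≥0, LipschitzOnWith K f (Metric.closedBall x R) :=
  (hf.locallyLipschitzOn (s := Metric.closedBall x R)).exists_lipschitzOnWith_of_compact
    (isCompact_closedBall x R)

lemma ae_differentiableAt_of_locallyLipschitz (hf : LocallyLipschitz f) :
    ∀ᵐ x, DifferentiableAt ℝ f x := by
  have h : ∀ n : ℕ, ∀ᵐ x : Vec d, x ∈ Metric.ball (0 : Vec d) n → DifferentiableAt ℝ f x := by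
    intro n
    obtain ⟨K, hK⟩ := exists_lipschitzOnWith_closedBall hf 0 n
    filter_upwards [(hK.mono Metric.ball_subset_closedBall).ae_differentiableWithinAt_of_mem
      (μ := volume)] with x hx hxn
    exact (hx hxn).differentiableAt (Metric.isOpen_ball.mem_nhds hxn)
  filter_upwards [ae_all_iff.2 h] with x hx
  obtain ⟨n, hn⟩ := exists_nat_gt ‖x‖
  exact hx n (by simpa using hn)

lemma measurable_gradient (f : Vec d → ℝ) : Measurable (gradient f) :=
  (InnerProductSpace.toDual ℝ (Vec d)).symm.continuous.measurable.comp (measurable_fderiv ℝ f)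

/-- For a fixed `s ≠ 0` the map `ζ ↦ x + s • ζ` pulls null sets back to null sets, so Rademacher's
theorem applies for each `s`; Fubini then exchanges the two quantifiers. -/
lemma ae_differentiableAt_line (hf : LocallyLipschitz f) (x : Vec d) :
    ∀ᵐ ζ : Vec d, ∀ᵐ s : ℝ, DifferentiableAt ℝ f (x + s • ζ) := by
  have hm : MeasurableSet {p : Vec d × ℝ | DifferentiableAt ℝ f (x + p.2 • p.1)} := by
    have : Measurable fun p : Vec d × ℝ => x + p.2 • p.1 := by fun_prop
    exact this (measurableSet_of_differentiableAt ℝ f)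
  rw [Measure.ae_ae_comm hm]
  filter_upwards [show ∀ᵐ s : ℝ, s ≠ 0 by simp [ae_iff]] with s hs
  have h1 : ∀ᵐ z : Vec d, DifferentiableAt ℝ f (x + z) :=
    (measurePreserving_add_left volume x).quasiMeasurePreserving.ae
      (ae_differentiableAt_of_locallyLipschitz hf)
  rw [ae_iff] at h1 ⊢
  have := Measure.addHaar_preimage_smul (volume : Measure (Vec d)) hs
    {z : Vec d | ¬ DifferentiableAt ℝ f (x + z)}
  rw [h1, mul_zero] at this
  exact this

lemma ae_differentiableAt_smul_line {x ζ : Vec d} {c : ℝ} (hc : c ≠ 0)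
    (h : ∀ᵐ s : ℝ, DifferentiableAt ℝ f (x + s • ζ)) :
    ∀ᵐ s : ℝ, DifferentiableAt ℝ f (x + s • c • ζ) := by
  rw [ae_iff] at h ⊢
  have := Measure.addHaar_preimage_smul (volume : Measure ℝ) hc
    {s : ℝ | ¬ DifferentiableAt ℝ f (x + s • ζ)}
  rw [h, mul_zero] at this
  convert this using 3
  ext s
  simp [smul_smul, mul_comm]

lemma norm_gradient_le {x : Vec d} {K : ℝ≥0} {s : Set (Vec d)} (hs : s ∈ 𝓝 x)
    (hK : LipschitzOnWith K f s) : ‖gradient f x‖ ≤ K := by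
  rw [gradient, LinearIsometryEquiv.norm_map]
  exact norm_fderiv_le_of_lipschitzOn ℝ hs hK

lemma inner_gradient (f : Vec d → ℝ) (x w : Vec d) :
    inner ℝ (gradient f x) w = fderiv ℝ f x w := by
  simp [gradient]

lemma line_lipschitz (hf : LocallyLipschitz f) (x w : Vec d) :
    ∃ K : ℝ≥0, LipschitzOnWith K (fun s : ℝ => f (x + s • w)) (uIcc 0 1) := by
  have h : LocallyLipschitz fun s : ℝ => f (x + s • w) := by
    refine hf.comp (ContDiff.locallyLipschitz (𝕂 := ℝ) ?_)
    fun_prop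
  exact h.locallyLipschitzOn.exists_lipschitzOnWith_of_compact isCompact_uIcc

lemma deriv_line {x w : Vec d} {s : ℝ} (hs : DifferentiableAt ℝ f (x + s • w)) :
    deriv (fun s : ℝ => f (x + s • w)) s = inner ℝ (gradient f (x + s • w)) w := by
  have h1 : HasDerivAt (fun s : ℝ => x + s • w) w s := by
    simpa using ((hasDerivAt_id s).smul_const w).const_add x
  rw [inner_gradient]
  exact (hs.hasFDerivAt.comp_hasDerivAt s h1).deriv

lemma intervalIntegrable_inner_gradient (hf : LocallyLipschitz f) {x w : Vec d}
    (h : ∀ᵐ s : ℝ, DifferentiableAt ℝ f (x + s • w)) :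
    IntervalIntegrable (fun s : ℝ => inner ℝ (gradient f (x + s • w)) w) volume 0 1 := by
  obtain ⟨K, hK⟩ := line_lipschitz hf x w
  refine hK.absolutelyContinuousOnInterval.intervalIntegrable_deriv.congr_ae ?_
  exact ae_restrict_of_ae (h.mono fun s hs => deriv_line hs)

/-- The restriction of `f` to the segment is Lipschitz, hence absolutely continuous, and so it is
the integral of its derivative. -/
lemma integral_inner_gradient (hf : LocallyLipschitz f) {x w : Vec d}
    (h : ∀ᵐ s : ℝ, DifferentiableAt ℝ f (x + s • w)) :
    ∫ s in (0 : ℝ)..1, inner ℝ (gradient f (x + s • w)) w = f (x + w) - f x := by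
  obtain ⟨K, hK⟩ := line_lipschitz hf x w
  have := hK.absolutelyContinuousOnInterval.integral_deriv_eq_sub
  rw [show f (x + w) - f x = f (x + (1 : ℝ) • w) - f (x + (0 : ℝ) • w) by simp, ← this]
  exact intervalIntegral.integral_congr_ae (h.mono fun s hs _ => (deriv_line hs).symm)

/-- Mean value inequality: a lower bound for the gradients near a segment, in the direction of the
segment, bounds the increment of the function. The segment is perturbed by a rotation only. -/
lemma le_sub_of_le_inner_gradient (hf : LocallyLipschitz f) {x w : Vec d} (hw : w ≠ 0) {c : ℝ}
    (h : ∀ᶠ w' in 𝓝 w, ‖w'‖ = ‖w‖ → ∀ s ∈ Icc (0 : ℝ) 1, DifferentiableAt ℝ f (x + s • w') →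
      c ≤ inner ℝ (gradient f (x + s • w')) w) :
    c ≤ f (x + w) - f x := by
  obtain ⟨K, hK⟩ := exists_lipschitzOnWith_closedBall hf x (‖w‖ + 1)
  -- Rescaling a generic direction to length `‖w‖` keeps the perturbed segment within distance `‖w‖`
  -- of `x`. This is what later allows Goldstein sets of radius exactly `σ`.
  set rot : Vec d → Vec d := fun ζ => (‖w‖ / ‖ζ‖) • ζ with hrot
  have hw0 : ‖w‖ ≠ 0 := norm_ne_zero_iff.2 hw
  have hrotw : rot w = w := by simp [hrot, hw0]
  have hrc : ContinuousAt rot w := by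
    refine ContinuousAt.smul (continuousAt_const.div continuous_norm.continuousAt hw0)
      continuousAt_id
  -- The last term pays for replacing `w` by `rot ζ` inside the inner product. If the claim failed,
  -- `φ` would be negative near `w`, while it is nonnegative at every generic `ζ` near `w`.
  set φ : Vec d → ℝ := fun ζ => f (x + rot ζ) - f x - c + K * ‖rot ζ - w‖ with hφ
  have hφc : ContinuousAt φ w := by
    have : ContinuousAt (fun ζ => f (x + rot ζ)) w :=
      (hf.continuous.continuousAt).comp (continuousAt_const.add hrc)
    exact ((this.sub continuousAt_const).sub continuousAt_const).add
      (continuousAt_const.mul (hrc.sub continuousAt_const).norm)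
  have hφw : φ w = f (x + w) - f x - c := by simp [hφ, hrotw]
  by_contra! hlt
  have hneg : ∀ᶠ ζ in 𝓝 w, φ ζ < 0 := hφc.eventually_lt continuousAt_const (by
    rw [hφw]; linarith)
  have hrt : Tendsto rot (𝓝 w) (𝓝 w) := by
    have := hrc.tendsto; rwa [hrotw] at this
  have hev := hrt.eventually h
  have hne : ∀ᶠ ζ in 𝓝 w, ζ ≠ 0 := isOpen_ne.mem_nhds hw
  have hfreq := (Measure.dense_of_ae (ae_differentiableAt_line hf x)).inter_nhds_nonempty
    (hneg.and (hev.and hne))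
  obtain ⟨ζ, hζ1, hζ2, hζ3, hζ4⟩ := hfreq
  have hζ0 : ‖ζ‖ ≠ 0 := norm_ne_zero_iff.2 hζ4
  have hnorm : ‖rot ζ‖ = ‖w‖ := by
    simp [hrot, norm_smul, hζ0]
  have hae : ∀ᵐ s : ℝ, DifferentiableAt ℝ f (x + s • rot ζ) :=
    ae_differentiableAt_smul_line (div_ne_zero hw0 hζ0) hζ1
  have key : c - K * ‖rot ζ - w‖ ≤ f (x + rot ζ) - f x := by
    rw [← integral_inner_gradient hf hae]
    have : c - K * ‖rot ζ - w‖ = ∫ s in (0 : ℝ)..1, (c - K * ‖rot ζ - w‖) := by simp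
    rw [this]
    refine intervalIntegral.integral_mono_ae_restrict zero_le_one (by simp)
      (intervalIntegrable_inner_gradient hf hae) ?_
    refine (ae_restrict_iff' measurableSet_Icc).2 (hae.mono fun s hs hsI => ?_)
    have h1 := hζ3 hnorm s hsI hs
    have hb : ‖gradient f (x + s • rot ζ)‖ ≤ K := by
      refine norm_gradient_le (s := Metric.closedBall x (‖w‖ + 1)) ?_ hK
      refine mem_of_superset (Metric.ball_mem_nhds _ one_pos) fun z hz => ?_
      rw [Metric.mem_ball] at hz
      rw [Metric.mem_closedBall]
      have h2 : dist (x + s • rot ζ) x ≤ ‖w‖ := by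
        rw [dist_eq_norm, add_sub_cancel_left, norm_smul, hnorm, Real.norm_eq_abs,
          abs_of_nonneg hsI.1]
        exact mul_le_of_le_one_left (norm_nonneg _) hsI.2
      linarith [dist_triangle z (x + s • rot ζ) x]
    have h3 : |inner ℝ (gradient f (x + s • rot ζ)) (rot ζ - w)| ≤ K * ‖rot ζ - w‖ :=
      (abs_real_inner_le_norm _ _).trans (mul_le_mul_of_nonneg_right hb (norm_nonneg _))
    have h4 : inner ℝ (gradient f (x + s • rot ζ)) (rot ζ) =
        inner ℝ (gradient f (x + s • rot ζ)) w +
        inner ℝ (gradient f (x + s • rot ζ)) (rot ζ - w) := by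
      rw [← inner_add_right]; congr 1; abel
    beta_reduce
    rw [h4]
    linarith [neg_abs_le (inner ℝ (gradient f (x + s • rot ζ)) (rot ζ - w))]
  have : φ ζ < 0 := hζ2
  simp only [hφ] at this
  linarith

lemma gradient_mem_clarke {x : Vec d} (hx : DifferentiableAt ℝ f x) :
    gradient f x ∈ clarke f x :=
  subset_convexHull _ _ ⟨fun _ => x, fun _ => hx, tendsto_const_nhds, tendsto_const_nhds⟩

lemma clarke_subset_goldstein {x z : Vec d} {σ : ℝ} (h : ‖z - x‖ ≤ σ) :
    clarke f z ⊆ goldstein f σ x := by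
  refine fun v hv => subset_convexHull _ _ (mem_iUnion₂.2 ⟨z, ?_, hv⟩)
  rwa [Metric.mem_closedBall, dist_eq_norm]

lemma goldstein_mono {x : Vec d} {σ σ' : ℝ} (h : σ ≤ σ') : goldstein f σ x ⊆ goldstein f σ' x :=
  convexHull_mono (biUnion_subset_biUnion_left (Metric.closedBall_subset_closedBall h))

lemma goldstein_subset {x : Vec d} {σ : ℝ} {S : Set (Vec d)} (hS : Convex ℝ S)
    (h : ∀ z, ‖z - x‖ ≤ σ → clarke f z ⊆ S) : goldstein f σ x ⊆ S := by
  refine convexHull_min (iUnion₂_subset fun z hz => h z ?_) hS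
  rwa [← dist_eq_norm, ← Metric.mem_closedBall]

/-- The descent along `-g` is at least what the Goldstein subgradients predict. -/
lemma descent_of_goldstein (hf : LocallyLipschitz f) {x g : Vec d} {σ c : ℝ} (hσ : 0 < σ)
    (hg : g ≠ 0) (h : ∀ w ∈ goldstein f σ x, c ≤ inner ℝ w g) :
    σ / ‖g‖ * c ≤ f x - f (x - (σ / ‖g‖) • g) := by
  have hg0 : 0 < ‖g‖ := norm_pos_iff.2 hg
  set y := x - (σ / ‖g‖) • g with hy
  set w := (σ / ‖g‖) • g with hw
  have hw0 : w ≠ 0 := smul_ne_zero (div_pos hσ hg0).ne' hg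
  have hnw : ‖w‖ = σ := by
    rw [hw, norm_smul, Real.norm_eq_abs, abs_of_pos (div_pos hσ hg0)]; field_simp
  have key : -(σ / ‖g‖ * c) ≥ f (x + -w) - f x := by
    -- A lower bound for the descent along `-w` is a lower bound for the increment of `-f`.
    have hfn : LocallyLipschitz fun z => -f z := hf.neg
    have := le_sub_of_le_inner_gradient hfn (x := x) (w := -w) (neg_ne_zero.2 hw0)
      (c := σ / ‖g‖ * c) ?_
    · linarith
    refine Eventually.of_forall fun w' hw' s hs hd => ?_
    have hd' : DifferentiableAt ℝ f (x + s • w') := by simpa using hd.neg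
    have hgr : gradient (fun z => -f z) (x + s • w') = -gradient f (x + s • w') := by
      simp [gradient, fderiv_fun_neg]
    rw [hgr, inner_neg_neg, hw, inner_smul_right]
    refine mul_le_mul_of_nonneg_left (h _ ?_) (div_pos hσ hg0).le
    refine clarke_subset_goldstein ?_ (gradient_mem_clarke hd')
    rw [add_sub_cancel_left, norm_smul, hw', norm_neg, hnw, Real.norm_eq_abs, abs_of_nonneg hs.1]
    exact mul_le_of_le_one_left hσ.le hs.2
  rw [← sub_eq_add_neg] at key
  linarith

/-- Bounded gradients on a ball give a Lipschitz bound there. -/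
lemma abs_sub_le_of_norm_gradient_le (hf : LocallyLipschitz f) {x₀ : Vec d} {R K : ℝ}
    (h : ∀ z ∈ Metric.ball x₀ R, DifferentiableAt ℝ f z → ‖gradient f z‖ ≤ K)
    {x y : Vec d} (hx : x ∈ Metric.ball x₀ R) (hy : y ∈ Metric.ball x₀ R) :
    |f x - f y| ≤ K * ‖x - y‖ := by
  have main : ∀ x ∈ Metric.ball x₀ R, ∀ y ∈ Metric.ball x₀ R, f x - f y ≤ K * ‖x - y‖ := by
    intro x hx y hy
    rcases eq_or_ne x y with rfl | hxy
    · simp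
    have := le_sub_of_le_inner_gradient hf (x := x) (w := y - x) (sub_ne_zero.2 hxy.symm)
      (c := -(K * ‖x - y‖)) ?_
    · rw [add_sub_cancel] at this; linarith
    have hev : ∀ᶠ w' in 𝓝 (y - x), x + w' ∈ Metric.ball x₀ R := by
      have hc : ContinuousAt (fun w' : Vec d => x + w') (y - x) := by fun_prop
      exact hc.eventually_mem (Metric.isOpen_ball.mem_nhds (by simpa using hy))
    filter_upwards [hev] with w' hw' _ s hs hd
    have hmem : x + s • w' ∈ Metric.ball x₀ R := by
      have := (convex_ball x₀ R).add_smul_sub_mem hx hw' hs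
      simpa using this
    have h1 := abs_real_inner_le_norm (gradient f (x + s • w')) (y - x)
    have h2 := mul_le_mul_of_nonneg_right (h _ hmem hd) (norm_nonneg (y - x))
    rw [norm_sub_rev x y]
    linarith [neg_abs_le (inner ℝ (gradient f (x + s • w')) (y - x))]
  rw [abs_le]
  constructor
  · have := main y hy x hx
    rw [norm_sub_rev] at this
    linarith
  · exact main x hx y hy

end Clarke


/-! ### Upper semicontinuity of the Clarke subdifferential and sharp growth off the manifold. -/

section Sharpness

variable {d : ℕ} {f : Vec d → ℝ}

/-- Gradients near `z` are bounded, so a sequence of counterexamples would have a convergent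
subsequence of gradients, whose limit is a Clarke subgradient violating the hypothesis. -/
lemma eventually_lt_inner_gradient (hf : LocallyLipschitz f) {z u : Vec d} {c : ℝ}
    (h : ∀ v ∈ clarke f z, c < inner ℝ v u) :
    ∀ᶠ z' in 𝓝 z, DifferentiableAt ℝ f z' → c < inner ℝ (gradient f z') u := by
  by_contra hcon
  rw [not_eventually] at hcon
  obtain ⟨K, hK⟩ := exists_lipschitzOnWith_closedBall hf z 1
  have hb : ∀ᶠ z' in 𝓝 z, ‖gradient f z'‖ ≤ K := by
    filter_upwards [Metric.ball_mem_nhds z one_pos] with z' hz'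
    exact norm_gradient_le (mem_of_superset (Metric.isOpen_ball.mem_nhds hz')
      Metric.ball_subset_closedBall) hK
  obtain ⟨s, hs, hs'⟩ := exists_seq_forall_of_frequently (hcon.and_eventually hb)
  push Not at hs'
  obtain ⟨v, -, φ, hφ, hv⟩ := (isCompact_closedBall (0 : Vec d) K).tendsto_subseq
    (x := fun n => gradient f (s n)) (fun n => by simpa using (hs' n).2)
  have hmem : v ∈ clarke f z := subset_convexHull _ _
    ⟨s ∘ φ, fun n => (hs' (φ n)).1.1, hs.comp hφ.tendsto_atTop, hv⟩
  have hle : inner ℝ v u ≤ c :=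
    le_of_tendsto (hv.inner tendsto_const_nhds) (Eventually.of_forall fun n => (hs' (φ n)).1.2)
  exact absurd (h v hmem) (not_lt.2 hle)

lemma clarke_nonempty (hf : LocallyLipschitz f) (z : Vec d) : (clarke f z).Nonempty := by
  by_contra hne
  rw [not_nonempty_iff_eq_empty] at hne
  -- For an empty subdifferential the hypothesis is vacuous, and the conclusion reads `0 < 0` at
  -- some nearby point of differentiability.
  have h := eventually_lt_inner_gradient hf (z := z) (u := 0) (c := 0) (by simp [hne])
  obtain ⟨z', h1, h2⟩ := (Measure.dense_of_ae
    (ae_differentiableAt_of_locallyLipschitz hf)).inter_nhds_nonempty h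
  simpa using h2 h1

lemma norm_le_of_mem_clarke {x v : Vec d} {K : ℝ≥0} {s : Set (Vec d)} (hs : s ∈ 𝓝 x)
    (hK : LipschitzOnWith K f s) (hv : v ∈ clarke f x) : ‖v‖ ≤ K := by
  have : clarke f x ⊆ Metric.closedBall 0 K := by
    refine convexHull_min ?_ (convex_closedBall _ _)
    rintro w ⟨z, -, hz, hw⟩
    rw [mem_closedBall_zero_iff]
    refine le_of_tendsto hw.norm ?_
    filter_upwards [hz.eventually (eventually_mem_nhds_iff.2 hs)] with n hn
    exact norm_gradient_le hn hK
  simpa using this hv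

/-- A local minimizer of `f + c ‖· - x₀‖` has Clarke subgradients of norm arbitrarily close
to at most `c`. -/
lemma exists_mem_clarke_norm_lt (hf : LocallyLipschitz f) {x₀ z : Vec d} {c ε : ℝ} (hc : 0 ≤ c)
    (hmin : IsLocalMin (fun w => f w + c * ‖w - x₀‖) z) (hε : 0 < ε) :
    ∃ v ∈ clarke f z, ‖v‖ < c + ε := by
  by_contra! hcon
  -- Projecting onto the closure avoids having to know that the subdifferential is closed; the slack
  -- `ε` absorbs the difference. The element `v₀` of least norm separates from the origin, so moving
  -- along `-v₀` lowers `f` at a rate above `c`.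
  have hconv : Convex ℝ (closure (clarke f z)) := (convex_convexHull ℝ _).closure
  obtain ⟨v₀, hv₀, hv₀'⟩ := exists_norm_eq_iInf_of_complete_convex
    (clarke_nonempty hf z).closure isClosed_closure.isComplete hconv (0 : Vec d)
  rw [norm_eq_iInf_iff_real_inner_le_zero hconv hv₀] at hv₀'
  have hn : c + ε ≤ ‖v₀‖ := by
    have : closure (clarke f z) ⊆ {v | c + ε ≤ ‖v‖} :=
      closure_minimal hcon (isClosed_le continuous_const continuous_norm)
    exact this hv₀
  have hpos : 0 < ‖v₀‖ := by linarith
  have hin : ∀ v ∈ clarke f z, (c + ε / 2) * ‖v₀‖ < inner ℝ v v₀ := by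
    intro v hv
    have := hv₀' v (subset_closure hv)
    rw [zero_sub, inner_neg_left, inner_sub_right, real_inner_self_eq_norm_sq,
      real_inner_comm] at this
    nlinarith
  obtain ⟨r, hr, hball⟩ := Metric.eventually_nhds_iff_ball.1 (eventually_lt_inner_gradient hf hin)
  obtain ⟨r', hr', hball'⟩ := Metric.eventually_nhds_iff_ball.1 hmin
  -- The segment runs from `z - t • v₀` back to `z`. Its perturbations leave `z` by at most two
  -- displacements of length `min r r' / 4`, hence stay in both balls.
  set t := min r r' / (4 * ‖v₀‖) with ht
  have htp : 0 < t := div_pos (lt_min hr hr') (by linarith)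
  have htn : ‖t • v₀‖ = min r r' / 4 := by
    rw [norm_smul, Real.norm_eq_abs, abs_of_pos htp, ht]; field_simp
  have hmr : 0 < min r r' := lt_min hr hr'
  have h1 := hball' (z - t • v₀) (by
    rw [Metric.mem_ball, dist_eq_norm, sub_sub_cancel_left, norm_neg, htn]
    linarith [min_le_right r r'])
  have h2 := le_sub_of_le_inner_gradient hf (x := z - t • v₀) (w := t • v₀)
    (smul_ne_zero htp.ne' (norm_pos_iff.1 hpos)) (c := t * ((c + ε / 2) * ‖v₀‖)) ?_
  · rw [sub_add_cancel] at h2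
    have h3 : ‖z - t • v₀ - x₀‖ ≤ ‖z - x₀‖ + t * ‖v₀‖ := by
      have : z - t • v₀ - x₀ = (z - x₀) - t • v₀ := by abel
      rw [this]
      refine (norm_sub_le _ _).trans ?_
      rw [norm_smul, Real.norm_eq_abs, abs_of_pos htp]
    have h4 := mul_le_mul_of_nonneg_left h3 hc
    have h5 : 0 < t * ‖v₀‖ * ε := by positivity
    simp only at h1
    nlinarith
  · refine Eventually.of_forall fun w' hw' s hs hd => ?_
    rw [inner_smul_right]
    refine mul_le_mul_of_nonneg_left (hball _ ?_ hd).le htp.le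
    rw [Metric.mem_ball, dist_eq_norm]
    have : z - t • v₀ + s • w' - z = s • w' - t • v₀ := by abel
    rw [this]
    have h6 : ‖s • w'‖ ≤ min r r' / 4 := by
      rw [norm_smul, hw', htn, Real.norm_eq_abs, abs_of_nonneg hs.1]
      exact mul_le_of_le_one_left (by linarith) hs.2
    have h7 := norm_sub_le (s • w') (t • v₀)
    linarith [min_le_left r r']

/-- Exact penalization. A minimizer `z` of `f + c ‖· - x‖` over a ball is interior and has a
subgradient of norm below `c'`, so it lies in `M`. Then `f x - f z ≥ c ‖z - x‖`, and replacing `z`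
by the nearest point `y` costs at most `2 η ‖z - x‖`, because `f` varies slowly along `M`. -/
lemma sharp_growth (hf : LocallyLipschitz f) {M : Set (Vec d)} {xbar x y : Vec d}
    {R c c' η : ℝ} (hxbar : xbar ∈ M) (hc : 0 < c) (hcc : c < c')
    (hmin : ∀ z ∈ Metric.ball xbar R, f xbar ≤ f z)
    (hsharp : ∀ z ∈ Metric.ball xbar R, z ∉ M → ∀ v ∈ clarke f z, c' ≤ ‖v‖)
    (hη : ∀ y ∈ M ∩ Metric.ball xbar R, ∀ y' ∈ M ∩ Metric.ball xbar R,
      f y - f y' ≤ η * ‖y - y'‖) (hη0 : 0 ≤ η) (hηc : 2 * η ≤ c)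
    (hx : ‖x - xbar‖ < R / 4) (hfx : f x - f xbar < c * (R / 4)) (hy : IsNearest M x y) :
    (c - 2 * η) * ‖x - y‖ ≤ f x - f y := by
  have hR : 0 < R := by linarith [norm_nonneg (x - xbar)]
  have hcont : Continuous fun w => f w + c * ‖w - x‖ := by
    have := hf.continuous
    fun_prop
  obtain ⟨z, hz, hzmin⟩ := (isCompact_closedBall xbar (R / 2)).exists_isMinOn
    (Metric.nonempty_closedBall.2 (by linarith)) hcont.continuousOn
  have hzx := hzmin (show x ∈ Metric.closedBall xbar (R / 2) by
    rw [Metric.mem_closedBall, dist_eq_norm]; linarith)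
  simp only [sub_self, norm_zero, mul_zero, add_zero, mem_ofPred_eq] at hzx
  have hzR : z ∈ Metric.ball xbar R := Metric.closedBall_subset_ball (by linarith) hz
  have h1 := hmin z hzR
  have h2 : ‖z - x‖ < R / 4 := by nlinarith
  have h3 : z ∈ Metric.ball xbar (R / 2) := by
    rw [Metric.mem_ball, dist_eq_norm]
    have : z - xbar = (z - x) + (x - xbar) := by abel
    rw [this]
    linarith [norm_add_le (z - x) (x - xbar)]
  have hloc : IsLocalMin (fun w => f w + c * ‖w - x‖) z :=
    (hzmin.on_subset Metric.ball_subset_closedBall).isLocalMin (Metric.isOpen_ball.mem_nhds h3)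
  have hzM : z ∈ M := by
    by_contra hzM
    obtain ⟨v, hv, hv'⟩ := exists_mem_clarke_norm_lt hf hc.le hloc (sub_pos.2 hcc)
    have := hsharp z hzR hzM v hv
    linarith
  have hyz := hy.2 z hzM
  have hyx := hy.2 xbar hxbar
  have hyR : y ∈ Metric.ball xbar R := by
    rw [Metric.mem_ball, dist_eq_norm]
    have : y - xbar = (y - x) + (x - xbar) := by abel
    rw [this]
    rw [norm_sub_rev xbar x] at hyx
    linarith [norm_add_le (y - x) (x - xbar)]
  have h4 := hη y ⟨hy.1, hyR⟩ z ⟨hzM, hzR⟩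
  have h5 : ‖y - z‖ ≤ 2 * ‖z - x‖ := by
    have : y - z = (y - x) - (z - x) := by abel
    rw [this]
    linarith [norm_sub_le (y - x) (z - x)]
  have h6 := mul_le_mul_of_nonneg_left h5 hη0
  have h7 := mul_le_mul_of_nonneg_left hyz (sub_nonneg.2 hηc)
  rw [norm_sub_rev x y]
  linarith

end Sharpness

/-! ### Lipschitz and sharpness moduli. -/

section Moduli

variable {d : ℕ} {Y : Type*} [PseudoEMetricSpace Y]

lemma exists_lipschitzOnWith_ball_of_lipMod_lt {H : Vec d → Y} {xbar : Vec d} {K : ℝ≥0}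
    (h : lipMod H xbar < K) : ∃ r > 0, LipschitzOnWith K H (Metric.ball xbar r) := by
  have hev := eventually_lt_of_limsup_lt h
  rw [eventually_inf_principal, nhds_prod_eq] at hev
  obtain ⟨s, hs, hs'⟩ := mem_prod_same_iff.1 hev
  obtain ⟨r, hr, hrs⟩ := Metric.mem_nhds_iff.1 hs
  refine ⟨r, hr, fun a ha b hb => ?_⟩
  rcases eq_or_ne a b with rfl | hab
  · simp
  have := hs' (mk_mem_prod (hrs ha) (hrs hb)) hab
  simp only at this
  exact (ENNReal.div_le_iff_le_mul (Or.inl (by simpa using hab)) (Or.inl (edist_ne_top _ _))).1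
    this.le

lemma lipMod_le_of_lipschitzOnWith {H : Vec d → Y} {xbar : Vec d} {K : ℝ≥0} {s : Set (Vec d)}
    (hs : s ∈ 𝓝 xbar) (h : LipschitzOnWith K H s) : lipMod H xbar ≤ K := by
  refine limsup_le_of_le (h := ?_)
  rw [eventually_inf_principal]
  filter_upwards [prod_mem_nhds hs hs] with z hz _
  exact ENNReal.div_le_of_le_mul (h hz.1 hz.2)

variable {f : Vec d → ℝ} {M : Set (Vec d)} {xbar : Vec d}

lemma lipMod_lt_top (hf : LocallyLipschitz f) (xbar : Vec d) : lipMod f xbar < ⊤ := by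
  obtain ⟨K, t, ht, hK⟩ := hf xbar
  exact (lipMod_le_of_lipschitzOnWith ht hK).trans_lt ENNReal.coe_lt_top

/-- Any local Lipschitz constant bounds the Clarke subgradients nearby. That `M` is not a
neighbourhood of `xbar` provides points off `M` at which to test; otherwise the lower limit runs
over the trivial filter and is infinite. -/
lemma liminf_infEDist_le_lipMod (hf : LocallyLipschitz f) (hM : M ∉ 𝓝 xbar) :
    liminf (fun x' => Metric.infEDist 0 (clarke f x')) (𝓝[Mᶜ] xbar) ≤ lipMod f xbar := by
  have : (𝓝[Mᶜ] xbar).NeBot := by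
    rw [← mem_closure_iff_nhdsWithin_neBot, closure_compl, mem_compl_iff, mem_interior_iff_mem_nhds]
    exact hM
  refine le_of_forall_gt fun K hK => ?_
  obtain ⟨K', hK'⟩ := ENNReal.lt_iff_exists_nnreal_btwn.1 hK
  obtain ⟨r, hr, hlip⟩ := exists_lipschitzOnWith_ball_of_lipMod_lt hK'.1
  refine lt_of_le_of_lt ?_ hK'.2
  refine liminf_le_of_le (h := ?_)
  intro b hb
  have hball : ∀ᶠ x in 𝓝[Mᶜ] xbar, x ∈ Metric.ball xbar r :=
    eventually_nhdsWithin_of_eventually_nhds (Metric.ball_mem_nhds _ hr)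
  obtain ⟨x, hx1, hx2⟩ := (hb.and hball).exists
  obtain ⟨v, hv⟩ := clarke_nonempty hf x
  refine hx1.trans ((Metric.infEDist_le_edist_of_mem hv).trans ?_)
  rw [edist_dist, dist_zero_left]
  have := norm_le_of_mem_clarke (Metric.isOpen_ball.mem_nhds hx2) hlip hv
  exact ENNReal.ofReal_le_of_le_toReal (by simpa using this)

lemma sharpConst_pos (hf : LocallyLipschitz f) (hM : M ∉ 𝓝 xbar)
    (hs : ∃ V ∈ 𝓝 xbar, ∃ c > 0, ∀ x ∈ V \ M, ∀ v ∈ clarke f x, c ≤ ‖v‖) :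
    0 < sharpConst f M xbar := by
  obtain ⟨V, hV, c, hc, h⟩ := hs
  have h1 : ENNReal.ofReal c ≤
      liminf (fun x' => Metric.infEDist 0 (clarke f x')) (𝓝[Mᶜ] xbar) := by
    refine le_liminf_of_le (h := ?_)
    filter_upwards [mem_nhdsWithin_of_mem_nhds hV, self_mem_nhdsWithin] with x hx hxM
    rw [Metric.le_infEDist]
    intro v hv
    rw [edist_dist, dist_zero_left]
    exact ENNReal.ofReal_le_ofReal (h x ⟨hx, hxM⟩ v hv)
  -- Finiteness matters: `toReal` would send an infinite lower limit to `0`.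
  have h2 := ((liminf_infEDist_le_lipMod hf hM).trans_lt (lipMod_lt_top hf xbar)).ne
  have h3 : 0 < (liminf (fun x' => Metric.infEDist 0 (clarke f x')) (𝓝[Mᶜ] xbar)).toReal :=
    ENNReal.toReal_pos ((ENNReal.ofReal_pos.2 hc).trans_le h1).ne' h2
  unfold sharpConst
  positivity

/-- The factor is 2 · 4, from the definitions of `lipConst` and `sharpConst`. It is the only
relation between `μ` and `L` used in the contraction estimates. -/
lemma eight_mul_sharpConst_le (hf : LocallyLipschitz f) (hM : M ∉ 𝓝 xbar) :
    8 * sharpConst f M xbar ≤ lipConst f xbar := by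
  have := ENNReal.toReal_mono (lipMod_lt_top hf xbar).ne (liminf_infEDist_le_lipMod hf hM)
  unfold sharpConst lipConst
  linarith

lemma eventually_le_norm_of_lt_sharpConst (hf : LocallyLipschitz f)
    (hM : M ∉ 𝓝 xbar) {c : ℝ} (hc0 : 0 ≤ c) (hc : c < 4 * sharpConst f M xbar) :
    ∀ᶠ x in 𝓝 xbar, x ∉ M → ∀ v ∈ clarke f x, c ≤ ‖v‖ := by
  have htop := ((liminf_infEDist_le_lipMod hf hM).trans_lt (lipMod_lt_top hf xbar)).ne
  have h1 : ENNReal.ofReal c <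
      liminf (fun x' => Metric.infEDist 0 (clarke f x')) (𝓝[Mᶜ] xbar) := by
    refine (ENNReal.ofReal_lt_iff_lt_toReal hc0 htop).2 ?_
    unfold sharpConst at hc
    linarith
  have := eventually_lt_of_lt_liminf h1
  rw [eventually_nhdsWithin_iff] at this
  filter_upwards [this] with x hx hxM v hv
  have h2 := (hx hxM).le.trans (Metric.infEDist_le_edist_of_mem hv)
  rw [edist_dist, dist_zero_left] at h2
  exact (ENNReal.ofReal_le_ofReal_iff (norm_nonneg _)).1 h2

end Moduli


/-! ### Smoothness of the nearest point projection onto a manifold. -/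

section Projection

variable {d m : ℕ} {M U : Set (Vec d)} {F : Vec d → Vec m} {xbar : Vec d}

/-- The map whose inverse solves the Lagrange system of the projection onto `{F = 0}`. -/
noncomputable def lagrangeMap (F : Vec d → Vec m) (q : Vec d × Vec m) : Vec d × Vec m :=
  (q.1 + ContinuousLinearMap.adjoint (fderiv ℝ F q.1) q.2, F q.1)

lemma contDiff_adjoint {n : WithTop ℕ∞} : ContDiff ℝ n
    (fun A : Vec d →L[ℝ] Vec m => ContinuousLinearMap.adjoint A) := by
  refine IsBoundedLinearMap.contDiff ⟨⟨fun A B => map_add _ A B, fun c A => ?_⟩, 1, one_pos,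
    fun A => ?_⟩
  · simp
  · simp

lemma contDiffAt_lagrangeMap {q : Vec d × Vec m} (hF : ContDiffAt ℝ 4 F q.1) :
    ContDiffAt ℝ 3 (lagrangeMap F) q := by
  have h1 : ContDiffAt ℝ 3 (fderiv ℝ F) q.1 := hF.fderiv_right (by norm_num)
  have h2 : ContDiffAt ℝ 3 (fun q : Vec d × Vec m =>
      ContinuousLinearMap.adjoint (fderiv ℝ F q.1)) q :=
    contDiff_adjoint.contDiffAt.comp q (h1.comp q contDiffAt_fst)
  refine ContDiffAt.prodMk (contDiffAt_fst.add (h2.clm_apply contDiffAt_snd)) ?_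
  exact (hF.of_le (by norm_num)).comp q contDiffAt_fst

/-- The derivative of `lagrangeMap F` at `(y, 0)` when `A` is the derivative of `F` at `y`. -/
noncomputable def lagrangeDeriv (A : Vec d →L[ℝ] Vec m) : (Vec d × Vec m) →L[ℝ] (Vec d × Vec m) :=
  (ContinuousLinearMap.fst ℝ _ _ + (ContinuousLinearMap.adjoint A).comp
    (ContinuousLinearMap.snd ℝ _ _)).prod (A.comp (ContinuousLinearMap.fst ℝ _ _))

lemma adjoint_injective {A : Vec d →L[ℝ] Vec m} (hA : Function.Surjective A) :
    Function.Injective (ContinuousLinearMap.adjoint A) := by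
  rw [injective_iff_map_eq_zero]
  intro l hl
  obtain ⟨v, rfl⟩ := hA l
  have := ContinuousLinearMap.adjoint_inner_left A v (A v)
  rw [hl, inner_zero_left] at this
  exact inner_self_eq_zero.1 this.symm

/-- Pairing the first component with `v` removes the multiplier term, since `A v = 0`; this gives `v
= 0`, and then `l = 0` because the adjoint of a surjection is injective. -/
lemma lagrangeDeriv_injective {A : Vec d →L[ℝ] Vec m} (hA : Function.Surjective A) :
    Function.Injective (lagrangeDeriv A) := by
  rw [injective_iff_map_eq_zero]
  rintro ⟨v, l⟩ h
  simp only [lagrangeDeriv, ContinuousLinearMap.prod_apply, add_apply,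
    ContinuousLinearMap.coe_fst', ContinuousLinearMap.coe_comp, Function.comp_apply,
    ContinuousLinearMap.coe_snd', Prod.mk_eq_zero] at h
  have h1 := congrArg (fun z => inner ℝ z v) h.1
  simp only [inner_add_left, ContinuousLinearMap.adjoint_inner_left, h.2, inner_zero_right,
    add_zero, inner_zero_left] at h1
  have hv : v = 0 := inner_self_eq_zero.1 h1
  have hl : l = 0 := adjoint_injective hA (by simpa [hv] using h.1)
  simp [hv, hl]

/-- `lagrangeDeriv A` as an equivalence. -/
noncomputable def lagrangeEquiv {A : Vec d →L[ℝ] Vec m} (hA : Function.Surjective A) :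
    (Vec d × Vec m) ≃L[ℝ] (Vec d × Vec m) :=
  (LinearEquiv.ofInjectiveEndo (lagrangeDeriv A).toLinearMap
    (lagrangeDeriv_injective hA)).toContinuousLinearEquiv

lemma coe_lagrangeEquiv {A : Vec d →L[ℝ] Vec m} (hA : Function.Surjective A) :
    (lagrangeEquiv hA : (Vec d × Vec m) →L[ℝ] (Vec d × Vec m)) = lagrangeDeriv A := by
  ext v <;> rfl

/-- The second derivative of `F` enters only multiplied by the multiplier, which is zero at `(y,
0)`. -/
lemma hasFDerivAt_lagrangeMap {y : Vec d} (hF : ContDiffAt ℝ 4 F y) :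
    HasFDerivAt (lagrangeMap F) (lagrangeDeriv (fderiv ℝ F y)) (y, 0) := by
  have h1 : DifferentiableAt ℝ (fderiv ℝ F) y :=
    (hF.fderiv_right (m := 3) (by norm_num)).differentiableAt (by norm_num)
  have h2 : DifferentiableAt ℝ (fun q : Vec d × Vec m =>
      ContinuousLinearMap.adjoint (fderiv ℝ F q.1)) (y, 0) :=
    ((contDiff_adjoint (n := 1)).differentiable (by norm_num)).differentiableAt.comp (y, 0)
      (DifferentiableAt.comp (y, (0 : Vec m)) h1 differentiableAt_fst)
  have h3 := h2.hasFDerivAt.clm_apply (hasFDerivAt_snd (𝕜 := ℝ) (p := (y, (0 : Vec m))))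
  have h4 : HasFDerivAt (fun q : Vec d × Vec m => F q.1)
      ((fderiv ℝ F y).comp (ContinuousLinearMap.fst ℝ _ _)) (y, 0) :=
    HasFDerivAt.comp (y, (0 : Vec m)) (hF.differentiableAt (by norm_num)).hasFDerivAt
      hasFDerivAt_fst
  have h5 := (hasFDerivAt_fst.add h3).prodMk h4
  refine h5.congr_fderiv ?_
  ext v <;> simp [lagrangeDeriv]

/-- The linearized system `v + A* l = w`, `A v = 0` is the orthogonal splitting of `w` into the
kernel of `A` and the range of its adjoint. -/
lemma fst_lagrangeEquiv_symm {A : Vec d →L[ℝ] Vec m} (hA : Function.Surjective A) (w : Vec d) :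
    ((lagrangeEquiv hA).symm (w, 0)).1 = (LinearMap.ker A.toLinearMap).starProjection w := by
  have hq : lagrangeDeriv A ((lagrangeEquiv hA).symm (w, 0)) = (w, 0) :=
    (lagrangeEquiv hA).apply_symm_apply (w, 0)
  generalize (lagrangeEquiv hA).symm (w, 0) = q at hq ⊢
  simp only [lagrangeDeriv, ContinuousLinearMap.prod_apply, add_apply,
    ContinuousLinearMap.coe_fst', ContinuousLinearMap.coe_comp, Function.comp_apply,
    ContinuousLinearMap.coe_snd', Prod.mk.injEq] at hq
  refine (Submodule.eq_starProjection_of_mem_of_inner_eq_zero ?_ fun z hz => ?_).symm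
  · exact hq.2
  · rw [← hq.1, add_sub_cancel_left, ContinuousLinearMap.adjoint_inner_left,
      show A z = 0 from hz, inner_zero_right]

/-- Lagrange's rule for the squared distance. Surjectivity of the derivative excludes a vanishing
coefficient of the objective. -/
lemma exists_multiplier {x y : Vec d} (hM : IsManifoldAround 4 M U F xbar) (hy : y ∈ U)
    (hxy : IsNearest M x y) :
    ∃ l : Vec m, x - y = ContinuousLinearMap.adjoint (fderiv ℝ F y) l := by
  have hFy : ContDiffAt ℝ 4 F y := hM.smooth.contDiffAt (hM.isOpen.mem_nhds hy)
  have hF0 : F y = 0 := (hM.eq_zero.subset ⟨hxy.1, hy⟩).2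
  have hmin : IsLocalMinOn (fun z => ‖z - x‖ ^ 2) {z | F z = F y} y := by
    filter_upwards [mem_nhdsWithin_of_mem_nhds (hM.isOpen.mem_nhds hy), self_mem_nhdsWithin]
      with z hzU hz
    have hzM : z ∈ M := (hM.eq_zero.superset ⟨hzU, by rw [← hF0]; exact hz⟩).1
    exact pow_le_pow_left₀ (norm_nonneg _) (hxy.2 z hzM) 2
  have hφ : HasStrictFDerivAt (fun z : Vec d => ‖z - x‖ ^ 2)
      (2 • (innerSL ℝ (y - x)).comp (ContinuousLinearMap.id ℝ (Vec d))) y := by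
    have := (hasStrictFDerivAt_norm_sq (y - x)).comp y ((hasStrictFDerivAt_id y).sub_const x)
    exact this
  obtain ⟨Λ, Λ₀, hne, h⟩ := IsLocalExtrOn.exists_linear_map_of_hasStrictFDerivAt
    (Or.inl hmin) (hFy.hasStrictFDerivAt (by norm_num)) hφ
  have hΛ₀ : Λ₀ ≠ 0 := by
    rintro rfl
    refine hne (Prod.ext (LinearMap.ext fun z => ?_) rfl)
    obtain ⟨v, rfl⟩ := hM.surj y hy z
    simpa using h v
  set ℓ := (InnerProductSpace.toDual ℝ (Vec m)).symm (LinearMap.toContinuousLinearMap Λ) with hℓ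
  have hℓ' : ∀ z, inner ℝ ℓ z = Λ z := by
    intro z; rw [hℓ, InnerProductSpace.toDual_symm_apply]; rfl
  refine ⟨(1 / (2 * Λ₀)) • ℓ, ext_inner_right ℝ fun v => ?_⟩
  rw [ContinuousLinearMap.adjoint_inner_left, inner_smul_left, hℓ']
  have h1 := h v
  simp only [smul_apply, ContinuousLinearMap.comp_apply,
    ContinuousLinearMap.id_apply, innerSL_apply_apply, smul_eq_mul, nsmul_eq_mul] at h1
  have h2 : inner ℝ (x - y) v = - inner ℝ (y - x) v := by rw [← inner_neg_left, neg_sub]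
  rw [h2]
  simp only [conj_trivial]
  push_cast at h1
  field_simp
  linarith

/-- `M` is closed only locally, so the distance is minimized over a compact piece of it; points of
`M` outside this piece are farther from `x` than `xbar` is. -/
lemma exists_isNearest (hM : IsManifoldAround 4 M U F xbar) (hx : xbar ∈ M) :
    ∀ᶠ x in 𝓝 xbar, ∃ y, IsNearest M x y := by
  obtain ⟨ρ, hρ, hρU⟩ := Metric.nhds_basis_closedBall.mem_iff.1 (hM.isOpen.mem_nhds hM.mem)
  have hcomp : IsCompact (M ∩ Metric.closedBall xbar ρ) := by
    have : M ∩ Metric.closedBall xbar ρ = Metric.closedBall xbar ρ ∩ F ⁻¹' {0} := by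
      ext z
      constructor
      · exact fun hz => ⟨hz.2, (hM.eq_zero.subset ⟨hz.1, hρU hz.2⟩).2⟩
      · exact fun hz => ⟨(hM.eq_zero.superset ⟨hρU hz.1, hz.2⟩).1, hz.1⟩
    rw [this]
    exact (isCompact_closedBall _ _).of_isClosed_subset
      ((hM.smooth.continuousOn.mono hρU).preimage_isClosed_of_isClosed Metric.isClosed_closedBall
        isClosed_singleton) inter_subset_left
  filter_upwards [Metric.ball_mem_nhds xbar (half_pos hρ)] with x hxb
  rw [mem_ball_iff_norm] at hxb
  obtain ⟨y, hy, hymin⟩ := hcomp.exists_isMinOn ⟨xbar, hx, Metric.mem_closedBall_self hρ.le⟩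
    (f := fun z => ‖z - x‖) (by fun_prop)
  refine ⟨y, hy.1, fun z hz => ?_⟩
  by_cases hzb : z ∈ Metric.closedBall xbar ρ
  · exact hymin ⟨hz, hzb⟩
  · have h1 : ‖y - x‖ ≤ ‖xbar - x‖ := hymin ⟨hx, Metric.mem_closedBall_self hρ.le⟩
    rw [Metric.mem_closedBall, dist_eq_norm, not_le] at hzb
    have h2 : z - xbar = (z - x) + (x - xbar) := by abel
    rw [h2] at hzb
    rw [norm_sub_rev xbar x] at h1
    have h3 := norm_add_le (z - x) (x - xbar)
    linarith

lemma proj_isNearest {x : Vec d} (h : ∃ y, IsNearest M x y) : IsNearest M x (proj M x) := by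
  unfold proj
  rw [dif_pos h]
  exact h.choose_spec

/-- Near a point of a `C⁴` manifold the projection is single valued and `C³`, and its derivative
at points of the manifold is the orthogonal projection onto the tangent space. -/
theorem eventually_projection (hM : IsManifoldAround 4 M U F xbar) (hx : xbar ∈ M) :
    ∀ᶠ x in 𝓝 xbar, (∃! y, IsNearest M x y) ∧ proj M x ∈ U ∧ ContDiffAt ℝ 3 (proj M) x ∧
      (x ∈ M → HasFDerivAt (proj M) (tangent F x).starProjection x) := by
  have hFU : ∀ y ∈ U, ContDiffAt ℝ 4 F y := fun y hy =>
    hM.smooth.contDiffAt (hM.isOpen.mem_nhds hy)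
  have hF0 : F xbar = 0 := (hM.eq_zero.subset ⟨hx, hM.mem⟩).2
  have hΦ : ContDiffAt ℝ 3 (lagrangeMap F) (xbar, 0) := contDiffAt_lagrangeMap (hFU _ hM.mem)
  have hΦ' : ∀ y (hy : y ∈ U), HasFDerivAt (lagrangeMap F)
      (lagrangeEquiv (hM.surj y hy) : (Vec d × Vec m) →L[ℝ] (Vec d × Vec m)) (y, 0) := by
    intro y hy
    rw [coe_lagrangeEquiv]
    exact hasFDerivAt_lagrangeMap (hFU y hy)
  have h30 : (3 : WithTop ℕ∞) ≠ 0 := by norm_num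
  set e := hΦ.toOpenPartialHomeomorph (lagrangeMap F) (hΦ' xbar hM.mem) h30 with he
  have hecoe : ∀ q, e q = lagrangeMap F q := fun q => rfl
  have hsrc : ((xbar, 0) : Vec d × Vec m) ∈ e.source :=
    hΦ.mem_toOpenPartialHomeomorph_source (hΦ' xbar hM.mem) h30
  have hval : ∀ y ∈ M ∩ U, lagrangeMap F (y, 0) = (y, 0) := by
    intro y hy
    simp [lagrangeMap, (hM.eq_zero.subset hy).2]
  have hsym : ∀ y ∈ M ∩ U, (y, (0 : Vec m)) ∈ e.source → e.symm (y, 0) = (y, 0) := by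
    intro y hy hys
    have := e.left_inv hys
    rwa [hecoe, hval y hy] at this
  have htgt : ((xbar, 0) : Vec d × Vec m) ∈ e.target := by
    have := e.map_source hsrc
    rwa [hecoe, hval xbar ⟨hx, hM.mem⟩] at this
  set p : Vec d → Vec d := fun x => (e.symm (x, 0)).1 with hp
  have hps : ContDiffAt ℝ 3 e.symm (xbar, 0) := by
    refine e.contDiffAt_symm htgt (f₀' := lagrangeEquiv (hM.surj xbar hM.mem)) ?_ ?_
    · rw [hsym xbar ⟨hx, hM.mem⟩ hsrc]; exact hΦ' xbar hM.mem
    · rw [hsym xbar ⟨hx, hM.mem⟩ hsrc]; exact hΦ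
  have hpc : ContDiffAt ℝ 3 p xbar := by
    have h1 : ContDiffAt ℝ 3 (fun x : Vec d => (x, (0 : Vec m))) xbar :=
      contDiffAt_id.prodMk contDiffAt_const
    exact contDiffAt_fst.comp xbar (ContDiffAt.comp xbar hps h1)
  -- multipliers are small near `xbar`
  obtain ⟨K, hK, hanti⟩ := LinearMap.exists_antilipschitzWith
    (ContinuousLinearMap.adjoint (fderiv ℝ F xbar)).toLinearMap
    (LinearMap.ker_eq_bot.2 (adjoint_injective (hM.surj xbar hM.mem)))
  have hmult : ∀ᶠ y in 𝓝 xbar, ∀ l : Vec m,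
      ‖l‖ ≤ 2 * K * ‖ContinuousLinearMap.adjoint (fderiv ℝ F y) l‖ := by
    have hc : ContinuousAt (fun y => ContinuousLinearMap.adjoint (fderiv ℝ F y)) xbar :=
      (contDiff_adjoint (n := 0)).continuous.continuousAt.comp
        ((hFU xbar hM.mem).fderiv_right (m := 3) (by norm_num)).continuousAt
    have hK2 : (0 : ℝ) < 1 / (2 * K) := by positivity
    filter_upwards [Metric.continuousAt_iff'.1 hc _ hK2] with y hy l
    rw [dist_eq_norm] at hy
    have h1 : ‖l‖ ≤ K * ‖ContinuousLinearMap.adjoint (fderiv ℝ F xbar) l‖ := by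
      have := hanti.le_mul_dist l 0
      simpa using this
    have h2 := (ContinuousLinearMap.adjoint (fderiv ℝ F y) -
      ContinuousLinearMap.adjoint (fderiv ℝ F xbar)).le_of_opNorm_le hy.le l
    rw [sub_apply] at h2
    have h3 := norm_sub_norm_le (ContinuousLinearMap.adjoint (fderiv ℝ F xbar) l)
      (ContinuousLinearMap.adjoint (fderiv ℝ F y) l)
    rw [norm_sub_rev] at h3
    have hKp : (0 : ℝ) < K := hK
    have h4 : K * (1 / (2 * K) * ‖l‖) = ‖l‖ / 2 := by field_simp
    nlinarith
  obtain ⟨r, hr, hrs⟩ : ∃ r > 0, ∀ y : Vec d, ∀ l : Vec m, ‖y - xbar‖ < r → ‖l‖ < r →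
      y ∈ U ∧ (y, l) ∈ e.source ∧ (∀ l : Vec m,
      ‖l‖ ≤ 2 * K * ‖ContinuousLinearMap.adjoint (fderiv ℝ F y) l‖) := by
    have ht : Tendsto (fun q : Vec d × Vec m => q.1) (𝓝 (xbar, 0)) (𝓝 xbar) := continuousAt_fst
    have h0 : ∀ᶠ q in 𝓝 ((xbar, 0) : Vec d × Vec m), q ∈ e.source := e.open_source.mem_nhds hsrc
    have h1 : ∀ᶠ q in 𝓝 ((xbar, 0) : Vec d × Vec m), q.1 ∈ U ∧ q ∈ e.source ∧ ∀ l : Vec m,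
        ‖l‖ ≤ 2 * K * ‖ContinuousLinearMap.adjoint (fderiv ℝ F q.1) l‖ :=
      (ht.eventually (hM.isOpen.mem_nhds hM.mem)).and (h0.and (ht.eventually hmult))
    obtain ⟨r, hr, h⟩ := Metric.eventually_nhds_iff.1 h1
    refine ⟨r, hr, fun y l hy hl => h (y := (y, l)) ?_⟩
    rw [Prod.dist_eq, max_lt_iff]
    exact ⟨by simpa [dist_eq_norm] using hy, by simpa using hl⟩
  -- For `x` close to `xbar` both a nearest point and its multiplier are close enough to `(xbar, 0)`
  -- to lie in the source of the local inverse. The Lagrange system then determines them, which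
  -- gives uniqueness and smoothness together.
  have key : ∀ᶠ x in 𝓝 xbar, ∀ y, IsNearest M x y → y ∈ U ∧ y = p x := by
    set s := min (r / 2) (r / (2 * K + 1)) with hs
    have hKp : (0 : ℝ) < K := hK
    have hsp : 0 < s := lt_min (half_pos hr) (by positivity)
    filter_upwards [Metric.ball_mem_nhds xbar hsp] with x hxs y hxy
    rw [mem_ball_iff_norm] at hxs
    have h1 := hxy.2 xbar hx
    rw [norm_sub_rev xbar] at h1
    have h2 : ‖y - xbar‖ < r := by
      have : y - xbar = (y - x) + (x - xbar) := by abel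
      rw [this]
      linarith [norm_add_le (y - x) (x - xbar), min_le_left (r / 2) (r / (2 * K + 1))]
    obtain ⟨hyU, -, hyl⟩ := hrs y 0 h2 (by simpa using hr)
    obtain ⟨l, hl⟩ := exists_multiplier hM hyU hxy
    have h3 := hyl l
    rw [← hl, norm_sub_rev] at h3
    have h4 : ‖l‖ < r := by
      have h5 : ‖y - x‖ < r / (2 * K + 1) := by
        linarith [min_le_right (r / 2) (r / (2 * K + 1))]
      rw [lt_div_iff₀ (by positivity)] at h5
      nlinarith [norm_nonneg (y - x)]
    obtain ⟨-, hys, -⟩ := hrs y l h2 h4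
    have h6 : e (y, l) = (x, 0) := by
      rw [hecoe, lagrangeMap]
      simp only [← hl, (hM.eq_zero.subset ⟨hxy.1, hyU⟩).2, add_sub_cancel]
    refine ⟨hyU, ?_⟩
    rw [hp]
    simp only
    rw [← h6, e.left_inv hys]
  have hproj : ∀ᶠ x in 𝓝 xbar, proj M x = p x := by
    filter_upwards [key, exists_isNearest hM hx] with x h1 h2
    exact (h1 _ (proj_isNearest h2)).2
  have hderiv : ∀ᶠ x in 𝓝 xbar, x ∈ M → HasFDerivAt p (tangent F x).starProjection x := by
    filter_upwards [Metric.ball_mem_nhds xbar hr] with x hxr hxM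
    rw [mem_ball_iff_norm] at hxr
    obtain ⟨hxU, hxs, -⟩ := hrs x 0 hxr (by simpa using hr)
    have h1 := hsym x ⟨hxM, hxU⟩ hxs
    have h2 : ((x, 0) : Vec d × Vec m) ∈ e.target := by
      have := e.map_source hxs
      rwa [hecoe, hval x ⟨hxM, hxU⟩] at this
    have h3 := e.hasFDerivAt_symm (f' := lagrangeEquiv (hM.surj x hxU)) h2
      (by rw [h1]; exact hΦ' x hxU)
    have h4 : HasFDerivAt (fun x : Vec d => (x, (0 : Vec m)))
        ((ContinuousLinearMap.id ℝ (Vec d)).prod 0) x :=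
      (hasFDerivAt_id x).prodMk (hasFDerivAt_const _ _)
    have h5 := (hasFDerivAt_fst (𝕜 := ℝ)).comp x (HasFDerivAt.comp x h3 h4)
    refine h5.congr_fderiv ?_
    ext w : 1
    exact fst_lagrangeEquiv_symm (hM.surj x hxU) w
  filter_upwards [key, exists_isNearest hM hx, hproj.eventually_nhds, hpc.eventually (by simp),
    hderiv] with x h1 h2 h3 h4 h5
  refine ⟨⟨proj M x, proj_isNearest h2, fun y hy => ?_⟩, (h1 _ (proj_isNearest h2)).1, ?_, ?_⟩
  · rw [(h1 y hy).2, (h1 _ (proj_isNearest h2)).2]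
  · exact h4.congr_of_eventuallyEq h3
  · exact fun hxM => (h5 hxM).congr_of_eventuallyEq h3

end Projection


/-! ### Second order Taylor estimates. -/

section Taylor

variable {E G : Type*} [NormedAddCommGroup E] [NormedSpace ℝ E] [NormedAddCommGroup G]
  [NormedSpace ℝ G]

/-- The remainder along the segment has derivative at most `C * t * ‖w‖ ^ 2`, so it stays below the
primitive of this bound. Only increments of the derivative from the base point are needed. -/
lemma norm_sub_fderiv_le {g : E → G} {s : Set E} (hs : Convex ℝ s) {C : ℝ} {x x' : E}
    (hx : x ∈ s) (hx' : x' ∈ s) (hd : ∀ z ∈ s, DifferentiableAt ℝ g z)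
    (hC : ∀ z ∈ s, ‖fderiv ℝ g z - fderiv ℝ g x‖ ≤ C * ‖z - x‖) :
    ‖g x' - g x - fderiv ℝ g x (x' - x)‖ ≤ C / 2 * ‖x' - x‖ ^ 2 := by
  set w := x' - x with hw
  have hmem : ∀ t ∈ Icc (0 : ℝ) 1, x + t • w ∈ s := fun t ht => hs.add_smul_sub_mem hx hx' ht
  have hk : ∀ t ∈ Icc (0 : ℝ) 1, HasDerivAt (fun t : ℝ => g (x + t • w) - g x - t • fderiv ℝ g x w)
      (fderiv ℝ g (x + t • w) w - fderiv ℝ g x w) t := by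
    intro t ht
    have h1 : HasDerivAt (fun t : ℝ => x + t • w) w t := by
      simpa using ((hasDerivAt_id t).smul_const w).const_add x
    have h2 := (hd _ (hmem t ht)).hasFDerivAt.comp_hasDerivAt t h1
    have h3 : HasDerivAt (fun t : ℝ => t • fderiv ℝ g x w) (fderiv ℝ g x w) t := by
      simpa using (hasDerivAt_id t).smul_const (fderiv ℝ g x w)
    exact (h2.sub_const _).sub h3
  have hB : ∀ t : ℝ, HasDerivAt (fun t : ℝ => C / 2 * ‖w‖ ^ 2 * t ^ 2) (C * t * ‖w‖ ^ 2) t := by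
    intro t
    refine ((hasDerivAt_pow 2 t).const_mul (C / 2 * ‖w‖ ^ 2)).congr_deriv ?_
    norm_num; ring
  have := image_norm_le_of_norm_deriv_right_le_deriv_boundary
    (f := fun t : ℝ => g (x + t • w) - g x - t • fderiv ℝ g x w)
    (f' := fun t => fderiv ℝ g (x + t • w) w - fderiv ℝ g x w) (a := 0) (b := 1)
    (fun t ht => (hk t ht).continuousAt.continuousWithinAt)
    (fun t ht => (hk t (Ico_subset_Icc_self ht)).hasDerivWithinAt)
    (B := fun t : ℝ => C / 2 * ‖w‖ ^ 2 * t ^ 2) (B' := fun t => C * t * ‖w‖ ^ 2)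
    (by simp) hB (fun t ht => by
      have h1 := (fderiv ℝ g (x + t • w) - fderiv ℝ g x).le_of_opNorm_le
        (hC _ (hmem t (Ico_subset_Icc_self ht))) w
      rw [sub_apply, add_sub_cancel_left, norm_smul, Real.norm_eq_abs, abs_of_nonneg ht.1] at h1
      linarith) (right_mem_Icc.2 zero_le_one)
  simp only [one_smul, one_pow, mul_one] at this
  rwa [hw, add_sub_cancel] at this

/-- At a critical point of a `C²` function, `h' y (y - x) = 2 (h y - h x) + o(‖y - x‖²)`. -/
lemma eventually_fderiv_sub_le {h : E → ℝ} {x : E} (hh : ContDiffAt ℝ 2 h x)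
    (h0 : fderiv ℝ h x = 0) {ε : ℝ} (hε : 0 < ε) :
    ∀ᶠ y in 𝓝 x, 2 * (h y - h x) - ε * ‖y - x‖ ^ 2 ≤ fderiv ℝ h y (y - x) := by
  have hd : DifferentiableAt ℝ (fderiv ℝ h) x :=
    (hh.fderiv_right (m := 1) (by norm_num)).differentiableAt (by norm_num)
  have h1 := (hasFDerivAt_iff_isLittleO.1 hd.hasFDerivAt).def (show (0 : ℝ) < ε / 4 by linarith)
  have h2 : ∀ᶠ y in 𝓝 x, DifferentiableAt ℝ h y :=
    (hh.eventually (by simp)).mono fun y hy => hy.differentiableAt (by norm_num)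
  obtain ⟨r, hr, hball⟩ := Metric.eventually_nhds_iff_ball.1 (h1.and h2)
  filter_upwards [Metric.ball_mem_nhds x hr] with y hy
  set w := y - x with hw
  have hmem : ∀ t ∈ Icc (0 : ℝ) 1, x + t • w ∈ Metric.ball x r := fun t ht =>
    (convex_ball x r).add_smul_sub_mem (Metric.mem_ball_self hr) hy ht
  -- The derivative of `2 h(x + t w) - t² h'(y) w` nearly vanishes, because at a critical point
  -- `h'(x + t w)` is `t h'(y)` to first order.
  have hk : ∀ t ∈ Icc (0 : ℝ) 1, HasDerivWithinAt
      (fun t : ℝ => 2 * h (x + t • w) - t ^ 2 * fderiv ℝ h y w)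
      (2 * fderiv ℝ h (x + t • w) w - 2 * t * fderiv ℝ h y w) (Icc 0 1) t := by
    intro t ht
    have h3 : HasDerivAt (fun t : ℝ => x + t • w) w t := by
      simpa using ((hasDerivAt_id t).smul_const w).const_add x
    have h4 := ((hball _ (hmem t ht)).2.hasFDerivAt.comp_hasDerivAt t h3).const_mul 2
    have h5 := (hasDerivAt_pow 2 t).mul_const (fderiv ℝ h y w)
    refine ((h4.sub h5).congr_deriv ?_).hasDerivWithinAt
    norm_num
  have hbound : ∀ t ∈ Ico (0 : ℝ) 1,
      ‖2 * fderiv ℝ h (x + t • w) w - 2 * t * fderiv ℝ h y w‖ ≤ ε * ‖w‖ ^ 2 := by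
    intro t ht
    have h3 := (hball _ (hmem t (Ico_subset_Icc_self ht))).1
    have h4 := (hball _ hy).1
    rw [h0, sub_zero, add_sub_cancel_left, map_smul, norm_smul, Real.norm_eq_abs,
      abs_of_nonneg ht.1] at h3
    rw [h0, sub_zero, ← hw] at h4
    set B := fderiv ℝ (fderiv ℝ h) x w with hB
    have h5 := (fderiv ℝ h (x + t • w) - t • B).le_of_opNorm_le h3 w
    have h6 := (fderiv ℝ h y - B).le_of_opNorm_le h4 w
    rw [sub_apply] at h5 h6
    rw [smul_apply, smul_eq_mul, Real.norm_eq_abs] at h5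
    rw [Real.norm_eq_abs] at h6 ⊢
    have h7 : 2 * fderiv ℝ h (x + t • w) w - 2 * t * fderiv ℝ h y w =
        2 * (fderiv ℝ h (x + t • w) w - t * B w) - 2 * t * (fderiv ℝ h y w - B w) := by ring
    have h8 : |2 * t * (fderiv ℝ h y w - B w)| ≤ 2 * (ε / 4 * ‖w‖ * ‖w‖) := by
      rw [abs_mul, abs_of_nonneg (by linarith [ht.1] : 0 ≤ 2 * t)]
      have := abs_nonneg (fderiv ℝ h y w - B w)
      nlinarith [ht.2, ht.1]
    have h9 : |2 * (fderiv ℝ h (x + t • w) w - t * B w)| ≤ 2 * (ε / 4 * ‖w‖ * ‖w‖) := by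
      rw [abs_mul, abs_two]
      have : ε / 4 * (t * ‖w‖) * ‖w‖ ≤ ε / 4 * ‖w‖ * ‖w‖ := by
        have h10 : t * ‖w‖ ≤ ‖w‖ := mul_le_of_le_one_left (norm_nonneg _) ht.2.le
        gcongr
      linarith
    rw [h7]
    refine (abs_sub _ _).trans ?_
    linarith
  have := norm_image_sub_le_of_norm_deriv_le_segment_01' hk hbound
  simp only [one_smul, one_pow, one_mul, zero_smul, add_zero, Real.norm_eq_abs] at this
  rw [hw, add_sub_cancel, ← hw] at this
  have := (abs_le.1 this).2
  nlinarith

end Taylor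

/-! ### Elementary facts on nearest points. -/

section Nearest

variable {d : ℕ} {M : Set (Vec d)} {x y : Vec d}

lemma infDist_eq_of_isNearest (h : IsNearest M x y) : Metric.infDist x M = ‖x - y‖ := by
  refine le_antisymm ?_ ?_
  · rw [← dist_eq_norm]; exact Metric.infDist_le_dist_of_mem h.1
  · refine (Metric.le_infDist ⟨y, h.1⟩).2 fun z hz => ?_
    rw [dist_eq_norm, norm_sub_rev x y, norm_sub_rev x z]
    exact h.2 z hz

lemma proj_eq_self (h : x ∈ M) : proj M x = x := by
  have h1 : IsNearest M x (proj M x) := proj_isNearest ⟨x, h, fun z _ => by simp⟩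
  have := h1.2 x h
  rw [sub_self, norm_zero] at this
  exact sub_eq_zero.1 (norm_le_zero_iff.1 this)

lemma norm_sub_le_of_isNearest {xbar : Vec d} (hx : xbar ∈ M) (h : IsNearest M x y) :
    ‖x - y‖ ≤ ‖x - xbar‖ := by
  rw [norm_sub_rev x y, norm_sub_rev x xbar]; exact h.2 _ hx

lemma norm_sub_le_two_mul_of_isNearest {xbar : Vec d} (hx : xbar ∈ M) (h : IsNearest M x y) :
    ‖y - xbar‖ ≤ 2 * ‖x - xbar‖ := by
  have h1 := norm_sub_le_of_isNearest hx h
  have : y - xbar = (x - xbar) - (x - y) := by abel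
  rw [this]
  linarith [norm_sub_le (x - xbar) (x - y)]

lemma extension_eq_of_mem {f : Vec d → ℝ} (h : x ∈ M) : extension f M x = f x := by
  rw [extension, proj_eq_self h]

lemma norm_gradient_sub_gradient (f g : Vec d → ℝ) (x y : Vec d) :
    ‖gradient f x - gradient g y‖ = ‖fderiv ℝ f x - fderiv ℝ g y‖ := by
  rw [gradient, gradient, ← map_sub, LinearIsometryEquiv.norm_map]

end Nearest


/-! ### Existence of regularity radii. -/

section RegularityRadius

variable {d m : ℕ} {f : Vec d → ℝ} {xbar : Vec d} {M U : Set (Vec d)} {F : Vec d → Vec m}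
  {γ Ca β CM : ℝ}

lemma sharpConst_pos_of_mainAssumption (hf : MainAssumption f xbar M U F γ Ca)
    (hM : M ∉ 𝓝 xbar) : 0 < sharpConst f M xbar :=
  sharpConst_pos hf.locLip hM hf.active.sharp

lemma eventually_contDiffAt_extension (hf : MainAssumption f xbar M U F γ Ca) :
    ∀ᶠ x in 𝓝 xbar, ContDiffAt ℝ 3 (extension f M) x := by
  have hp := eventually_projection hf.active.manifold hf.active.mem
  obtain ⟨V, fhat, hV, hxV, hsm, hfhat⟩ := hf.active.smooth_on
  have hpx := hp.self_of_nhds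
  have hproj : proj M xbar = xbar := proj_eq_self hf.active.mem
  have h1 : ContDiffAt ℝ 3 (fhat ∘ proj M) xbar := by
    refine ContDiffAt.comp xbar ?_ hpx.2.2.1
    rw [hproj]
    exact (hsm.contDiffAt (hV.mem_nhds hxV)).of_le (by exact_mod_cast (by norm_num))
  have h2 : ∀ᶠ x in 𝓝 xbar, extension f M x = (fhat ∘ proj M) x := by
    have hc : Tendsto (proj M) (𝓝 xbar) (𝓝 xbar) := by
      have := hpx.2.2.1.continuousAt.tendsto
      rwa [hproj] at this
    filter_upwards [hc.eventually (hV.mem_nhds hxV), hp] with x hxV hx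
    exact (hfhat _ ⟨hxV, (proj_isNearest hx.1.exists).1⟩).symm
  exact (h1.congr_of_eventuallyEq h2).eventually (by simp)

lemma fderiv_extension_eq_zero (hf : MainAssumption f xbar M U F γ Ca) :
    fderiv ℝ (extension f M) xbar = 0 := by
  have hpx := (eventually_projection hf.active.manifold hf.active.mem).self_of_nhds
  have hproj : proj M xbar = xbar := proj_eq_self hf.active.mem
  refine IsLocalMin.fderiv_eq_zero ?_
  have hc : Tendsto (proj M) (𝓝 xbar) (𝓝 xbar) := by
    have := hpx.2.2.1.continuousAt.tendsto
    rwa [hproj] at this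
  filter_upwards [hc.eventually hf.localMin] with x hx
  simpa [extension, hproj] using hx

/-- Quadratic growth bounds twice the increment by `γ ‖y - xbar‖ ^ 2` from below, and the Taylor
error is allowed to use half of it; Cauchy–Schwarz turns the slope into the norm of the gradient. -/
lemma eventually_le_norm_covGrad (hf : MainAssumption f xbar M U F γ Ca) :
    ∀ᶠ y in 𝓝 xbar, y ∈ M → γ / 2 * ‖y - xbar‖ ≤ ‖covGrad f M y‖ := by
  have h1 := eventually_fderiv_sub_le
    ((eventually_contDiffAt_extension hf).self_of_nhds.of_le (by norm_num))
    (fderiv_extension_eq_zero hf) (half_pos hf.γ_pos)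
  filter_upwards [h1, hf.growth] with y hy hg hyM
  rw [extension_eq_of_mem hyM, extension_eq_of_mem hf.active.mem] at hy
  rcases eq_or_ne y xbar with rfl | hne
  · simp
  have h2 : 0 < ‖y - xbar‖ := norm_pos_iff.2 (sub_ne_zero.2 hne)
  have h3 : fderiv ℝ (extension f M) y (y - xbar) ≤ ‖covGrad f M y‖ * ‖y - xbar‖ := by
    rw [← inner_gradient]
    exact real_inner_le_norm _ _
  refine le_of_mul_le_mul_right ?_ h2
  nlinarith

/-- Proximal aiming: `b_≤`-regularity together with sharp growth off the manifold. -/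
lemma eventually_aiming (hf : MainAssumption f xbar M U F γ Ca) (hM : M ∉ 𝓝 xbar) :
    ∀ᶠ x in 𝓝 xbar, ∀ v ∈ clarke f x,
      sharpConst f M xbar * Metric.infDist x M ≤ inner ℝ v (x - proj M x) := by
  set μ := sharpConst f M xbar with hμdef
  have hμ : 0 < μ := sharpConst_pos_of_mainAssumption hf hM
  have hp := eventually_projection hf.active.manifold hf.active.mem
  have hsharp := eventually_le_norm_of_lt_sharpConst hf.locLip hM (c := 7 / 2 * μ) (by positivity)
    (by rw [← hμdef]; linarith)
  have hstrict : HasStrictFDerivAt (extension f M) (0 : Vec d →L[ℝ] ℝ) xbar := by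
    have := (eventually_contDiffAt_extension hf).self_of_nhds.hasStrictFDerivAt (by norm_num)
    rwa [fderiv_extension_eq_zero hf] at this
  obtain ⟨s, hs, hlip⟩ := hstrict.exists_lipschitzOnWith_of_nnnorm_lt (μ / 2).toNNReal
    (by simpa using hμ)
  obtain ⟨o, ho, hb⟩ := hf.b_le
  have ho' : ∀ᶠ t in 𝓝[≠] (0 : ℝ), |o t / t| < μ := by
    have := ho.abs
    rw [abs_zero] at this
    exact this.eventually_lt_const hμ
  rw [eventually_nhdsWithin_iff] at ho'
  obtain ⟨ρ, hρ, hoρ⟩ := Metric.eventually_nhds_iff.1 ho'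
  rw [nhds_prod_eq] at hb
  obtain ⟨s', hs', hbs⟩ := mem_prod_same_iff.1 hb
  have hmin := hf.localMin
  obtain ⟨R, hR, hall⟩ := Metric.eventually_nhds_iff_ball.1
    (((hsharp.and hmin).and (Eventually.and hs hs')).and hp)
  have hcont : ∀ᶠ x in 𝓝 xbar, f x - f xbar < 3 * μ * (R / 4) := by
    have : Tendsto (fun x => f x - f xbar) (𝓝 xbar) (𝓝 0) := by
      have := (hf.locLip.continuous.tendsto xbar).sub_const (f xbar)
      rwa [sub_self] at this
    exact this.eventually_lt_const (by positivity)
  have hsmall : 0 < min (R / 4) ρ := lt_min (by linarith) hρ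
  filter_upwards [hcont, Metric.ball_mem_nhds xbar hsmall] with x hfx hx v hv
  rw [mem_ball_iff_norm] at hx
  have hxR : ‖x - xbar‖ < R / 4 := hx.trans_le (min_le_left _ _)
  have hxball : x ∈ Metric.ball xbar R := by rw [mem_ball_iff_norm]; linarith
  have hnear := proj_isNearest (hall x hxball).2.1.exists
  set y := proj M x with hy
  have hyball : y ∈ Metric.ball xbar R := by
    rw [mem_ball_iff_norm]
    linarith [norm_sub_le_two_mul_of_isNearest hf.active.mem hnear]
  -- Off `M` subgradients have norm at least `7 / 2 * μ`, a value below the lower limit `4 * μ`;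
  -- along `M` the slope is at most `μ / 2`, as the extension is critical at `xbar`. This yields
  -- growth `2 * μ`, of which the error term of (b_≤) takes at most `μ`.
  have hgrow := sharp_growth hf.locLip (c := 3 * μ) (c' := 7 / 2 * μ) (η := μ / 2)
    hf.active.mem (by positivity) (by linarith) (fun z hz => (hall z hz).1.1.2)
    (fun z hz => (hall z hz).1.1.1) (fun a ha b hb => by
      have h1 := hlip.dist_le_mul a (hall a ha.2).1.2.1 b (hall b hb.2).1.2.1
      rw [extension_eq_of_mem ha.1, extension_eq_of_mem hb.1, Real.dist_eq, dist_eq_norm,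
        Real.coe_toNNReal _ (half_pos hμ).le] at h1
      exact (le_abs_self _).trans h1) (half_pos hμ).le (by linarith) hxR hfx hnear
  rw [infDist_eq_of_isNearest hnear]
  rcases eq_or_ne x y with hxy | hxy
  · rw [← hxy]; simp
  have hD : 0 < ‖x - y‖ := norm_pos_iff.2 (sub_ne_zero.2 hxy)
  have hbx := hbs (mk_mem_prod (hall x hxball).1.2.2 (hall y hyball).1.2.2) hnear.1 v hv
  simp only at hbx
  rw [norm_sub_rev y x] at hbx
  have hoD := hoρ (y := ‖x - y‖) (by
    rw [Real.dist_eq, sub_zero, abs_of_pos hD]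
    linarith [norm_sub_le_of_isNearest hf.active.mem hnear, min_le_right (R / 4) ρ])
    hD.ne'
  rw [abs_div, abs_of_pos hD, div_lt_iff₀ hD] at hoD
  have h2 : inner ℝ v (y - x) = - inner ℝ v (x - y) := by rw [← inner_neg_right, neg_sub]
  rw [h2] at hbx
  linarith [neg_abs_le (o ‖x - y‖)]

lemma lipMod_lt_ofReal_lipConst (hf : MainAssumption f xbar M U F γ Ca) (hM : M ∉ 𝓝 xbar) :
    lipMod f xbar < ENNReal.ofReal (lipConst f xbar) := by
  have h1 := sharpConst_pos_of_mainAssumption hf hM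
  have h2 := eight_mul_sharpConst_le hf.locLip hM
  rw [ENNReal.lt_ofReal_iff_toReal_lt (lipMod_lt_top hf.locLip xbar).ne]
  unfold lipConst at *
  linarith

theorem exists_isRegularityRadius (hf : MainAssumption f xbar M U F γ Ca) (hM : M ∉ 𝓝 xbar)
    (hβ : lipMod (gradient (extension f M)) xbar < ENNReal.ofReal β)
    (hCM : lipMod (fderiv ℝ (proj M)) xbar < ENNReal.ofReal CM) :
    ∃ δA : ℝ, IsRegularityRadius f xbar M U F (consts f xbar M γ Ca β CM δA) := by
  have hβ0 : 0 < β := ENNReal.ofReal_pos.1 (pos_of_gt hβ)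
  have hCM0 : 0 < CM := ENNReal.ofReal_pos.1 (pos_of_gt hCM)
  have hmem := hf.active.mem
  have hμ := sharpConst_pos_of_mainAssumption hf hM
  have hL0 : 0 < lipConst f xbar := by linarith [eight_mul_sharpConst_le hf.locLip hM]
  obtain ⟨r₁, hr₁, hlipβ⟩ := exists_lipschitzOnWith_ball_of_lipMod_lt hβ
  obtain ⟨r₂, hr₂, hlipCM⟩ := exists_lipschitzOnWith_ball_of_lipMod_lt hCM
  obtain ⟨r₃, hr₃, hlipf⟩ := exists_lipschitzOnWith_ball_of_lipMod_lt
    (lipMod_lt_ofReal_lipConst hf hM)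
  have hst := hf.strong_a
  rw [nhds_prod_eq] at hst
  obtain ⟨s, hs, hst'⟩ := mem_prod_same_iff.1 hst
  have e₁ : ∀ᶠ x in 𝓝 xbar, x ∈ Metric.ball xbar r₁ := Metric.ball_mem_nhds xbar hr₁
  have e₂ : ∀ᶠ x in 𝓝 xbar, x ∈ Metric.ball xbar r₂ := Metric.ball_mem_nhds xbar hr₂
  have e₃ : ∀ᶠ x in 𝓝 xbar, x ∈ Metric.ball xbar r₃ := Metric.ball_mem_nhds xbar hr₃
  obtain ⟨R, hR, hall⟩ := Metric.eventually_nhds_iff_ball.1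
    ((((eventually_projection hf.active.manifold hmem).and
      (eventually_contDiffAt_extension hf)).and
      ((eventually_le_norm_covGrad hf).and (eventually_aiming hf hM))).and
      ((hf.growth.and hs).and (e₁.and (e₂.and e₃))))
  -- Nearest points may double the distance to `xbar`, and Goldstein neighbours add a further `δ`;
  -- the quarter keeps them all within the ball where the estimates hold.
  set δ := R / 4 with hδ
  have hδ0 : 0 < δ := by positivity
  have hb4 : ∀ x, ‖x - xbar‖ < R → x ∈ Metric.ball xbar R := fun x hx => by
    rwa [mem_ball_iff_norm]
  have hb2 : ∀ x ∈ Metric.ball xbar (2 * δ), x ∈ Metric.ball xbar R :=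
    Metric.ball_subset_ball (by linarith)
  have hb1 : ∀ x ∈ Metric.ball xbar δ, x ∈ Metric.ball xbar R :=
    Metric.ball_subset_ball (by linarith)
  have hnear : ∀ x ∈ Metric.ball xbar R, IsNearest M x (proj M x) := fun x hx =>
    proj_isNearest (hall x hx).1.1.1.1.exists
  have hy2 : ∀ x ∈ Metric.ball xbar δ, proj M x ∈ Metric.ball xbar (2 * δ) := fun x hx => by
    have := norm_sub_le_two_mul_of_isNearest hmem (hnear x (hb1 x hx))
    rw [mem_ball_iff_norm] at hx ⊢
    linarith
  have hDx : ∀ x ∈ Metric.ball xbar R, Metric.infDist x M = ‖x - proj M x‖ := fun x hx =>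
    infDist_eq_of_isNearest (hnear x hx)
  have hLβ : ∀ a ∈ Metric.ball xbar R, ∀ b ∈ Metric.ball xbar R,
      ‖fderiv ℝ (extension f M) a - fderiv ℝ (extension f M) b‖ ≤ β * ‖a - b‖ := by
    intro a ha b hb
    have := hlipβ.dist_le_mul a (hall a ha).2.2.1 b (hall b hb).2.2.1
    rwa [dist_eq_norm, dist_eq_norm, norm_gradient_sub_gradient, Real.coe_toNNReal _ hβ0.le]
      at this
  have hLCM : ∀ a ∈ Metric.ball xbar R, ∀ b ∈ Metric.ball xbar R,
      ‖fderiv ℝ (proj M) a - fderiv ℝ (proj M) b‖ ≤ CM * ‖a - b‖ := by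
    intro a ha b hb
    have := hlipCM.dist_le_mul a (hall a ha).2.2.2.1 b (hall b hb).2.2.2.1
    rwa [dist_eq_norm, dist_eq_norm, Real.coe_toNNReal _ hCM0.le] at this
  have hLf : ∀ a ∈ Metric.ball xbar R, ∀ b ∈ Metric.ball xbar R,
      f a - f b ≤ lipConst f xbar * ‖a - b‖ := by
    intro a ha b hb
    have := hlipf.dist_le_mul a (hall a ha).2.2.2.2 b (hall b hb).2.2.2.2
    rw [Real.dist_eq, dist_eq_norm, Real.coe_toNNReal _ hL0.le] at this
    exact (le_abs_self _).trans this
  have hxbarR : xbar ∈ Metric.ball xbar R := Metric.mem_ball_self hR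
  have hgold : ∀ x ∈ Metric.ball xbar δ, ∀ σ : ℝ, σ ≤ δ → ∀ z, ‖z - x‖ ≤ σ →
      z ∈ Metric.ball xbar (2 * δ) := by
    intro x hx σ hσ z hz
    rw [mem_ball_iff_norm] at hx ⊢
    have : z - xbar = (z - x) + (x - xbar) := by abel
    rw [this]
    linarith [norm_add_le (z - x) (x - xbar)]
  have hupper : ∀ x ∈ Metric.ball xbar δ,
      ‖covGrad f M (proj M x)‖ ≤ β * ‖proj M x - xbar‖ := by
    intro x hx
    have h1 := hLβ _ (hb2 _ (hy2 x hx)) _ hxbarR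
    rw [← norm_gradient_sub_gradient] at h1
    have h2 : gradient (extension f M) xbar = 0 := by
      simp [gradient, fderiv_extension_eq_zero hf]
    rwa [h2, sub_zero] at h1
  have hstrong : ∀ x ∈ Metric.ball xbar δ, ∀ σ : ℝ, 0 < σ → σ ≤ δ → ∀ g ∈ goldstein f σ x,
      ‖(tangent F (proj M x)).starProjection (g - covGrad f M (proj M x))‖ ≤
        Ca * (Metric.infDist x M + σ) := by
    intro x hx σ _ hσ g hg
    set A := (tangent F (proj M x)).starProjection with hA
    -- The estimate cuts out a convex set of vectors, so it passes from Clarke subgradients to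
    -- Goldstein subgradients.
    have hconv : Convex ℝ (A ⁻¹' (Metric.closedBall (A (covGrad f M (proj M x)))
        (Ca * (Metric.infDist x M + σ)))) :=
      (convex_closedBall _ _).linear_preimage A.toLinearMap
    have hsub := goldstein_subset (f := f) (x := x) (σ := σ) hconv fun z hz v hv => by
      rw [mem_preimage, Metric.mem_closedBall, dist_eq_norm, ← map_sub]
      have h1 := hst' (mk_mem_prod (hall z (hb2 z (hgold x hx σ hσ z hz))).2.1.2
        (hall _ (hb2 _ (hy2 x hx))).2.1.2) (hnear x (hb1 x hx)).1 v hv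
      refine h1.trans (mul_le_mul_of_nonneg_left ?_ hf.Ca_pos.le)
      rw [hDx x (hb1 x hx)]
      simp only
      have : z - proj M x = (x - proj M x) + (z - x) := by abel
      rw [this]
      exact (norm_add_le _ _).trans (by linarith)
    have := hsub hg
    rwa [mem_preimage, Metric.mem_closedBall, dist_eq_norm, ← map_sub] at this
  refine ⟨δ, ?_⟩
  constructor
  case pos => exact hδ0
  case proj_unique => exact fun x hx => (hall x (hb2 x hx)).1.1.1.1
  case proj_mem => exact fun x hx => (hall x (hb2 x hx)).1.1.1.2.1
  case proj_smooth => exact fun x hx => (hall x (hb2 x hx)).1.1.1.2.2.1.contDiffWithinAt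
  case proj_lip => exact ⟨_, hlipCM.mono fun x hx => (hall x (hb2 x hx)).2.2.2.1⟩
  case ext_smooth => exact fun x hx => (hall x (hb2 x hx)).1.1.2.contDiffWithinAt
  case ext_lip => exact ⟨_, hlipβ.mono fun x hx => (hall x (hb2 x hx)).2.2.1⟩
  case growth =>
    exact fun x hx => (hall x (Metric.closedBall_subset_ball
      (show 2 * δ < R by linarith) hx)).2.1.1
  case proj_approx =>
    intro x hx x' hx'
    show _ ≤ CM * (Metric.infDist x M ^ 2 + ‖x - x'‖ ^ 2)
    have hyM := (hnear x (hb1 x hx)).1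
    have hyR := hb2 _ (hy2 x hx)
    -- Taylor expansion at `x`, followed by the replacement of the derivative at `x` by the one at
    -- the nearest point, which is the tangent projection. The second error, `CM * D * ‖x' - x‖`, is
    -- split by the arithmetic–geometric mean inequality.
    have h1 := norm_sub_fderiv_le (convex_ball xbar R) (g := proj M) (C := CM) (hb1 x hx)
      (hb2 x' hx') (fun z hz => (hall z hz).1.1.1.2.2.1.differentiableAt (by norm_num))
      (fun z hz => hLCM z hz x (hb1 x hx))
    have h2 := ((hall _ hyR).1.1.1.2.2.2 hyM).fderiv
    have h3 := (fderiv ℝ (proj M) x - fderiv ℝ (proj M) (proj M x)).le_of_opNorm_le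
      (hLCM x (hb1 x hx) _ hyR) (x' - x)
    rw [h2, sub_apply, ← hDx x (hb1 x hx)] at h3
    have h4 : proj M x' - proj M x - (tangent F (proj M x)).starProjection (x' - x) =
        (proj M x' - proj M x - fderiv ℝ (proj M) x (x' - x)) +
        (fderiv ℝ (proj M) x (x' - x) - (tangent F (proj M x)).starProjection (x' - x)) := by
      abel
    rw [h4, norm_sub_rev x x']
    refine (norm_add_le _ _).trans ((add_le_add h1 h3).trans ?_)
    nlinarith [mul_nonneg hCM0.le (sq_nonneg (Metric.infDist x M - ‖x' - x‖)),
      mul_nonneg hCM0.le (sq_nonneg (Metric.infDist x M))]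
  case covGrad_lower =>
    exact fun x hx => (hall _ (hb2 _ (hy2 x hx))).1.2.1 (hnear x (hb1 x hx)).1
  case covGrad_upper => exact hupper
  case strong_a₁ => exact hstrong
  case strong_a₂ =>
    intro x hx σ hσ0 hσ g hg
    have h1 := hstrong x hx σ hσ0 hσ g hg
    have h2 := (hupper x hx)
    have h3 := (tangent F (proj M x)).norm_starProjection_apply_le (covGrad f M (proj M x))
    rw [map_sub] at h1
    have h4 := norm_sub_norm_le ((tangent F (proj M x)).starProjection g)
      ((tangent F (proj M x)).starProjection (covGrad f M (proj M x)))
    show _ ≤ Ca * (Metric.infDist x M + σ) + β * ‖proj M x - xbar‖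
    linarith
  case strong_a₃ =>
    intro x hx σ hσ0 hσ g hg g' hg'
    have h1 := hstrong x hx σ hσ0 hσ g hg
    have h2 := hstrong x hx σ hσ0 hσ g' hg'
    have h3 : g - g' = (g - covGrad f M (proj M x)) - (g' - covGrad f M (proj M x)) := by abel
    rw [h3, map_sub]
    show _ ≤ 2 * Ca * (Metric.infDist x M + σ)
    refine (norm_sub_le _ _).trans ?_
    linarith
  case aiming => exact fun x hx => (hall x (hb1 x hx)).1.2.2
  case subgrad =>
    intro x hx σ _ hσ g hg
    have := goldstein_subset (f := f) (x := x) (σ := σ) (convex_closedBall 0 (lipConst f xbar))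
      (fun z hz v hv => by
        rw [mem_closedBall_zero_iff]
        have := norm_le_of_mem_clarke (Metric.isOpen_ball.mem_nhds
          (hall z (hb2 z (hgold x hx σ hσ z hz))).2.2.2.2) hlipf hv
        rwa [Real.coe_toNNReal _ hL0.le] at this)
    show ‖g‖ ≤ lipConst f xbar
    simpa using this hg
  case gap =>
    intro x hx
    show _ ≤ lipConst f xbar * Metric.infDist x M + β / 2 * ‖proj M x - xbar‖ ^ 2
    have hyR := hb2 _ (hy2 x hx)
    have h1 := hLf x (hb1 x hx) _ hyR
    have h2 := norm_sub_fderiv_le (convex_ball xbar R) (g := extension f M) (C := β) hxbarR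
      hyR (fun z hz => (hall z hz).1.1.2.differentiableAt (by norm_num))
      (fun z hz => hLβ z hz xbar hxbarR)
    rw [fderiv_extension_eq_zero hf, zero_apply, sub_zero, extension_eq_of_mem hmem,
      extension_eq_of_mem (hnear x (hb1 x hx)).1] at h2
    rw [hDx x (hb1 x hx)]
    linarith [(abs_le.1 h2).2]

end RegularityRadius


/-! ### Contraction under minimal norm elements of segments. -/

section MinNorm

variable {d : ℕ} {a b z : Vec d}

lemma IsMinNorm.inner_nonneg (h : IsMinNorm a b z) {w : Vec d} (hw : w ∈ segment ℝ a b) :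
    0 ≤ inner ℝ z (w - z) := by
  have hinf : ‖(0 : Vec d) - z‖ = ⨅ w : segment ℝ a b, ‖(0 : Vec d) - w‖ := by
    have : Nonempty (segment ℝ a b) := ⟨⟨z, h.1⟩⟩
    refine le_antisymm (le_ciInf fun w => ?_) ?_
    · simpa using h.2 w w.2
    · exact ciInf_le ⟨0, by rintro _ ⟨w, rfl⟩; exact norm_nonneg _⟩ (⟨z, h.1⟩ : segment ℝ a b)
  have := (norm_eq_iInf_iff_real_inner_le_zero (convex_segment a b) h.1).1 hinf w hw
  rw [zero_sub, inner_neg_left] at this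
  linarith

lemma IsMinNorm.norm_le (h : IsMinNorm a b z) : ‖z‖ ≤ ‖a‖ := h.2 a (left_mem_segment ℝ a b)

lemma IsMinNorm.norm_sq_le (h : IsMinNorm a b z) {t : ℝ} (ht : t ∈ Icc (0 : ℝ) 1) :
    ‖z‖ ^ 2 ≤ ‖a‖ ^ 2 - 2 * t * inner ℝ (a - b) a + t ^ 2 * ‖a - b‖ ^ 2 := by
  have h1 : a - t • (a - b) ∈ segment ℝ a b := by
    rw [segment_eq_image']
    exact ⟨t, ht, by simp only [smul_sub]; abel⟩
  have h2 := pow_le_pow_left₀ (norm_nonneg _) (h.2 _ h1) 2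
  rw [norm_sub_sq_real, inner_smul_right, norm_smul, mul_pow, Real.norm_eq_abs, sq_abs,
    real_inner_comm] at h2
  linarith

/-- If the inner product with the new vector is negative, the norm contracts. -/
lemma IsMinNorm.norm_sq_le_of_inner_le (h : IsMinNorm a b z) {μ L : ℝ} (hμ : 0 < μ)
    (hμL : 8 * μ ≤ L) (ha : ‖a‖ ≤ L) (hb : ‖b‖ ≤ L) (hab : inner ℝ b a ≤ -(μ / 2 * ‖a‖)) :
    ‖z‖ ^ 2 ≤ (1 - μ ^ 2 / (64 * L ^ 2)) * ‖a‖ ^ 2 := by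
  have hL : 0 < L := by linarith
  have hn := norm_nonneg a
  -- This parameter minimizes the quadratic bound `-μ ‖a‖² t/‖a‖ + 4 L² t²`, the first term being
  -- `-t * (μ * ‖a‖)`.
  have ht : μ * ‖a‖ / (8 * L ^ 2) ∈ Icc (0 : ℝ) 1 := by
    refine ⟨by positivity, ?_⟩
    rw [div_le_one (by positivity)]
    nlinarith
  have h1 := h.norm_sq_le ht
  have h2 : ‖a - b‖ ^ 2 ≤ 4 * L ^ 2 := by
    have := pow_le_pow_left₀ (norm_nonneg _) ((norm_sub_le a b).trans (add_le_add ha hb)) 2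
    linarith
  have h3 : μ / 2 * ‖a‖ ≤ inner ℝ (a - b) a := by
    rw [inner_sub_left, real_inner_self_eq_norm_sq]
    nlinarith
  have h4 : (μ * ‖a‖ / (8 * L ^ 2)) ^ 2 * ‖a - b‖ ^ 2 ≤
      (μ * ‖a‖ / (8 * L ^ 2)) ^ 2 * (4 * L ^ 2) := by gcongr
  have h5 : 2 * (μ * ‖a‖ / (8 * L ^ 2)) * (μ / 2 * ‖a‖) ≤
      2 * (μ * ‖a‖ / (8 * L ^ 2)) * inner ℝ (a - b) a :=
    mul_le_mul_of_nonneg_left h3 (by positivity)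
  have h6 : (μ * ‖a‖ / (8 * L ^ 2)) ^ 2 * (4 * L ^ 2) = μ ^ 2 / (16 * L ^ 2) * ‖a‖ ^ 2 := by
    field_simp; ring
  have h7 : 2 * (μ * ‖a‖ / (8 * L ^ 2)) * (μ / 2 * ‖a‖) = 2 * (μ ^ 2 / (16 * L ^ 2) * ‖a‖ ^ 2) := by
    field_simp; ring
  have h8 : μ ^ 2 / (64 * L ^ 2) * ‖a‖ ^ 2 ≤ μ ^ 2 / (16 * L ^ 2) * ‖a‖ ^ 2 := by
    gcongr; norm_num
  linarith

lemma norm_sq_eq_add (K : Submodule ℝ (Vec d)) (v : Vec d) :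
    ‖v‖ ^ 2 = ‖K.starProjection v‖ ^ 2 + ‖v - K.starProjection v‖ ^ 2 := by
  have h := K.starProjection_inner_eq_zero v _ (K.starProjection_apply_mem v)
  have h2 := norm_add_sq_real (K.starProjection v) (v - K.starProjection v)
  rw [add_sub_cancel, real_inner_comm, h] at h2
  linarith

lemma inner_eq_add (K : Submodule ℝ (Vec d)) (v w : Vec d) :
    inner ℝ v w = inner ℝ (K.starProjection v) (K.starProjection w) +
      inner ℝ v (w - K.starProjection w) := by
  have h := K.starProjection_inner_eq_zero v _ (K.starProjection_apply_mem w)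
  rw [inner_sub_left] at h
  rw [inner_sub_right]
  linarith

lemma inner_sub_starProjection (K : Submodule ℝ (Vec d)) (v w : Vec d) :
    inner ℝ (v - K.starProjection v) (w - K.starProjection w) =
      inner ℝ v (w - K.starProjection w) := by
  have h := K.starProjection_inner_eq_zero w _ (K.starProjection_apply_mem v)
  rw [inner_sub_left, real_inner_comm _ (K.starProjection v), h, sub_zero]

lemma norm_sub_starProjection_le (K : Submodule ℝ (Vec d)) (v : Vec d) :
    ‖v - K.starProjection v‖ ≤ ‖v‖ := by
  have := norm_sq_eq_add K v
  exact le_of_sq_le_sq (by nlinarith [sq_nonneg ‖K.starProjection v‖]) (norm_nonneg _)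

/-- The normal part contracts if the tangential parts of the two vectors are close enough. -/
lemma IsMinNorm.normal_norm_sq_le (h : IsMinNorm a b z) (K : Submodule ℝ (Vec d)) {μ L : ℝ}
    (hμ : 0 < μ) (hμL : 8 * μ ≤ L) (ha : ‖a‖ ≤ L) (hb : ‖b‖ ≤ L)
    (hpos : 0 < ‖a - K.starProjection a‖)
    (hN : inner ℝ b (a - K.starProjection a) ≤ -(μ / 2 * ‖a - K.starProjection a‖))
    (hT : |inner ℝ (K.starProjection (a - b)) (K.starProjection a)| ≤
      μ / 8 * ‖a - K.starProjection a‖) :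
    ‖z - K.starProjection z‖ ^ 2 ≤
      (1 - 3 * μ ^ 2 / (256 * L ^ 2)) * ‖a - K.starProjection a‖ ^ 2 := by
  have hL : 0 < L := by linarith
  set n := ‖a - K.starProjection a‖ with hn
  have hnL : n ≤ L := (norm_sub_starProjection_le K a).trans ha
  set A := inner ℝ (a - b) (a - K.starProjection a) with hA
  set B := inner ℝ (K.starProjection (a - b)) (K.starProjection a) with hB
  have hAn : μ / 2 * n ≤ A := by
    rw [hA, inner_sub_left, ← inner_sub_starProjection, real_inner_self_eq_norm_sq, ← hn]
    nlinarith
  have hA0 : 0 < A := lt_of_lt_of_le (by positivity) hAn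
  have hAB : inner ℝ (a - b) a = B + A := inner_eq_add K (a - b) a
  obtain ⟨t, ht, hz⟩ : ∃ t ∈ Icc (0 : ℝ) 1, a - t • (a - b) = z := by
    have := h.1
    rw [segment_eq_image'] at this
    obtain ⟨t, ht, hz⟩ := this
    exact ⟨t, ht, by rw [← hz]; simp only [smul_sub]; abel⟩
  set Q := ‖a - b‖ ^ 2 with hQ
  have hzin : inner ℝ z (a - b) = B + A - t * Q := by
    rw [← hz, inner_sub_left, inner_smul_left, real_inner_self_eq_norm_sq, real_inner_comm, hAB, conj_trivial]
  -- The minimality of `z` concerns the full norm, not the normal part, so its actual parameter `t`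
  -- must be located: optimality towards `a` bounds `t` above, optimality towards `b` bounds it
  -- below.
  have h1 : 0 ≤ t * (B + A - t * Q) := by
    have := h.inner_nonneg (left_mem_segment ℝ a b)
    rwa [show a - z = t • (a - b) by rw [← hz]; abel, inner_smul_right, hzin] at this
  have h2 : (1 - t) * (B + A - t * Q) ≤ 0 := by
    have := h.inner_nonneg (right_mem_segment ℝ a b)
    rw [show b - z = -((1 - t) • (a - b)) by rw [← hz, sub_smul, one_smul]; abel,
      inner_neg_right, inner_smul_right, hzin] at this
    linarith
  have hBA := abs_le.1 hT
  have ht0 : 0 < t := by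
    rcases ht.1.eq_or_lt with h0 | h0
    · rw [← h0] at h2; nlinarith
    · exact h0
  have htQ : t * Q ≤ B + A := by
    have := nonneg_of_mul_nonneg_right h1 ht0
    linarith
  have hQL : Q ≤ 4 * L ^ 2 := by
    have := pow_le_pow_left₀ (norm_nonneg _) ((norm_sub_le a b).trans (add_le_add ha hb)) 2
    linarith
  have hNz : ‖z - K.starProjection z‖ ^ 2 ≤ n ^ 2 - 2 * t * A + t ^ 2 * Q := by
    have h3 : z - K.starProjection z =
        (a - K.starProjection a) - t • ((a - b) - K.starProjection (a - b)) := by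
      rw [← hz]; simp only [map_sub, map_smul, smul_sub]; abel
    rw [h3, norm_sub_sq_real, inner_smul_right, norm_smul, mul_pow, Real.norm_eq_abs, sq_abs,
      real_inner_comm, inner_sub_starProjection]
    have h4 := pow_le_pow_left₀ (norm_nonneg _) (norm_sub_starProjection_le K (a - b)) 2
    have h5 := mul_le_mul_of_nonneg_left h4 (sq_nonneg t)
    linarith
  -- The tangential term satisfies `|B| ≤ A / 4`, so `t * Q` is at most `5 / 4 * A`.
  have hdec : ‖z - K.starProjection z‖ ^ 2 ≤ n ^ 2 - 3 / 4 * (t * A) := by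
    have : t ^ 2 * Q ≤ t * (5 / 4 * A) := by
      rw [sq, mul_assoc]
      exact mul_le_mul_of_nonneg_left (by linarith) ht0.le
    linarith
  have hgoal : 3 * μ ^ 2 / (256 * L ^ 2) * n ^ 2 ≤ 3 / 4 * (t * A) := by
    rw [div_mul_eq_mul_div, div_le_iff₀ (by positivity)]
    -- At `t = 1` the decrease is at least of order `A`, hence ample; for `t < 1` stationarity gives
    -- `t * Q = A + B`, so `t` is at least of order `A / L ^ 2`.
    rcases ht.2.eq_or_lt with h1t | h1t
    · rw [h1t]
      have e1 : μ * n ^ 2 ≤ L * (2 * A) := by nlinarith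
      have e2 : μ * (μ * n ^ 2) ≤ L * (L * (2 * A)) :=
        mul_le_mul (by linarith) e1 (by positivity) hL.le
      nlinarith
    · have h3 : B + A ≤ t * Q := by
        have := nonpos_of_mul_nonpos_right h2 (sub_pos.2 h1t)
        linarith
      have h4 : 3 / 4 * A ≤ t * (4 * L ^ 2) := by
        have := mul_le_mul_of_nonneg_left hQL ht0.le
        linarith
      have h5 : (μ / 2 * n) ^ 2 ≤ A ^ 2 := pow_le_pow_left₀ (by positivity) hAn 2
      nlinarith
  linarith

end MinNorm

/-- A regularity radius together with the signs of the basic constants. -/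
structure Setting {d m : ℕ} (f : Vec d → ℝ) (xbar : Vec d) (M U : Set (Vec d))
    (F : Vec d → Vec m) (c : Consts) : Prop where
  reg : IsRegularityRadius f xbar M U F c
  locLip : LocallyLipschitz f
  mem : xbar ∈ M
  γ_pos : 0 < c.γ
  Ca_pos : 0 < c.Ca
  β_pos : 0 < c.β
  CM_pos : 0 < c.CM
  μ_pos : 0 < c.μ
  μ_le : 8 * c.μ ≤ c.L

namespace Setting

variable {d m : ℕ} {f : Vec d → ℝ} {xbar : Vec d} {M U : Set (Vec d)} {F : Vec d → Vec m}
  {c : Consts}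

/-! ### Inequalities between the constants, in the form in which they are used. -/

section Constants

variable (h : Setting f xbar M U F c)
include h

lemma L_pos : 0 < c.L := by linarith [h.μ_pos, h.μ_le]

lemma δA_pos : 0 < c.δA := h.reg.pos

lemma D₁_pos : 0 < c.D₁ := by
  have := h.μ_pos; have := h.L_pos
  unfold Consts.D₁; positivity

lemma mul_D₁ : (c.μ + c.L) * c.D₁ = c.μ / 8 := by
  have := h.μ_pos; have := h.L_pos
  unfold Consts.D₁; field_simp

lemma D₁_le : c.D₁ ≤ 1 / 16 := by
  have h1 := h.mul_D₁; have h2 := h.μ_pos; have h3 := h.D₁_pos; have h4 := h.μ_le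
  by_contra! hlt
  nlinarith

lemma C₃_eq : c.C₃ * c.L = c.γ ^ 2 / 128 := by
  have := h.L_pos
  unfold Consts.C₃ Consts.C₁; field_simp; ring

lemma C₃_pos : 0 < c.C₃ := by
  have := h.L_pos; have := h.γ_pos
  unfold Consts.C₃ Consts.C₁; positivity

omit h in
lemma C₄_le_half : c.C₄ ≤ 1 / 2 := (min_le_right _ _).trans (min_le_right _ _)

lemma C₄_mul_le_β : c.C₄ * (c.Ca * (1 + c.δA)) ≤ c.β := by
  have h1 : c.C₄ ≤ c.β / (c.Ca * (1 + c.δA)) := min_le_left _ _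
  have := h.Ca_pos; have := h.δA_pos
  rwa [le_div_iff₀ (by positivity)] at h1

lemma C₄_mul_le : c.C₄ * (4 * ((1 + (1 + c.δA) * c.CM) * (c.μ + c.L))) ≤
    min (c.μ / c.δA) (c.C₃ * c.D₂ / c.β) := by
  have h1 : c.C₄ ≤ min (c.μ / c.δA) (c.C₃ * c.D₂ / c.β) /
      (4 * (1 + (1 + c.δA) * c.CM) * (c.μ + c.L)) :=
    (min_le_right _ _).trans (min_le_left _ _)
  have := h.CM_pos; have := h.δA_pos; have := h.μ_pos; have := h.L_pos
  rw [le_div_iff₀ (by positivity)] at h1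
  linarith

omit h in
lemma C₅_le_C₄ : c.C₅ ≤ c.C₄ := (min_le_right _ _).trans (min_le_left _ _)

/-- With D + σ ≤ 2 C₅ E this keeps the strong (a) error below γE/16, a fraction of the covariant
gradient. -/
lemma C₅_mul_le_γ : c.C₅ * (32 * c.Ca) ≤ c.γ := by
  have h1 : c.C₅ ≤ c.C₂ / 4 := (min_le_right _ _).trans (min_le_right _ _)
  have h2 : c.C₂ ≤ c.γ / (8 * c.Ca) := min_le_left _ _
  have := h.Ca_pos
  rw [le_div_iff₀ (by positivity)] at h2
  nlinarith

/-- It keeps the tangential cross term below μ/8 times the normal part, as long as that part exceeds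
C₃E². -/
lemma C₅_mul_le : c.C₅ * (16 * (c.Ca * c.β)) ≤ c.C₃ * c.μ / 4 := by
  have h1 : c.C₅ ≤ c.C₃ * c.D₂ / (32 * c.Ca * c.β) := (min_le_left _ _).trans (min_le_right _ _)
  have := h.Ca_pos; have := h.β_pos
  rw [le_div_iff₀ (by positivity)] at h1
  unfold Consts.D₂ at h1
  linarith

lemma C₅_pos : 0 < c.C₅ := by
  have := h.Ca_pos; have := h.β_pos; have := h.δA_pos; have := h.μ_pos; have := h.L_pos
  have := h.C₃_pos; have := h.γ_pos; have := h.CM_pos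
  unfold Consts.C₅ Consts.C₄ Consts.C₂ Consts.D₂
  refine lt_min (lt_min (by positivity) (by positivity)) (lt_min (lt_min (by positivity)
    (lt_min (div_pos (lt_min (by positivity) (by positivity)) (by positivity)) (by norm_num)))
    (div_pos (lt_min (by positivity) (div_pos (lt_min one_pos (by positivity)) two_pos))
      (by norm_num)))

lemma a₂_pos : 0 < c.a₂ := by
  have := h.γ_pos; have := h.L_pos
  unfold Consts.a₂ Consts.C₁
  exact div_pos (lt_min (by positivity) h.C₅_pos) two_pos

omit h in
lemma two_a₂_le_C₅ : 2 * c.a₂ ≤ c.C₅ := by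
  unfold Consts.a₂; linarith [min_le_right (c.C₁ / c.L) c.C₅]

lemma two_a₂_mul_le : 2 * c.a₂ * c.L ≤ c.γ / 4 := by
  have h1 : 2 * c.a₂ ≤ c.C₁ / c.L := by
    unfold Consts.a₂; linarith [min_le_left (c.C₁ / c.L) c.C₅]
  rwa [le_div_iff₀ h.L_pos] at h1

lemma a₁_pos : 0 < c.a₁ := by
  have := h.μ_pos; have := h.L_pos
  unfold Consts.a₁ Consts.D₂
  exact lt_min h.D₁_pos (by positivity)

omit h in
lemma a₁_le_D₁ : c.a₁ ≤ c.D₁ := min_le_left _ _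

lemma a₁_mul_le : c.a₁ * c.L ≤ c.D₂ := by
  have h1 : c.a₁ ≤ c.D₂ / c.L := min_le_right _ _
  rwa [le_div_iff₀ h.L_pos] at h1

lemma δGrid_pos : 0 < c.δGrid := by
  have := h.D₁_pos; have := h.μ_pos; have := h.β_pos; have := h.Ca_pos; have := h.CM_pos
  have := h.δA_pos
  unfold Consts.δGrid
  exact lt_min (by positivity) (lt_min (by positivity) (by positivity))

lemma δGrid_mul_le : c.δGrid * (c.CM * (1 / c.D₁ + 1)) ≤ 1 := by
  have h1 : c.δGrid ≤ 1 / (c.CM * (1 / c.D₁ + 1)) := (min_le_right _ _).trans (min_le_left _ _)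
  have := h.D₁_pos; have := h.CM_pos
  rwa [le_div_iff₀ (by positivity)] at h1

lemma δGrid_mul_le_μ : c.δGrid * (8 * (c.Ca + c.β)) ≤ c.μ := by
  have h1 : c.δGrid ≤ c.μ / (8 * (c.Ca + c.β)) := (min_le_right _ _).trans (min_le_right _ _)
  have := h.β_pos; have := h.Ca_pos
  rwa [le_div_iff₀ (by positivity)] at h1

omit h in
lemma δLS_le : c.δLS ≤ c.δA / 4 ∧ c.δLS ≤ c.D₁ / c.CM ∧ c.δLS ≤ c.D₂ / (c.D₁ * c.L * √128) ∧
    c.δLS ≤ c.δGrid ∧ c.δLS ≤ 1 / (2 * (c.a₁ + 2 * c.a₂)) ∧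
    c.δLS ≤ c.γ * c.D₁ ^ 2 * (min (c.δGrid / 2) (1 / 4)) ^ 2 / (2 * c.L) ∧ c.δLS ≤ 1 := by
  have e1 : c.δLS ≤ min (min (c.δA / 2) c.δGI) (min c.δND c.δGrid) :=
    min_le_left _ _
  have e2 : c.δLS ≤ min (1 / (2 * (c.a₁ + 2 * c.a₂)))
      (c.γ * c.D₁ ^ 2 * (min (c.δGrid / 2) (1 / 4)) ^ 2 / (2 * c.L)) :=
    (min_le_right _ _).trans (min_le_left _ _)
  have e3 : c.δLS ≤ c.δGI := e1.trans ((min_le_left _ _).trans (min_le_right _ _))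
  have e4 : c.δLS ≤ c.δND := e1.trans ((min_le_right _ _).trans (min_le_left _ _))
  exact ⟨e3.trans (min_le_left _ _), e3.trans (min_le_right _ _), e4.trans (min_le_right _ _),
    e1.trans ((min_le_right _ _).trans (min_le_right _ _)), e2.trans (min_le_left _ _),
    e2.trans (min_le_right _ _), (min_le_right _ _).trans (min_le_right _ _)⟩

lemma rate_mem : 0 ≤ 1 - 3 * c.μ ^ 2 / (256 * c.L ^ 2) ∧ 0 ≤ 1 - c.μ ^ 2 / (64 * c.L ^ 2) := by
  have h1 := h.μ_pos; have h2 := h.L_pos; have h3 := h.μ_le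
  constructor
  · rw [sub_nonneg, div_le_one (by positivity)]; nlinarith
  · rw [sub_nonneg, div_le_one (by positivity)]; nlinarith

end Constants

/-! ### Aiming at displaced points and lower bounds for Goldstein subgradients. -/

section Geometry

variable (h : Setting f xbar M U F c) {x : Vec d}
include h

omit h in
lemma _root_.NTDescent.mem_ball_of_norm_sub_le {δ σ : ℝ} {z : Vec d} (hx : x ∈ Metric.ball xbar (δ / 2))
    (hσ : σ ≤ δ / 2) (hz : ‖z - x‖ ≤ σ) : z ∈ Metric.ball xbar δ := by
  rw [mem_ball_iff_norm] at hx ⊢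
  have : z - xbar = (z - x) + (x - xbar) := by abel
  rw [this]
  linarith [norm_add_le (z - x) (x - xbar)]

lemma isNearest (hx : x ∈ Metric.ball xbar (2 * c.δA)) : IsNearest M x (proj M x) :=
  proj_isNearest (h.reg.proj_unique x hx).exists

lemma infDist_eq (hx : x ∈ Metric.ball xbar (2 * c.δA)) :
    Metric.infDist x M = ‖x - proj M x‖ := infDist_eq_of_isNearest (h.isNearest hx)

lemma ball_le (hx : x ∈ Metric.ball xbar c.δA) : x ∈ Metric.ball xbar (2 * c.δA) :=
  Metric.ball_subset_ball (by linarith [h.δA_pos]) hx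

lemma norm_le_of_mem_goldstein (hx : x ∈ Metric.ball xbar c.δA) {σ : ℝ} (hσ : σ ≤ c.δA)
    {g : Vec d} (hg : g ∈ goldstein f σ x) : ‖g‖ ≤ c.L :=
  h.reg.subgrad x hx c.δA h.δA_pos le_rfl g (goldstein_mono hσ hg)

lemma norm_le_of_mem_clarke (hx : x ∈ Metric.ball xbar c.δA) {v : Vec d} (hv : v ∈ clarke f x) :
    ‖v‖ ≤ c.L :=
  h.norm_le_of_mem_goldstein hx (σ := 0) h.δA_pos.le (clarke_subset_goldstein (by simp) hv)

lemma infDist_le : Metric.infDist x M ≤ ‖x - xbar‖ := by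
  rw [← dist_eq_norm]; exact Metric.infDist_le_dist_of_mem h.mem

lemma norm_proj_sub_le (hx : x ∈ Metric.ball xbar (2 * c.δA)) :
    ‖proj M x - xbar‖ ≤ 2 * ‖x - xbar‖ :=
  norm_sub_le_two_mul_of_isNearest h.mem (h.isNearest hx)

lemma abs_sub_le {x' : Vec d} (hx : x ∈ Metric.ball xbar c.δA)
    (hx' : x' ∈ Metric.ball xbar c.δA) : |f x - f x'| ≤ c.L * ‖x - x'‖ :=
  abs_sub_le_of_norm_gradient_le h.locLip (fun _ hz hd =>
    h.norm_le_of_mem_clarke hz (gradient_mem_clarke hd)) hx hx'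

/-- The normal part of `g` is a direction along which subgradients at `x - σ g / ‖g‖` increase:
aiming at the displaced point. -/
lemma inner_normal_le (hx : x ∈ Metric.ball xbar (c.δA / 2)) {σ : ℝ} (hσ0 : 0 < σ)
    (hσ : σ ≤ c.δA / 2) {g v : Vec d} (hg : g ≠ 0) (hv : v ∈ clarke f (x - (σ / ‖g‖) • g)) :
    inner ℝ v (g - (tangent F (proj M x)).starProjection g) ≤
      -(c.μ * ‖g - (tangent F (proj M x)).starProjection g‖) + ‖g‖ / σ *
        ((c.μ + c.L) * (Metric.infDist x M + c.CM * (Metric.infDist x M ^ 2 + σ ^ 2))) := by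
  have hg0 : 0 < ‖g‖ := norm_pos_iff.2 hg
  set P := (tangent F (proj M x)).starProjection with hP
  set D := Metric.infDist x M with hD
  set k := σ / ‖g‖ with hk
  have hk0 : 0 < k := div_pos hσ0 hg0
  set z := x - k • g with hz
  have hkg : ‖k • g‖ = σ := by
    rw [norm_smul, Real.norm_eq_abs, abs_of_pos hk0, hk]; field_simp
  have hzx : ‖z - x‖ ≤ σ := by rw [hz, sub_sub_cancel_left, norm_neg, hkg]
  have hzb : z ∈ Metric.ball xbar c.δA := mem_ball_of_norm_sub_le hx hσ hzx
  have hxb : x ∈ Metric.ball xbar c.δA :=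
    Metric.ball_subset_ball (by linarith [h.δA_pos]) hx
  have hv' : ‖v‖ ≤ c.L := h.norm_le_of_mem_clarke hzb hv
  set e := proj M z - proj M x - P (z - x) with he
  have he' : ‖e‖ ≤ c.CM * (D ^ 2 + σ ^ 2) := by
    have := h.reg.proj_approx x hxb z (h.ball_le hzb)
    rwa [show ‖x - z‖ = σ by rw [hz, sub_sub_cancel, hkg]] at this
  have haim := h.reg.aiming z hzb v hv
  rw [h.infDist_eq (h.ball_le hzb)] at haim
  -- To first order the step moves the normal displacement by the normal part of `g` only; `e` is
  -- the linearization error of the projection. Aiming at `z` is then estimated on both sides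
  -- through this identity.
  have hdec : z - proj M z = (x - proj M x) - k • (g - P g) - e := by
    have : P (z - x) = - (k • P g) := by rw [hz, sub_sub_cancel_left, map_neg, map_smul]
    rw [he, this, smul_sub, hz]; abel
  have hDx : D = ‖x - proj M x‖ := h.infDist_eq (h.ball_le hxb)
  have hlow : k * ‖g - P g‖ - D - ‖e‖ ≤ ‖z - proj M z‖ := by
    have h1 : k • (g - P g) = (x - proj M x) - e - (z - proj M z) := by rw [hdec]; abel
    have h2 := norm_sub_le ((x - proj M x) - e) (z - proj M z)
    have h3 := norm_sub_le (x - proj M x) e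
    rw [← h1, norm_smul, Real.norm_eq_abs, abs_of_pos hk0] at h2
    rw [hDx]
    linarith
  have hup : inner ℝ v (z - proj M z) ≤ c.L * D - k * inner ℝ v (g - P g) + c.L * ‖e‖ := by
    rw [hdec, inner_sub_right, inner_sub_right, inner_smul_right, hDx]
    have h1 := (real_inner_le_norm v (x - proj M x)).trans
      (mul_le_mul_of_nonneg_right hv' (norm_nonneg _))
    have h2 := (abs_real_inner_le_norm v e).trans
      (mul_le_mul_of_nonneg_right hv' (norm_nonneg _))
    linarith [neg_abs_le (inner ℝ v e)]
  have h3 := mul_le_mul_of_nonneg_left hlow h.μ_pos.le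
  have h4 := mul_le_mul_of_nonneg_left he' (add_pos h.μ_pos h.L_pos).le
  have h5 : k * inner ℝ v (g - P g) ≤ k * (-(c.μ * ‖g - P g‖)) +
      (c.μ + c.L) * (D + c.CM * (D ^ 2 + σ ^ 2)) := by linarith
  have h6 : ‖g‖ / σ = k⁻¹ := by rw [hk, inv_div]
  rw [h6]
  refine le_of_mul_le_mul_left ?_ hk0
  rw [mul_add, ← mul_assoc k k⁻¹, mul_inv_cancel₀ hk0.ne', one_mul]
  exact h5

/-- Goldstein subgradients of radius at most `D₁ dist(x, M)` are bounded away from zero. -/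
lemma D₂_le_norm (hx : ‖x - xbar‖ < c.δLS) {σ : ℝ} (hD : 0 < Metric.infDist x M)
    (hσ : σ ≤ c.D₁ * Metric.infDist x M) {g : Vec d} (hg : g ∈ goldstein f σ x) :
    c.D₂ ≤ ‖g‖ := by
  obtain ⟨hδ1, hδ2, -⟩ := δLS_le (c := c)
  have hL := h.L_pos; have hμ := h.μ_pos; have hCM := h.CM_pos; have hD1 := h.D₁_pos
  have hD1' := h.D₁_le; have hmul := h.mul_D₁; have hδA := h.δA_pos
  set D := Metric.infDist x M with hDdef
  have hDle : D ≤ ‖x - xbar‖ := h.infDist_le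
  have hxh : x ∈ Metric.ball xbar (c.δA / 2) := by rw [mem_ball_iff_norm]; linarith
  have hxb : x ∈ Metric.ball xbar c.δA := by rw [mem_ball_iff_norm]; linarith
  have hCMD : c.CM * D ≤ c.D₁ := by
    have : D ≤ c.D₁ / c.CM := by linarith
    rw [le_div_iff₀ hCM] at this; linarith
  have hDx : D = ‖x - proj M x‖ := h.infDist_eq (h.ball_le hxb)
  -- A half-space is convex, so Clarke subgradients at points `z` near `x` suffice. Aiming at `z`
  -- gives `μ * D`; moving from `z` to `x` costs at most `μ / 8 * D`, and the linearization error at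
  -- most `μ / 4 * D`.
  have hsub : goldstein f σ x ⊆ {g | c.μ / 2 * D ≤ inner ℝ g (x - proj M x)} := by
    refine goldstein_subset ?_ fun z hz v hv => ?_
    · exact (convex_halfSpace_ge (f := fun g => inner ℝ g (x - proj M x))
        ⟨fun a b => inner_add_left _ _ _, fun a b => by simp [inner_smul_left]⟩ _)
    set P := (tangent F (proj M x)).starProjection with hP
    have hzb : z ∈ Metric.ball xbar c.δA := by
      refine mem_ball_of_norm_sub_le hxh ?_ hz
      nlinarith
    have hv' : ‖v‖ ≤ c.L := h.norm_le_of_mem_clarke hzb hv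
    have haim := h.reg.aiming z hzb v hv
    set e := proj M z - proj M x - P (z - x) with he
    have he' : ‖e‖ ≤ c.CM * (D ^ 2 + ‖x - z‖ ^ 2) :=
      h.reg.proj_approx x hxb z (h.ball_le hzb)
    rw [norm_sub_rev x z] at he'
    have hDz : D ≤ Metric.infDist z M + ‖z - x‖ := by
      rw [← dist_eq_norm, dist_comm]; exact Metric.infDist_le_infDist_add_dist
    have hdec : x - proj M x = (z - proj M z) - ((z - x) - P (z - x)) + e := by
      rw [he]; abel
    rw [mem_ofPred_eq, hdec, inner_add_right, inner_sub_right]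
    have h1 := (abs_real_inner_le_norm v e).trans
      (mul_le_mul_of_nonneg_right hv' (norm_nonneg _))
    have h2 := (real_inner_le_norm v ((z - x) - P (z - x))).trans
      (mul_le_mul hv' (norm_sub_starProjection_le _ _) (norm_nonneg _) hL.le)
    have hzx := norm_nonneg (z - x)
    have hσ' : ‖z - x‖ ≤ c.D₁ * D := hz.trans hσ
    have h3 : (c.μ + c.L) * ‖z - x‖ ≤ c.μ / 8 * D := by
      rw [← hmul, mul_assoc]; exact mul_le_mul_of_nonneg_left hσ' (by linarith)
    have h4 : ‖e‖ ≤ 2 * (c.D₁ * D) := by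
      have h5 : ‖z - x‖ ≤ D := by nlinarith
      have h6 : D ^ 2 + ‖z - x‖ ^ 2 ≤ 2 * (D * D) := by nlinarith
      have h7 := mul_le_mul_of_nonneg_left h6 hCM.le
      have h8 := mul_le_mul_of_nonneg_right hCMD hD.le
      linarith
    have h5 : c.L * ‖e‖ ≤ c.μ / 4 * D := by
      have h6 : c.L * ‖e‖ ≤ (c.μ + c.L) * (2 * (c.D₁ * D)) :=
        mul_le_mul (by linarith) h4 (norm_nonneg _) (by linarith)
      have h7 : (c.μ + c.L) * (2 * (c.D₁ * D)) = 2 * ((c.μ + c.L) * c.D₁) * D := by ring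
      rw [h7, hmul] at h6
      linarith
    have h6 := mul_le_mul_of_nonneg_left hDz hμ.le
    have h7 := mul_pos hμ hD
    linarith [neg_abs_le (inner ℝ v e)]
  have h1 := hsub hg
  rw [mem_ofPred_eq] at h1
  have h2 := real_inner_le_norm g (x - proj M x)
  rw [← hDx] at h2
  unfold Consts.D₂
  exact le_of_mul_le_mul_right (h1.trans h2) hD

end Geometry

end Setting


/-! ### Single passes of the two loops. -/

section Steps

variable {d : ℕ} {f : Vec d → ℝ} {x g g' : Vec d} {σ : ℝ}

lemma norm_step_sub (x : Vec d) {g : Vec d} (hg : 0 < ‖g‖) (hσ : 0 ≤ σ) :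
    ‖x - (σ / ‖g‖) • g - x‖ = σ := by
  rw [sub_sub_cancel_left, norm_neg, norm_smul, Real.norm_eq_abs,
    abs_of_nonneg (div_nonneg hσ hg.le)]
  field_simp

lemma goldstein_convex : Convex ℝ (goldstein f σ x) := convex_convexHull ℝ _

lemma TDescentStep.norm_le (h : TDescentStep f x σ g g') : ‖g'‖ ≤ ‖g‖ := by
  by_cases hl : LoopGoesOn f x σ g
  · obtain ⟨ghat, -, hm⟩ := h.1 hl
    exact hm.norm_le
  · rw [h.2 hl]

lemma TDescentStep.mem_goldstein (h : TDescentStep f x σ g g') (hσ : 0 ≤ σ)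
    (hg : g ∈ goldstein f σ x) : g' ∈ goldstein f σ x := by
  by_cases hl : LoopGoesOn f x σ g
  · obtain ⟨ghat, hgh, hm⟩ := h.1 hl
    exact goldstein_convex.segment_subset hg
      (clarke_subset_goldstein (norm_step_sub x hl.1 hσ).le hgh) hm.1
  · rwa [h.2 hl]

lemma norm_samplePoint_sub_le (x : Vec d) {r τ : ℝ} (ξ g : Vec d) (hσ : 0 ≤ σ)
    (hτ : τ ∈ Icc (0 : ℝ) 1) : ‖samplePoint x σ r ξ τ g - x‖ ≤ σ := by
  unfold samplePoint
  rw [sub_sub_cancel_left, norm_neg, norm_smul, Real.norm_eq_abs,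
    abs_of_nonneg (div_nonneg (mul_nonneg hτ.1 hσ) (norm_nonneg _))]
  -- For a zero perturbed vector the convention for division by zero makes the sampled point equal
  -- to `x`.
  rcases (norm_nonneg (g + r • ξ)).eq_or_lt with h0 | h0
  · rw [← h0]; simpa using hσ
  · rw [div_mul_cancel₀ _ h0.ne']
    exact mul_le_of_le_one_left hσ hτ.2

variable {r τ : ℝ} {ξ : Vec d}

lemma NDescentStep.norm_le (h : NDescentStep f x σ r ξ τ g g') : ‖g'‖ ≤ ‖g‖ := by
  by_cases hl : LoopGoesOn f x σ g
  · obtain ⟨-, ghat, -, -, hm⟩ := h.1 hl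
    exact hm.norm_le
  · rw [h.2 hl]

lemma NDescentStep.mem_goldstein (h : NDescentStep f x σ r ξ τ g g') (hσ : 0 ≤ σ)
    (hτ : τ ∈ Icc (0 : ℝ) 1) (hg : g ∈ goldstein f σ x) : g' ∈ goldstein f σ x := by
  by_cases hl : LoopGoesOn f x σ g
  · obtain ⟨-, ghat, hgh, -, hm⟩ := h.1 hl
    exact goldstein_convex.segment_subset hg
      (clarke_subset_goldstein (norm_samplePoint_sub_le x ξ g hσ hτ) hgh) hm.1
  · rwa [h.2 hl]

/-- If the loop has not ended after `T` passes, it went on at each of them. -/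
lemma goesOn_of_goesOn {T : ℕ} {u : ℕ → Vec d}
    (hend : ∀ t < T, ¬ LoopGoesOn f x σ (u t) → u (t + 1) = u t)
    (hT : LoopGoesOn f x σ (u T)) : ∀ t ≤ T, LoopGoesOn f x σ (u t) := by
  intro t ht
  induction ht using Nat.decreasingInduction with
  | self => exact hT
  | of_succ k hk ih =>
    by_contra hcon
    rw [hend k hk hcon] at ih
    exact hcon ih

end Steps

namespace Setting

variable {d m : ℕ} {f : Vec d → ℝ} {xbar : Vec d} {M U : Set (Vec d)} {F : Vec d → Vec m}
  {c : Consts} {x : Vec d} {σ : ℝ}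

lemma mem_ball_of_lt_δLS (h : Setting f xbar M U F c) (hx : ‖x - xbar‖ < c.δLS) :
    x ∈ Metric.ball xbar (c.δA / 2) ∧ x ∈ Metric.ball xbar c.δA ∧
      x ∈ Metric.ball xbar (2 * c.δA) := by
  have h1 := (δLS_le (c := c)).1
  have h2 := h.δA_pos
  simp only [mem_ball_iff_norm]
  exact ⟨by linarith, by linarith, by linarith⟩

/-- The covariant gradient is tangent to the manifold. -/
lemma starProjection_covGrad (h : Setting f xbar M U F c) {y : Vec d} (hy : y ∈ M)
    (hyb : y ∈ Metric.ball xbar c.δA) :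
    (tangent F y).starProjection (covGrad f M y) = covGrad f M y := by
  have hyy : proj M y = y := proj_eq_self hy
  have hopen : Metric.ball xbar (2 * c.δA) ∈ 𝓝 y := Metric.isOpen_ball.mem_nhds (h.ball_le hyb)
  -- On `M` the distance term of the projection estimate vanishes, so the remainder is quadratic.
  have h1 : HasFDerivAt (proj M) (tangent F y).starProjection y := by
    have h2 : (fun z => proj M z - proj M y - (tangent F y).starProjection (z - y)) =O[𝓝 y]
        fun z => ‖z - y‖ ^ 2 := by
      refine Asymptotics.IsBigO.of_bound c.CM ?_
      filter_upwards [hopen] with z hz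
      have := h.reg.proj_approx y hyb z hz
      rw [Metric.infDist_zero_of_mem hy, hyy] at this
      rw [norm_pow, norm_norm, hyy, norm_sub_rev z y]
      simpa using this
    have h3 := (h2.hasFDerivAt one_lt_two).add
      (((tangent F y).starProjection.hasFDerivAt (x := y)).add_const
        (proj M y - (tangent F y).starProjection y))
    rw [zero_add] at h3
    refine h3.congr_of_eventuallyEq (Eventually.of_forall fun z => ?_)
    simp only [Pi.add_apply, map_sub]
    abel
  have hd : DifferentiableAt ℝ (extension f M) y :=
    (h.reg.ext_smooth.contDiffAt hopen).differentiableAt (by norm_num)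
  -- The extension is unchanged by precomposition with the projection; the chain rule therefore
  -- makes its derivative factor through the tangent space.
  have h2 : extension f M =ᶠ[𝓝 y] extension f M ∘ proj M := by
    filter_upwards [hopen] with z hz
    exact (extension_eq_of_mem (h.isNearest hz).1).symm
  have h3 : fderiv ℝ (extension f M) y =
      (fderiv ℝ (extension f M) y).comp (tangent F y).starProjection := by
    have h4 : HasFDerivAt (extension f M) (fderiv ℝ (extension f M) y) (proj M y) := by
      rw [hyy]; exact hd.hasFDerivAt
    conv_lhs => rw [h2.fderiv_eq, (h4.comp y h1).fderiv]
  refine ext_inner_right ℝ fun w => ?_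
  rw [Submodule.inner_starProjection_left_eq_right, covGrad, inner_gradient, inner_gradient]
  conv_rhs => rw [h3]
  rfl

/-! ### The tangential regime: `TDescent` succeeds. -/

section Tangent

variable (h : Setting f xbar M U F c) (hx : ‖x - xbar‖ < c.δLS)
  (hE : 0 < ‖proj M x - xbar‖) (hσ0 : 0 < σ) (hσ : σ ≤ 2 * c.a₂ * ‖proj M x - xbar‖)
  (hD : Metric.infDist x M ≤ σ ^ 2)
include h hx hE hσ0 hσ hD

lemma tangent_radius : ‖proj M x - xbar‖ ≤ c.δA / 2 ∧ σ ≤ c.C₅ * ‖proj M x - xbar‖ ∧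
    σ ≤ c.δA / 4 ∧ σ ≤ 1 ∧ Metric.infDist x M ≤ σ ∧ Metric.infDist x M ≤ c.δA := by
  obtain ⟨hxh, hxb, hx2⟩ := h.mem_ball_of_lt_δLS hx
  obtain ⟨hδ1, -, -, -, -, -, hδ7⟩ := δLS_le (c := c)
  have h1 := h.norm_proj_sub_le hx2
  have h2 := two_a₂_le_C₅ (c := c)
  have h3 := C₅_le_C₄ (c := c)
  have h4 := C₄_le_half (c := c)
  have h5 : σ ≤ c.C₅ * ‖proj M x - xbar‖ :=
    hσ.trans (mul_le_mul_of_nonneg_right h2 hE.le)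
  have h6 : c.C₅ * ‖proj M x - xbar‖ ≤ 1 / 2 * ‖proj M x - xbar‖ :=
    mul_le_mul_of_nonneg_right (h3.trans h4) hE.le
  have h7 := h.δA_pos
  have h8 : σ ≤ 1 := by linarith
  have h9 := h.infDist_le (x := x)
  refine ⟨by linarith, h5, by linarith, h8, ?_, by linarith⟩
  nlinarith

/-- The covariant gradient is tangent and of size between γE/2 and βE, and strong (a) makes the
tangential part of `g` differ from it by at most a small multiple of E; 7/16 is 1/2 less 1/16. -/
lemma tangent_bounds {g : Vec d} (hg : g ∈ goldstein f σ x) :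
    ‖(tangent F (proj M x)).starProjection g‖ ≤ 2 * c.β * ‖proj M x - xbar‖ ∧
    7 / 16 * c.γ * ‖proj M x - xbar‖ ≤ ‖(tangent F (proj M x)).starProjection g‖ := by
  obtain ⟨-, hxb, hx2⟩ := h.mem_ball_of_lt_δLS hx
  obtain ⟨hEA, hσC, hσA, hσ1, hDσ, hDA⟩ := h.tangent_radius hx hE hσ0 hσ hD
  have hδA := h.δA_pos
  have hCa := h.Ca_pos
  set E := ‖proj M x - xbar‖ with hEdef
  have h1 := h.reg.strong_a₂ x hxb σ hσ0 (by linarith) g hg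
  have h2 := h.reg.strong_a₁ x hxb σ hσ0 (by linarith) g hg
  have h3 := h.reg.covGrad_lower x hxb
  have hyM := (h.isNearest hx2).1
  have hyb : proj M x ∈ Metric.ball xbar c.δA := by rw [mem_ball_iff_norm]; linarith
  have hpm := h.starProjection_covGrad hyM hyb
  constructor
  · have h4 : Metric.infDist x M + σ ≤ σ * (1 + c.δA) := by nlinarith
    have h5 : σ * (1 + c.δA) ≤ c.C₄ * E * (1 + c.δA) := by
      have := C₅_le_C₄ (c := c)
      gcongr
      exact hσC.trans (by gcongr)
    have h6 := mul_le_mul_of_nonneg_left (h4.trans h5) hCa.le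
    have h7 := mul_le_mul_of_nonneg_right h.C₄_mul_le_β hE.le
    rw [← hEdef] at h1
    linarith
  · have h4 : c.Ca * (Metric.infDist x M + σ) ≤ c.γ * E / 16 := by
      have h5 : Metric.infDist x M + σ ≤ 2 * (c.C₅ * E) := by linarith
      have h6 := mul_le_mul_of_nonneg_left h5 hCa.le
      have h7 := mul_le_mul_of_nonneg_right h.C₅_mul_le_γ hE.le
      linarith
    rw [map_sub, hpm] at h2
    have h5 := norm_sub_norm_le (covGrad f M (proj M x))
      ((tangent F (proj M x)).starProjection g)
    rw [norm_sub_rev] at h5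
    linarith

/-- The step along a nearly tangential vector gives descent, so that the loop stops. -/
lemma tangent_stops {g : Vec d} (hg : g ∈ goldstein f σ x)
    (hN : ‖g - (tangent F (proj M x)).starProjection g‖ ≤ c.C₃ * ‖proj M x - xbar‖ ^ 2) :
    ¬ LoopGoesOn f x σ g := by
  obtain ⟨-, hxb, hx2⟩ := h.mem_ball_of_lt_δLS hx
  obtain ⟨hEA, hσC, hσA, hσ1, hDσ, hDA⟩ := h.tangent_radius hx hE hσ0 hσ hD
  obtain ⟨-, hplow⟩ := h.tangent_bounds hx hE hσ0 hσ hD hg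
  have hδA := h.δA_pos
  have hCa := h.Ca_pos
  have hL := h.L_pos
  have hγ := h.γ_pos
  have hgL := h.norm_le_of_mem_goldstein hxb (by linarith) hg
  set K := tangent F (proj M x) with hK
  set E := ‖proj M x - xbar‖ with hEdef
  set p := ‖K.starProjection g‖ with hp
  set n := ‖g - K.starProjection g‖ with hn
  have hnL : n ≤ c.L := (norm_sub_starProjection_le K g).trans hgL
  have hn0 : 0 ≤ n := norm_nonneg _
  have hp0 : 0 < p := lt_of_lt_of_le (by positivity) hplow
  have hsq := norm_sq_eq_add K g
  rw [← hp, ← hn] at hsq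
  have hLn : c.L * n ≤ c.γ ^ 2 / 128 * E ^ 2 := by
    rw [← h.C₃_eq]
    have := mul_le_mul_of_nonneg_left hN hL.le
    linarith
  have hpE : (7 / 16 * c.γ * E) ^ 2 ≤ p ^ 2 := pow_le_pow_left₀ (by positivity) hplow 2
  have hLnp : c.L * n ≤ p ^ 2 / 16 := by
    have : (7 / 16 * c.γ * E) ^ 2 = 49 / 256 * (c.γ ^ 2 * E ^ 2) := by ring
    have := mul_nonneg (sq_nonneg c.γ) (sq_nonneg E)
    linarith
  have hn2 : n ^ 2 ≤ p ^ 2 / 16 := by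
    have := mul_le_mul_of_nonneg_right hnL hn0
    linarith
  have hCaDσ : 2 * c.Ca * (Metric.infDist x M + σ) ≤ c.γ * E / 8 := by
    have h5 : Metric.infDist x M + σ ≤ 2 * (c.C₅ * E) := by linarith
    have h6 := mul_le_mul_of_nonneg_left h5 hCa.le
    have h7 := mul_le_mul_of_nonneg_right h.C₅_mul_le_γ hE.le
    linarith
  -- The tangential parts contribute at least `5 / 7 * p ^ 2`, since those of `w` and `g` are close;
  -- the normal part of `g` disturbs this by at most `c.L * n ≤ p ^ 2 / 16`.
  have hin : ∀ w ∈ goldstein f σ x, p ^ 2 / 2 ≤ inner ℝ w g := by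
    intro w hw
    have h1 := h.reg.strong_a₃ x hxb σ hσ0 (by linarith) g hg w hw
    have hwL := h.norm_le_of_mem_goldstein hxb (by linarith) hw
    rw [inner_eq_add K w g]
    have h2 := (abs_real_inner_le_norm w (g - K.starProjection g)).trans
      (mul_le_mul_of_nonneg_right hwL hn0)
    have h3 : inner ℝ (K.starProjection w) (K.starProjection g) =
        p ^ 2 - inner ℝ (K.starProjection (g - w)) (K.starProjection g) := by
      rw [map_sub, inner_sub_left, real_inner_self_eq_norm_sq]; ring
    have h4 := (real_inner_le_norm (K.starProjection (g - w)) (K.starProjection g)).trans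
      (mul_le_mul_of_nonneg_right (h1.trans hCaDσ) hp0.le)
    have h5 : c.γ * E / 8 * p ≤ 2 / 7 * p ^ 2 := by
      have := mul_le_mul_of_nonneg_right hplow hp0.le
      linarith
    rw [h3]
    rw [← hn] at h2
    rw [← hp] at h4
    linarith [neg_abs_le (inner ℝ w (g - K.starProjection g)), pow_pos hp0 2]
  have hg0 : 0 < ‖g‖ := by
    by_contra! h0
    have := norm_nonneg g
    have h1 : ‖g‖ = 0 := by linarith
    rw [h1] at hsq
    linarith [pow_pos hp0 2, sq_nonneg n]
  rintro ⟨-, hle⟩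
  have hdesc := (descent_of_goldstein h.locLip hσ0 (norm_pos_iff.1 hg0) hin).trans hle
  -- Continuing would force `p ^ 2 / 2 ≤ ‖g‖ ^ 2 / 8`, against `‖g‖ ^ 2 ≤ 17 / 16 * p ^ 2`.
  have h1 := mul_le_mul_of_nonneg_right hdesc hg0.le
  have h2 : σ / ‖g‖ * (p ^ 2 / 2) * ‖g‖ = σ * (p ^ 2 / 2) := by field_simp
  have h3 : σ / 8 * ‖g‖ * ‖g‖ = σ * (‖g‖ ^ 2 / 8) := by ring
  rw [h2, h3] at h1
  have h4 := le_of_mul_le_mul_left h1 hσ0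
  have h5 := pow_pos hp0 2
  linarith

/-- While the loop of `TDescent` goes on, the normal part contracts. -/
lemma tangent_contracts {g g' : Vec d} (hg : g ∈ goldstein f σ x)
    (hstep : TDescentStep f x σ g g') (hgo : LoopGoesOn f x σ g) :
    ‖g' - (tangent F (proj M x)).starProjection g'‖ ^ 2 ≤
      (1 - 3 * c.μ ^ 2 / (256 * c.L ^ 2)) *
        ‖g - (tangent F (proj M x)).starProjection g‖ ^ 2 := by
  obtain ⟨hxh, hxb, hx2⟩ := h.mem_ball_of_lt_δLS hx
  obtain ⟨hEA, hσC, hσA, hσ1, hDσ, hDA⟩ := h.tangent_radius hx hE hσ0 hσ hD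
  obtain ⟨hpup, -⟩ := h.tangent_bounds hx hE hσ0 hσ hD hg
  have hNlow : c.C₃ * ‖proj M x - xbar‖ ^ 2 <
      ‖g - (tangent F (proj M x)).starProjection g‖ := by
    by_contra! hcon
    exact h.tangent_stops hx hE hσ0 hσ hD hg hcon hgo
  obtain ⟨v, hv, hmin⟩ := hstep.1 hgo
  have hδA := h.δA_pos
  have hCa := h.Ca_pos
  have hL := h.L_pos
  have hμ := h.μ_pos
  have hβ := h.β_pos
  have hCM := h.CM_pos
  have hgL := h.norm_le_of_mem_goldstein hxb (by linarith) hg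
  have hvg : v ∈ goldstein f σ x :=
    clarke_subset_goldstein (norm_step_sub x hgo.1 hσ0.le).le hv
  have hvL := h.norm_le_of_mem_goldstein hxb (by linarith) hvg
  have hN := h.inner_normal_le hxh hσ0 (by linarith) (norm_pos_iff.1 hgo.1) hv
  have hT := h.reg.strong_a₃ x hxb σ hσ0 (by linarith) g hg v hvg
  set P := tangent F (proj M x) with hP
  set E := ‖proj M x - xbar‖ with hEdef
  set D := Metric.infDist x M with hDdef
  set p := ‖P.starProjection g‖ with hp
  set n := ‖g - P.starProjection g‖ with hn
  have hp0 : 0 ≤ p := norm_nonneg _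
  have hC₃ := h.C₃_pos
  have hn0 : 0 < n := lt_of_le_of_lt (by positivity) hNlow
  have hD0 : 0 ≤ D := Metric.infDist_nonneg
  refine hmin.normal_norm_sq_le P hμ h.μ_le hgL hvL hn0 ?_ ?_
  · refine hN.trans ?_
    set K := (1 + (1 + c.δA) * c.CM) * (c.μ + c.L) with hKdef
    have hK0 : 0 < K := by positivity
    have h1 : (c.μ + c.L) * (D + c.CM * (D ^ 2 + σ ^ 2)) ≤ K * σ ^ 2 := by
      have h2 : D ^ 2 ≤ c.δA * σ ^ 2 := by nlinarith
      have h3 : D + c.CM * (D ^ 2 + σ ^ 2) ≤ (1 + (1 + c.δA) * c.CM) * σ ^ 2 := by nlinarith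
      have := mul_le_mul_of_nonneg_left h3 (by linarith : 0 ≤ c.μ + c.L)
      rw [hKdef]; linarith
    have h2 : ‖g‖ / σ * ((c.μ + c.L) * (D + c.CM * (D ^ 2 + σ ^ 2))) ≤ ‖g‖ * (K * σ) := by
      have := mul_le_mul_of_nonneg_left h1 (div_nonneg (norm_nonneg g) hσ0.le)
      have h3 : ‖g‖ / σ * (K * σ ^ 2) = ‖g‖ * (K * σ) := by field_simp
      linarith
    -- The error `‖g‖ * (K * σ)` is split. The share of `n` is small because `K * σ ≤ μ / 8`; the
    -- share of `p` is of order E², which is dominated by `n > C₃ * E ^ 2`. In total at most `3 / 8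
    -- * μ * n` is lost from the aiming term.
    have h3 : ‖g‖ ≤ p + n := by
      have := norm_add_le (P.starProjection g) (g - P.starProjection g)
      rwa [add_sub_cancel] at this
    have hKσ : K * σ ≤ K * c.C₄ * E := by
      have h4 : σ ≤ c.C₄ * E := hσC.trans (mul_le_mul_of_nonneg_right (C₅_le_C₄) hE.le)
      have := mul_le_mul_of_nonneg_left h4 hK0.le
      linarith
    have h4 := h.C₄_mul_le.trans (min_le_left _ _)
    have h5 := h.C₄_mul_le.trans (min_le_right _ _)
    rw [← hKdef, le_div_iff₀ hδA] at h4
    rw [← hKdef, le_div_iff₀ hβ] at h5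
    have hC₄ : 0 < c.C₄ := h.C₅_pos.trans_le C₅_le_C₄
    have h6 : K * σ ≤ c.μ / 8 := by
      have : K * c.C₄ * E ≤ K * c.C₄ * (c.δA / 2) := by gcongr
      linarith
    have h7 : K * σ * (2 * c.β * E) ≤ c.C₃ * E ^ 2 * (c.μ / 4) := by
      have e1 := mul_le_mul_of_nonneg_right hKσ (show 0 ≤ 2 * c.β * E by positivity)
      have e2 := mul_le_mul_of_nonneg_right h5 (sq_nonneg E)
      unfold Consts.D₂ at e2
      linarith
    have h8 : K * σ * p ≤ c.μ / 4 * n := by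
      have e1 := mul_le_mul_of_nonneg_left hpup (show 0 ≤ K * σ by positivity)
      have e2 := mul_le_mul_of_nonneg_left hNlow.le (show 0 ≤ c.μ / 4 by positivity)
      linarith
    have h9 : K * σ * n ≤ c.μ / 8 * n := mul_le_mul_of_nonneg_right h6 hn0.le
    have h10 := mul_le_mul_of_nonneg_right h3 (show 0 ≤ K * σ by positivity)
    have h11 := mul_pos hμ hn0
    linarith
  · refine (abs_real_inner_le_norm _ _).trans ?_
    have h1 := mul_le_mul hT hpup hp0 (by positivity)
    refine h1.trans ?_
    have h2 : D + σ ≤ 2 * (c.C₅ * E) := by linarith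
    have h3 : 2 * c.Ca * (D + σ) * (2 * c.β * E) ≤ 2 * c.Ca * (2 * (c.C₅ * E)) * (2 * c.β * E) := by
      gcongr
    have h4 := mul_le_mul_of_nonneg_right h.C₅_mul_le (sq_nonneg E)
    have h5 := mul_le_mul_of_nonneg_left hNlow.le (show 0 ≤ c.μ / 4 by positivity)
    linarith

/-- `TDescent` finds descent when the tangential displacement is not too small. -/
lemma tangent_success {T : ℕ} {u : ℕ → Vec d} (hu0 : u 0 ∈ goldstein f σ x)
    (hstep : ∀ t < T, TDescentStep f x σ (u t) (u (t + 1)))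
    (hlarge : (1 - 3 * c.μ ^ 2 / (256 * c.L ^ 2)) ^ T * c.L ^ 2 <
      (c.C₃ * ‖proj M x - xbar‖ ^ 2) ^ 2) : ¬ LoopGoesOn f x σ (u T) := by
  intro hgo
  obtain ⟨-, hxb, -⟩ := h.mem_ball_of_lt_δLS hx
  have hσA := (h.tangent_radius hx hE hσ0 hσ hD).2.2.1
  have hδA := h.δA_pos
  have hC₃ := h.C₃_pos
  have hall := goesOn_of_goesOn (fun t ht => (hstep t ht).2) hgo
  have hmem : ∀ t ≤ T, u t ∈ goldstein f σ x := by
    intro t ht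
    induction t with
    | zero => exact hu0
    | succ k ih => exact (hstep k ht).mem_goldstein hσ0.le (ih (by omega))
  have hpow : ∀ t ≤ T, ‖u t - (tangent F (proj M x)).starProjection (u t)‖ ^ 2 ≤
      (1 - 3 * c.μ ^ 2 / (256 * c.L ^ 2)) ^ t * c.L ^ 2 := by
    intro t ht
    induction t with
    | zero =>
      rw [pow_zero, one_mul]
      exact pow_le_pow_left₀ (norm_nonneg _) ((norm_sub_starProjection_le _ _).trans
        (h.norm_le_of_mem_goldstein hxb (by linarith) hu0)) 2
    | succ k ih =>
      have h1 := h.tangent_contracts hx hE hσ0 hσ hD (hmem k (by omega)) (hstep k ht)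
        (hall k (by omega))
      have h2 := mul_le_mul_of_nonneg_left (ih (by omega)) h.rate_mem.1
      refine h1.trans (h2.trans (le_of_eq ?_))
      ring
  refine h.tangent_stops hx hE hσ0 hσ hD (hmem T le_rfl) ?_ hgo
  exact (le_of_sq_le_sq ((hpow T le_rfl).trans hlarge.le) (by positivity))

end Tangent

end Setting


/-! ### Scales of the grid. -/

section Grid

lemma gridσ_pos (G i : ℕ) : 0 < gridσ G i := by unfold gridσ; positivity

lemma gridσ_mono {G i j : ℕ} (h : i ≤ j) : gridσ G i ≤ gridσ G j :=
  pow_le_pow_of_le_one (by norm_num) (by norm_num) (by omega)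

lemma exists_gridσ {G : ℕ} {t : ℝ} (h1 : (1 / 2 : ℝ) ^ G ≤ t) (h2 : t < 1) :
    ∃ i < G, t / 2 < gridσ G i ∧ gridσ G i ≤ t := by
  classical
  have hex : ∃ k : ℕ, (1 / 2 : ℝ) ^ k ≤ t := ⟨G, h1⟩
  set k := Nat.find hex with hk
  have hkt : (1 / 2 : ℝ) ^ k ≤ t := Nat.find_spec hex
  have hkG : k ≤ G := Nat.find_min' hex h1
  -- The largest scale of the grid is 1/2, so exponent zero must be excluded; this is where `t < 1`
  -- enters.
  have hk0 : k ≠ 0 := by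
    intro h0
    rw [h0, pow_zero] at hkt
    linarith
  have hlt := Nat.find_min hex (m := k - 1) (by omega)
  rw [not_le] at hlt
  have hgrid : gridσ G (G - k) = (1 / 2) ^ k := by
    unfold gridσ; congr 1; omega
  refine ⟨G - k, by omega, ?_, by rw [hgrid]; exact hkt⟩
  rw [hgrid]
  obtain ⟨l, hl⟩ := Nat.exists_eq_succ_of_ne_zero hk0
  rw [hl, Nat.succ_eq_add_one, Nat.add_sub_cancel] at hlt
  rw [hl, pow_succ]
  linarith

/-- Contraction is proved for squared norms, whereas `ε₁` is stated for norms, with exponent `T /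
2`. -/
lemma sq_rpow_half {b : ℝ} (hb : 0 ≤ b) (T : ℕ) : (b ^ ((T : ℝ) / 2)) ^ 2 = b ^ T := by
  rw [← Real.rpow_natCast, ← Real.rpow_mul hb]
  norm_num

end Grid

/-! ### Invariants of an execution of the line search. -/

namespace IsExecution

variable {d : ℕ} {f : Vec d → ℝ} {x g xt : Vec d} {s : ℝ} {G T : ℕ} {td nd : ℕ → ℕ → Vec d}
  {r : ℕ → ℕ → ℝ} {ξ : ℕ → ℕ → Vec d} {τ : ℕ → ℕ → ℝ}

/-- Goldstein sets are convex, and the scales increase with the round, so a vector handed on remains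
admissible at the next scale. -/
lemma mem_goldstein (he : IsExecution f x g s G T td nd r ξ τ xt)
    (hτ : ∀ i < G, ∀ t < T, τ i t ∈ Icc (0 : ℝ) 1) (hg : g ∈ clarke f x) :
    ∀ i < G, (∀ t ≤ T, td i t ∈ goldstein f (gridσ G i) x) ∧
      ∀ t ≤ T, nd i t ∈ goldstein f (gridσ G i) x := by
  have round : ∀ i < G, td i 0 ∈ goldstein f (gridσ G i) x →
      (∀ t ≤ T, td i t ∈ goldstein f (gridσ G i) x) ∧
      ∀ t ≤ T, nd i t ∈ goldstein f (gridσ G i) x := by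
    intro i hi h0
    have htd : ∀ t ≤ T, td i t ∈ goldstein f (gridσ G i) x := by
      intro t ht
      induction t with
      | zero => exact h0
      | succ k ih =>
        exact (he.tangent_steps i hi k ht).mem_goldstein (gridσ_pos G i).le (ih (by omega))
    refine ⟨htd, fun t ht => ?_⟩
    induction t with
    | zero => rw [he.tangent_to_normal i hi]; exact htd T le_rfl
    | succ k ih =>
      exact (he.normal_steps i hi k ht).mem_goldstein (gridσ_pos G i).le (hτ i hi k ht)
        (ih (by omega))
  intro i hi
  induction i with
  | zero =>
    refine round 0 hi ?_
    rw [he.start hi]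
    exact clarke_subset_goldstein (by simpa using (gridσ_pos G 0).le) hg
  | succ k ih =>
    refine round (k + 1) hi ?_
    rw [he.next_round k hi]
    exact goldstein_mono (gridσ_mono (Nat.le_succ k)) ((ih (by omega)).2 T le_rfl)

lemma norm_nd_le_td (he : IsExecution f x g s G T td nd r ξ τ xt) {i : ℕ} (hi : i < G) :
    ∀ t ≤ T, ‖nd i t‖ ≤ ‖td i T‖ := by
  intro t ht
  induction t with
  | zero => rw [he.tangent_to_normal i hi]
  | succ k ih => exact (he.normal_steps i hi k ht).norm_le.trans (ih (by omega))

lemma norm_td_le (he : IsExecution f x g s G T td nd r ξ τ xt) {i : ℕ} (hi : i < G) :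
    ∀ t ≤ T, ‖td i t‖ ≤ ‖td i 0‖ := by
  intro t ht
  induction t with
  | zero => rfl
  | succ k ih => exact (he.tangent_steps i hi k ht).norm_le.trans (ih (by omega))

lemma norm_nd_le (he : IsExecution f x g s G T td nd r ξ τ xt) {i j : ℕ} (hji : j ≤ i)
    (hi : i < G) : ‖nd i T‖ ≤ ‖td j T‖ := by
  induction i, hji using Nat.le_induction with
  | base => exact he.norm_nd_le_td hi T le_rfl
  | succ k hk ih =>
    refine le_trans ?_ (ih (by omega))
    rw [← he.next_round k hi]
    exact (he.norm_nd_le_td hi T le_rfl).trans (he.norm_td_le hi T le_rfl)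

/-- The two loops share one stopping rule: a vector for which `TDescent` has succeeded passes
through `NDescent` untouched. The tangential regime is thus free of randomness. -/
lemma nd_eq_of_not_goesOn (he : IsExecution f x g s G T td nd r ξ τ xt) {i : ℕ} (hi : i < G)
    (hend : ¬ LoopGoesOn f x (gridσ G i) (td i T)) : nd i T = td i T := by
  have : ∀ t ≤ T, nd i t = td i T := by
    intro t ht
    induction t with
    | zero => exact he.tangent_to_normal i hi
    | succ k ih =>
      have h1 := ih (by omega)
      rw [(he.normal_steps i hi k ht).2 (by rwa [h1]), h1]
  exact this T le_rfl

lemma out_le (he : IsExecution f x g s G T td nd r ξ τ xt) : f xt ≤ f x :=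
  he.output_min x (Or.inl rfl)

/-- If the vector of round `i` is admissible and not subject to the loop condition, then the
output improves on `x` by the guaranteed descent. -/
lemma out_le_sub (he : IsExecution f x g s G T td nd r ξ τ xt) {i : ℕ} (hi : i < G)
    (hpos : 0 < ‖nd i T‖) (hend : ¬ LoopGoesOn f x (gridσ G i) (nd i T))
    (hs : gridσ G i ≤ ‖nd i T‖ / s) : f xt ≤ f x - gridσ G i / 8 * ‖nd i T‖ := by
  have h1 := he.output_min _ (Or.inr ⟨i, hi, hs, rfl⟩)
  have h2 : ¬ (f x - f (x - (gridσ G i / ‖nd i T‖) • nd i T) ≤ gridσ G i / 8 * ‖nd i T‖) :=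
    fun hle => hend ⟨hpos, hle⟩
  linarith

end IsExecution

namespace Setting

variable {d m : ℕ} {f : Vec d → ℝ} {xbar : Vec d} {M U : Set (Vec d)} {F : Vec d → Vec m}
  {c : Consts} {x g xt : Vec d} {σ s : ℝ} {G T : ℕ} {td nd : ℕ → ℕ → Vec d}
  {r : ℕ → ℕ → ℝ} {ξ : ℕ → ℕ → Vec d} {τ : ℕ → ℕ → ℝ}

/-! ### Bounds in terms of the gap. -/

section Gap

variable (h : Setting f xbar M U F c) (hx : ‖x - xbar‖ < c.δLS)
include h hx

lemma growth_le : c.γ / 2 * ‖x - xbar‖ ^ 2 ≤ f x - f xbar :=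
  h.reg.growth x (Metric.ball_subset_closedBall (h.mem_ball_of_lt_δLS hx).2.2)

lemma gap_nonneg : 0 ≤ f x - f xbar :=
  le_trans (by have := h.γ_pos; positivity) (h.growth_le hx)

/-- The gap is at most `L * δLS`, and one entry in the minimum defining `δLS` is chosen for this
bound. It guarantees that the scale fitting the gap is below both 1 and `δGrid`. -/
lemma gap_le_sqrt : √(2 * (f x - f xbar) / c.γ) ≤ c.D₁ * min (c.δGrid / 2) (1 / 4) := by
  obtain ⟨-, hxb, -⟩ := h.mem_ball_of_lt_δLS hx
  have hδ := (δLS_le (c := c)).2.2.2.2.2.1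
  have hL := h.L_pos
  have hγ := h.γ_pos
  have hD₁ := h.D₁_pos
  have hm : 0 < min (c.δGrid / 2) (1 / 4) := lt_min (half_pos h.δGrid_pos) (by norm_num)
  have h1 := (abs_le.1 (h.abs_sub_le hxb (Metric.mem_ball_self h.δA_pos))).2
  rw [le_div_iff₀ (by positivity)] at hδ
  rw [Real.sqrt_le_left (by positivity), div_le_iff₀ hγ]
  nlinarith

lemma norm_le_sqrt : ‖x - xbar‖ ≤ √(2 * (f x - f xbar) / c.γ) := by
  refine Real.le_sqrt_of_sq_le ?_
  rw [le_div_iff₀ h.γ_pos]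
  linarith [h.growth_le hx]

/-- A nonzero vector at which the loop stops promises a descent above σ/8 times its norm, and `f`
cannot drop below its value at `xbar` on the ball. -/
lemma norm_le_of_not_goesOn (hσ0 : 0 < σ) (hσ : σ ≤ c.δA / 2)
    (hend : ¬ LoopGoesOn f x σ g) : ‖g‖ ≤ 8 * (f x - f xbar) / σ := by
  rcases (norm_nonneg g).eq_or_lt with h0 | h0
  · rw [← h0]
    exact div_nonneg (mul_nonneg (by norm_num) (h.gap_nonneg hx)) hσ0.le
  · have h1 : σ / 8 * ‖g‖ < f x - f (x - (σ / ‖g‖) • g) := by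
      by_contra! hcon
      exact hend ⟨h0, hcon⟩
    have h2 := mem_ball_of_norm_sub_le (h.mem_ball_of_lt_δLS hx).1 hσ
      (norm_step_sub x h0 hσ0.le).le
    have h3 := h.reg.growth _ (Metric.ball_subset_closedBall (h.ball_le h2))
    have h4 : 0 ≤ c.γ / 2 * ‖x - (σ / ‖g‖) • g - xbar‖ ^ 2 := by
      have := h.γ_pos; positivity
    rw [le_div_iff₀ hσ0]
    linarith

end Gap

/-! ### `TDescent` at scales dominating the distance to the manifold. -/

section Distance

variable (h : Setting f xbar M U F c) (hx : ‖x - xbar‖ < c.δLS) (hσ0 : 0 < σ)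
  (hσ : σ ≤ c.δGrid) (hD : Metric.infDist x M ≤ c.D₁ * σ)
include h hx hσ0 hσ hD

/-- A vector much longer than the tangential bound is nearly normal, so aiming controls its whole
inner product with the new subgradient: `-7/8 μ ‖g‖` from the normal part, against errors `μ/4 ‖g‖`
and `μ/32 ‖g‖`. -/
lemma norm_contracts {g g' : Vec d} (hg : g ∈ goldstein f σ x)
    (hstep : TDescentStep f x σ g g') (hgo : LoopGoesOn f x σ g)
    (hlarge : 8 * (c.Ca * (Metric.infDist x M + σ) + c.β * ‖proj M x - xbar‖) ≤ ‖g‖) :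
    ‖g'‖ ^ 2 ≤ (1 - c.μ ^ 2 / (64 * c.L ^ 2)) * ‖g‖ ^ 2 := by
  obtain ⟨hxh, hxb, hx2⟩ := h.mem_ball_of_lt_δLS hx
  obtain ⟨v, hv, hmin⟩ := hstep.1 hgo
  have hδA := h.δA_pos
  have hCa := h.Ca_pos
  have hL := h.L_pos
  have hμ := h.μ_pos
  have hβ := h.β_pos
  have hCM := h.CM_pos
  have hD₁ := h.D₁_pos
  have hσA : σ ≤ c.δA / 2 := hσ.trans (min_le_left _ _)
  have hgL := h.norm_le_of_mem_goldstein hxb (by linarith) hg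
  have hvg : v ∈ goldstein f σ x :=
    clarke_subset_goldstein (norm_step_sub x hgo.1 hσ0.le).le hv
  have hvL := h.norm_le_of_mem_goldstein hxb (by linarith) hvg
  have hN := h.inner_normal_le hxh hσ0 hσA (norm_pos_iff.1 hgo.1) hv
  have hT1 := h.reg.strong_a₂ x hxb σ hσ0 (by linarith) g hg
  have hT2 := h.reg.strong_a₂ x hxb σ hσ0 (by linarith) v hvg
  have hE := h.norm_proj_sub_le hx2
  have hDx := h.infDist_le (x := x)
  have hxG : ‖x - xbar‖ ≤ c.δGrid := hx.le.trans (δLS_le (c := c)).2.2.2.1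
  set P := tangent F (proj M x) with hP
  set E := ‖proj M x - xbar‖ with hEdef
  set D := Metric.infDist x M with hDdef
  set κ := c.Ca * (D + σ) + c.β * E with hκ
  have hD0 : 0 ≤ D := Metric.infDist_nonneg
  have hg0 := hgo.1
  have hκ0 : 0 ≤ κ := (norm_nonneg _).trans hT1
  have hκμ : κ ≤ c.μ / 4 := by
    have h1 : D + σ ≤ 2 * c.δGrid := by linarith
    have h2 : E ≤ 2 * c.δGrid := by linarith
    have h3 := mul_le_mul_of_nonneg_left h1 hCa.le
    have h4 := mul_le_mul_of_nonneg_left h2 hβ.le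
    linarith [h.δGrid_mul_le_μ]
  have hNg : 7 / 8 * ‖g‖ ≤ ‖g - P.starProjection g‖ := by
    have := norm_add_le (P.starProjection g) (g - P.starProjection g)
    rw [add_sub_cancel] at this
    linarith
  have hPP : inner ℝ (P.starProjection v) (P.starProjection g) ≤ c.μ / 32 * ‖g‖ := by
    refine (real_inner_le_norm _ _).trans ((mul_le_mul hT2 hT1 (norm_nonneg _) hκ0).trans ?_)
    have := mul_le_mul hκμ (show κ ≤ ‖g‖ / 8 by linarith) hκ0 (by linarith)
    linarith
  have herr : (c.μ + c.L) * (D + c.CM * (D ^ 2 + σ ^ 2)) ≤ c.μ / 4 * σ := by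
    have h1 : (c.μ + c.L) * D ≤ c.μ / 8 * σ := by
      rw [← h.mul_D₁, mul_assoc]; exact mul_le_mul_of_nonneg_left hD (by linarith)
    have h2 : c.CM * (D ^ 2 + σ ^ 2) ≤ c.D₁ * σ := by
      have h3 : D ^ 2 + σ ^ 2 ≤ σ * c.δGrid * (c.D₁ + 1) := by
        have e1 : D * D ≤ c.D₁ * σ * c.δGrid := mul_le_mul hD (by linarith) hD0 (by positivity)
        have e2 : σ * σ ≤ σ * c.δGrid := mul_le_mul_of_nonneg_left hσ hσ0.le
        linarith
      have h4 := mul_le_mul_of_nonneg_left h3 hCM.le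
      have h5 := mul_le_mul_of_nonneg_left h.δGrid_mul_le (show 0 ≤ c.D₁ * σ by positivity)
      have h6 : c.D₁ * σ * (c.δGrid * (c.CM * (1 / c.D₁ + 1))) =
          c.CM * (σ * c.δGrid * (c.D₁ + 1)) := by field_simp; ring
      linarith
    have h3 := mul_le_mul_of_nonneg_left h2 (show 0 ≤ c.μ + c.L by linarith)
    rw [← mul_assoc (c.μ + c.L) c.D₁, h.mul_D₁] at h3
    linarith
  have herr' : ‖g‖ / σ * ((c.μ + c.L) * (D + c.CM * (D ^ 2 + σ ^ 2))) ≤ c.μ / 4 * ‖g‖ := by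
    have := mul_le_mul_of_nonneg_left herr (div_nonneg hg0.le hσ0.le)
    have e : ‖g‖ / σ * (c.μ / 4 * σ) = c.μ / 4 * ‖g‖ := by field_simp
    linarith
  refine hmin.norm_sq_le_of_inner_le hμ h.μ_le hgL hvL ?_
  rw [inner_eq_add P v g]
  have h1 := mul_le_mul_of_nonneg_left hNg hμ.le
  have h2 := mul_pos hμ hg0
  linarith

/-- The outcome of `TDescent` at a scale that dominates `dist(x, M)`. -/
lemma norm_TDescent_le {T : ℕ} {u : ℕ → Vec d} (hu0 : u 0 ∈ goldstein f σ x)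
    (hstep : ∀ t < T, TDescentStep f x σ (u t) (u (t + 1))) :
    ‖u T‖ ≤ 8 * (f x - f xbar) / σ ∨
    ‖u T‖ ≤ 8 * (c.Ca * (Metric.infDist x M + σ) + c.β * ‖proj M x - xbar‖) ∨
    ‖u T‖ ≤ (1 - c.μ ^ 2 / (64 * c.L ^ 2)) ^ ((T : ℝ) / 2) * c.L := by
  obtain ⟨-, hxb, -⟩ := h.mem_ball_of_lt_δLS hx
  have hδA := h.δA_pos
  have hσA : σ ≤ c.δA / 2 := hσ.trans (min_le_left _ _)
  by_cases hgo : LoopGoesOn f x σ (u T)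
  swap
  · exact Or.inl (h.norm_le_of_not_goesOn hx hσ0 hσA hgo)
  refine Or.inr ((le_total _ _).imp_right fun hlarge => ?_)
  have hall := goesOn_of_goesOn (fun t ht => (hstep t ht).2) hgo
  have hmem : ∀ t ≤ T, u t ∈ goldstein f σ x := by
    intro t ht
    induction t with
    | zero => exact hu0
    | succ k ih => exact (hstep k ht).mem_goldstein hσ0.le (ih (by omega))
  have hanti : ∀ t ≤ T, ‖u T‖ ≤ ‖u t‖ := by
    intro t ht
    induction ht using Nat.decreasingInduction with
    | self => rfl
    | of_succ k hk ih => exact ih.trans (hstep k hk).norm_le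
  have hpow : ∀ t ≤ T, ‖u t‖ ^ 2 ≤ (1 - c.μ ^ 2 / (64 * c.L ^ 2)) ^ t * c.L ^ 2 := by
    intro t ht
    induction t with
    | zero =>
      rw [pow_zero, one_mul]
      exact pow_le_pow_left₀ (norm_nonneg _)
        (h.norm_le_of_mem_goldstein hxb (by linarith) hu0) 2
    | succ k ih =>
      have h1 := h.norm_contracts hx hσ0 hσ hD (hmem k (by omega)) (hstep k ht)
        (hall k (by omega)) (hlarge.trans (hanti k (by omega)))
      have h2 := mul_le_mul_of_nonneg_left (ih (by omega)) h.rate_mem.2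
      refine h1.trans (h2.trans (le_of_eq ?_))
      ring
  have h1 := hpow T le_rfl
  rw [← sq_rpow_half h.rate_mem.2, ← mul_pow] at h1
  exact le_of_sq_le_sq h1 (mul_nonneg (Real.rpow_nonneg h.rate_mem.2 _) h.L_pos.le)

end Distance

end Setting


/-! ### Step length and decrease along one execution. -/

namespace Setting

variable {d m : ℕ} {f : Vec d → ℝ} {xbar : Vec d} {M U : Set (Vec d)} {F : Vec d → Vec m}
  {c : Consts} {x g xt : Vec d} {σ s slb : ℝ} {G T : ℕ} {td nd : ℕ → ℕ → Vec d}
  {r : ℕ → ℕ → ℝ} {ξ : ℕ → ℕ → Vec d} {τ : ℕ → ℕ → ℝ}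

lemma le_ε₂ (h : Setting f xbar M U F c) (G : ℕ) :
    (c.L / min 1 c.a₁ + c.β / (2 * min 1 c.a₁ * c.a₂ ^ 2)) * (1 / 2) ^ G ≤ c.ε₂ G ∧
    16 * c.L * (1 / 2) ^ G ≤ c.ε₂ G := by
  have ha₁ := h.a₁_pos
  have ha₂ := h.a₂_pos
  have hL := h.L_pos
  have hβ := h.β_pos
  have h1 : (c.L / min 1 c.a₁ + c.β / (2 * min 1 c.a₁ * c.a₂ ^ 2)) * (1 / 2) ^ G ≤ c.ε₂ G :=
    mul_le_mul_of_nonneg_right ((le_max_left _ _).trans (le_max_left _ _)) (by positivity)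
  refine ⟨h1, le_trans (mul_le_mul_of_nonneg_right ?_ (by positivity)) h1⟩
  have hm : 0 < min 1 c.a₁ := lt_min one_pos ha₁
  have hm' : min 1 c.a₁ ≤ 1 / 16 := (min_le_right _ _).trans ((a₁_le_D₁).trans h.D₁_le)
  have h2 : 16 * c.L ≤ c.L / min 1 c.a₁ := by
    rw [le_div_iff₀ hm]; nlinarith
  have h3 : 0 ≤ c.β / (2 * min 1 c.a₁ * c.a₂ ^ 2) := by positivity
  linarith

/-- The output is close to the starting point. -/
theorem norm_out_sub_le (h : Setting f xbar M U F c) (hx : ‖x - xbar‖ < c.δLS)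
    (he : IsExecution f x g s G T td nd r ξ τ xt)
    (hτ : ∀ i < G, ∀ t < T, τ i t ∈ Icc (0 : ℝ) 1) (hg : g ∈ clarke f x)
    (hslb : 0 < slb) (hs : s ∈ Icc slb c.L) (hG : (1 / 2 : ℝ) ^ G ≤ c.δGrid) :
    ‖xt - x‖ ≤ c.C₆ slb * max (max (c.ε₁ T / slb) (c.ε₂ G / slb))
      √(2 * (f x - f xbar) / min slb c.γ) := by
  have hγ := h.γ_pos
  have hL := h.L_pos
  have hD₁ := h.D₁_pos
  have hCa := h.Ca_pos
  have hβ := h.β_pos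
  have hgap := h.gap_nonneg hx
  set Q := max (max (c.ε₁ T / slb) (c.ε₂ G / slb)) √(2 * (f x - f xbar) / min slb c.γ) with hQ
  set q := √(2 * (f x - f xbar) / c.γ) with hq
  have hq0 : 0 ≤ q := Real.sqrt_nonneg _
  have hqQ : q ≤ Q := by
    refine le_trans (Real.sqrt_le_sqrt ?_) (le_max_right _ _)
    exact div_le_div_of_nonneg_left (by linarith) (lt_min hslb hγ) (min_le_right _ _)
  have hQ0 : 0 ≤ Q := hq0.trans hqQ
  have hC1 : 1 ≤ c.C₆ slb := (le_max_left _ _).trans (le_max_left _ _)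
  have hC2 : 8 * (c.Ca + 2 * c.β + 2 * c.Ca * (1 / c.D₁)) / slb ≤ c.C₆ slb :=
    (le_max_right _ _).trans (le_max_left _ _)
  have hC3 : 2 * (1 / c.D₁) ≤ c.C₆ slb := (le_max_left _ _).trans (le_max_right _ _)
  have hC4 : 4 * c.γ * c.D₁ / slb ≤ c.C₆ slb := (le_max_right _ _).trans (le_max_right _ _)
  have hs0 : 0 < s := hslb.trans_le hs.1
  rcases he.output_mem with hxt | ⟨i, hi, hle, hxt⟩
  · rw [mem_singleton_iff.1 hxt, sub_self, norm_zero]; positivity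
  have hnd : 0 < ‖nd i T‖ := by
    have := (gridσ_pos G i).trans_le hle
    by_contra! hcon
    have h0 : ‖nd i T‖ = 0 := le_antisymm hcon (norm_nonneg _)
    rw [h0, zero_div] at this
    exact lt_irrefl _ this
  rw [hxt, norm_step_sub x hnd (gridσ_pos G i).le]
  have hqm := h.gap_le_sqrt hx
  have hqD : 2 * q / c.D₁ ≤ c.δGrid ∧ 2 * q / c.D₁ ≤ 1 / 2 := by
    rw [div_le_iff₀ hD₁, div_le_iff₀ hD₁]
    have e1 := mul_le_mul_of_nonneg_left (min_le_left (c.δGrid / 2) (1 / 4)) hD₁.le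
    have e2 := mul_le_mul_of_nonneg_left (min_le_right (c.δGrid / 2) (1 / 4)) hD₁.le
    constructor <;> linarith
  -- The reference scale lies between `q / D₁` and `2 * q / D₁`, or is the smallest one if this
  -- range lies below the grid. It dominates the distance to `M`, because that distance is at most
  -- `q`.
  obtain ⟨j, hj, hσj, hqj, hcase⟩ : ∃ j < G, gridσ G j ≤ c.δGrid ∧ q ≤ c.D₁ * gridσ G j ∧
      (gridσ G j ≤ 2 * q / c.D₁ ∨ j = 0) := by
    rcases le_or_gt ((1 / 2 : ℝ) ^ G) (2 * q / c.D₁) with hc | hc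
    · obtain ⟨j, hj, h1, h2⟩ := exists_gridσ hc (by linarith [hqD.2])
      refine ⟨j, hj, h2.trans hqD.1, ?_, Or.inl h2⟩
      have : c.D₁ * (2 * q / c.D₁ / 2) = q := by field_simp
      nlinarith
    · refine ⟨0, by omega, hG, ?_, Or.inr rfl⟩
      rw [div_lt_iff₀ hD₁] at hc
      show q ≤ c.D₁ * (1 / 2) ^ (G - 0)
      rw [Nat.sub_zero]
      linarith
  -- Before round `j` the scale itself is small enough. From round `j` on, the test `σ_i ≤ ‖v_{i+1}‖
  -- / s` and the monotonicity of norms bound the step by the outcome of `TDescent` in round `j`.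
  rcases lt_or_ge i j with hij | hij
  · have hcj : gridσ G j ≤ 2 * q / c.D₁ := by
      rcases hcase with h1 | h1
      · exact h1
      · omega
    calc gridσ G i ≤ gridσ G j := gridσ_mono hij.le
      _ ≤ 2 * (1 / c.D₁) * q := by rw [mul_one_div, div_mul_eq_mul_div]; exact hcj
      _ ≤ c.C₆ slb * Q := mul_le_mul hC3 hqQ hq0 (by linarith)
  have hstep : gridσ G i ≤ ‖td j T‖ / slb := by
    refine hle.trans ?_
    have := he.norm_nd_le hij hi
    gcongr
    exact hs.1
  have hσj0 := gridσ_pos G j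
  have hxq : ‖x - xbar‖ ≤ q := h.norm_le_sqrt hx
  have hDq : Metric.infDist x M ≤ q := h.infDist_le.trans hxq
  have hEq : ‖proj M x - xbar‖ ≤ 2 * q :=
    (h.norm_proj_sub_le (h.mem_ball_of_lt_δLS hx).2.2).trans (by linarith)
  rcases h.norm_TDescent_le hx hσj0 hσj (hDq.trans hqj)
      ((he.mem_goldstein hτ hg j hj).1 0 (Nat.zero_le _)) (he.tangent_steps j hj) with h1 | h1 | h1
  · have hq2 : q ^ 2 * c.γ = 2 * (f x - f xbar) := by
      rw [hq, Real.sq_sqrt (div_nonneg (by linarith) hγ.le)]; field_simp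
    have h2 : 8 * (f x - f xbar) / gridσ G j ≤ 4 * c.γ * c.D₁ * q := by
      rw [div_le_iff₀ hσj0]
      have := mul_le_mul_of_nonneg_left hqj (show 0 ≤ 4 * c.γ * q by positivity)
      linarith
    calc gridσ G i ≤ 4 * c.γ * c.D₁ * q / slb := hstep.trans (by gcongr; exact h1.trans h2)
      _ = 4 * c.γ * c.D₁ / slb * q := by ring
      _ ≤ c.C₆ slb * Q := mul_le_mul hC4 hqQ hq0 (by linarith)
  · have hσQ : gridσ G j ≤ 2 * (1 / c.D₁) * Q := by
      rcases hcase with h2 | h2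
      · calc gridσ G j ≤ 2 * q / c.D₁ := h2
          _ = 2 * (1 / c.D₁) * q := by ring
          _ ≤ 2 * (1 / c.D₁) * Q := by gcongr
      · have h3 : gridσ G j * slb ≤ c.ε₂ G := by
          rw [h2]
          show (1 / 2 : ℝ) ^ (G - 0) * slb ≤ c.ε₂ G
          rw [Nat.sub_zero]
          refine le_trans ?_ (h.le_ε₂ G).2
          have h4 : slb ≤ 16 * c.L := by linarith [hs.1.trans hs.2]
          have := mul_le_mul_of_nonneg_right h4 (show (0 : ℝ) ≤ (1 / 2) ^ G by positivity)
          linarith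
        rw [← le_div_iff₀ hslb] at h3
        have h4 : c.ε₂ G / slb ≤ Q := (le_max_right _ _).trans (le_max_left _ _)
        have h5 : 1 ≤ 2 * (1 / c.D₁) := by
          rw [mul_one_div, le_div_iff₀ hD₁]; linarith [h.D₁_le]
        nlinarith
    have h2 : 8 * (c.Ca * (Metric.infDist x M + gridσ G j) + c.β * ‖proj M x - xbar‖) ≤
        8 * (c.Ca + 2 * c.β + 2 * c.Ca * (1 / c.D₁)) * Q := by
      have e1 := mul_le_mul_of_nonneg_left (add_le_add (hDq.trans hqQ) hσQ) hCa.le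
      have e2 := mul_le_mul_of_nonneg_left (hEq.trans (by linarith : 2 * q ≤ 2 * Q)) hβ.le
      linarith
    calc gridσ G i ≤ 8 * (c.Ca + 2 * c.β + 2 * c.Ca * (1 / c.D₁)) * Q / slb :=
          hstep.trans (by gcongr; exact h1.trans h2)
      _ = 8 * (c.Ca + 2 * c.β + 2 * c.Ca * (1 / c.D₁)) / slb * Q := by ring
      _ ≤ c.C₆ slb * Q := mul_le_mul_of_nonneg_right hC2 hQ0
  · have h2 : ‖td j T‖ ≤ c.ε₁ T := h1.trans (le_max_right _ _)
    calc gridσ G i ≤ c.ε₁ T / slb := hstep.trans (by gcongr)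
      _ ≤ Q := (le_max_left _ _).trans (le_max_left _ _)
      _ ≤ c.C₆ slb * Q := le_mul_of_one_le_left hQ0 hC1

/-- Improvement of the function value when the tangential displacement dominates. -/
theorem out_le_of_tangent (h : Setting f xbar M U F c) (hx : ‖x - xbar‖ < c.δLS)
    (he : IsExecution f x g s G T td nd r ξ τ xt)
    (hτ : ∀ i < G, ∀ t < T, τ i t ∈ Icc (0 : ℝ) 1) (hg : g ∈ clarke f x)
    (hs0 : 0 < s) (hs : s ≤ c.L)
    (hD : Metric.infDist x M ≤ c.a₂ ^ 2 * ‖proj M x - xbar‖ ^ 2) :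
    f xt - f xbar ≤ max (c.ρ * (f x - f xbar)) (max (c.ε₁ T) (c.ε₂ G)) := by
  obtain ⟨-, hxb, hx2⟩ := h.mem_ball_of_lt_δLS hx
  have hγ := h.γ_pos
  have hL := h.L_pos
  have hβ := h.β_pos
  have ha₁ := h.a₁_pos
  have ha₂ := h.a₂_pos
  have hC₃ := h.C₃_pos
  have hgap0 := h.gap_nonneg hx
  have hgap := h.reg.gap x hxb
  have hEx := h.norm_proj_sub_le hx2
  set E := ‖proj M x - xbar‖ with hE
  have hE0 : 0 ≤ E := norm_nonneg _
  have hgapE : f x - f xbar ≤ (c.L * c.a₂ ^ 2 + c.β / 2) * E ^ 2 := by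
    have := mul_le_mul_of_nonneg_left hD hL.le
    linarith
  have hout := he.out_le
  -- If the fitting scale is finer than the grid, E is so small that the gap falls under the first
  -- term of `ε₂`.
  rcases lt_or_ge (2 * c.a₂ * E) ((1 / 2 : ℝ) ^ G) with hsmall | hbig
  · refine le_trans ?_ ((le_max_right _ _).trans (le_max_right _ _))
    refine le_trans ?_ (h.le_ε₂ G).1
    have hm : 0 < min 1 c.a₁ := lt_min one_pos ha₁
    have hm' : min 1 c.a₁ ≤ 1 := min_le_left _ _
    have hP : (0 : ℝ) < (1 / 2) ^ G := by positivity
    have hP1 : (1 / 2 : ℝ) ^ G ≤ 1 := pow_le_one₀ (by norm_num) (by norm_num)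
    have h1 : c.a₂ * E ≤ (1 / 2) ^ G := by nlinarith
    have h2 : (c.a₂ * E) ^ 2 ≤ (1 / 2) ^ G := by
      have := mul_le_mul h1 h1 (by positivity) hP.le
      nlinarith
    have h3 : (c.L * c.a₂ ^ 2 + c.β / 2) * E ^ 2 =
        (c.L + c.β / (2 * c.a₂ ^ 2)) * (c.a₂ * E) ^ 2 := by field_simp
    have h4 : c.L + c.β / (2 * c.a₂ ^ 2) ≤
        c.L / min 1 c.a₁ + c.β / (2 * min 1 c.a₁ * c.a₂ ^ 2) := by
      refine add_le_add ?_ ?_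
      · exact le_div_self hL.le hm hm'
      · refine div_le_div_of_nonneg_left hβ.le (by positivity) ?_
        have := mul_le_mul_of_nonneg_right hm' (show 0 ≤ 2 * c.a₂ ^ 2 by positivity)
        linarith
    have h5 := mul_le_mul h4 h2 (by positivity) (by positivity)
    linarith
  have hEpos : 0 < E := by
    have : (0 : ℝ) < (1 / 2) ^ G := by positivity
    by_contra! hcon
    have : E = 0 := le_antisymm hcon hE0
    rw [this, mul_zero] at hbig
    linarith
  have hlt1 : 2 * c.a₂ * E < 1 := by
    have hδ := (δLS_le (c := c)).2.2.2.2.1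
    rw [le_div_iff₀ (by positivity)] at hδ
    have h1 : E < 2 * c.δLS := by linarith
    have h2 := mul_lt_mul_of_pos_left h1 (show 0 < 2 * c.a₂ by positivity)
    have h3 : 0 ≤ c.δLS * c.a₁ := mul_nonneg ((norm_nonneg _).trans hx.le) ha₁.le
    linarith
  obtain ⟨i, hi, hσ1, hσ2⟩ := exists_gridσ hbig hlt1
  have hσ0 := gridσ_pos G i
  have hσ1' : c.a₂ * E < gridσ G i := by linarith
  have hDσ : Metric.infDist x M ≤ gridσ G i ^ 2 := by
    refine hD.trans ?_
    rw [← mul_pow]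
    exact pow_le_pow_left₀ (by positivity) hσ1'.le 2
  have hmem := (he.mem_goldstein hτ hg i hi).1
  -- Either T contractions bring the normal part below the stopping threshold, or that threshold,
  -- and with it the gap, is already below the accuracy `ε₁`.
  by_cases hlarge : (1 - 3 * c.μ ^ 2 / (256 * c.L ^ 2)) ^ T * c.L ^ 2 < (c.C₃ * E ^ 2) ^ 2
  · have hend := h.tangent_success hx hEpos hσ0 hσ2 hDσ (hmem 0 (Nat.zero_le _))
      (he.tangent_steps i hi) hlarge
    have hnd := he.nd_eq_of_not_goesOn hi hend
    have hlow := (h.tangent_bounds hx hEpos hσ0 hσ2 hDσ (hmem T le_rfl)).2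
    have hlow' : c.γ / 4 * E ≤ ‖nd i T‖ := by
      rw [hnd]
      refine le_trans ?_ (hlow.trans ((tangent F (proj M x)).norm_starProjection_apply_le _))
      have := mul_pos hγ hEpos
      rw [← hE]
      linarith
    have hndpos : 0 < ‖nd i T‖ := lt_of_lt_of_le (by positivity) hlow'
    -- Admissibility of the step: `σ_i s ≤ 2 a₂ E L ≤ γ E / 4`, by the choice of `a₂`.
    have hdec := he.out_le_sub hi hndpos (by rwa [hnd]) (by
      rw [le_div_iff₀ hs0]
      have e1 := mul_le_mul hσ2 hs hs0.le (by positivity)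
      have e2 := mul_le_mul_of_nonneg_right h.two_a₂_mul_le hE0
      linarith)
    refine le_trans ?_ (le_max_left _ _)
    have hdec2 : c.a₂ * E * (c.γ / 4 * E) ≤ gridσ G i * ‖nd i T‖ :=
      mul_le_mul hσ1'.le hlow' (by positivity) hσ0.le
    set mx := max (4 * c.L * c.a₂ ^ 2) c.β with hmx
    have hmx0 : 0 < mx := lt_max_of_lt_right hβ
    have hgm : f x - f xbar ≤ mx * E ^ 2 := by
      refine hgapE.trans (mul_le_mul_of_nonneg_right ?_ (sq_nonneg E))
      have e1 := le_max_left (4 * c.L * c.a₂ ^ 2) c.β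
      have e2 := le_max_right (4 * c.L * c.a₂ ^ 2) c.β
      rw [← hmx] at e1 e2
      linarith
    have hρ : (1 - 1 / 8 * (c.γ * c.a₂ / (8 * mx))) * (f x - f xbar) ≤
        c.ρ * (f x - f xbar) := by
      refine mul_le_mul_of_nonneg_right ?_ hgap0
      unfold Consts.ρ
      linarith [min_le_left (c.γ * c.a₂ / (8 * max (4 * c.L * c.a₂ ^ 2) c.β))
        (c.μ * c.a₁ / (4 * max (2 * c.L) (c.β / c.a₂ ^ 2)))]
    refine le_trans ?_ hρ
    have h3 : c.γ * c.a₂ / (8 * mx) * (f x - f xbar) ≤ c.γ * c.a₂ / 8 * E ^ 2 := by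
      have := mul_le_mul_of_nonneg_left hgm (show 0 ≤ c.γ * c.a₂ / (8 * mx) by positivity)
      have e : c.γ * c.a₂ / (8 * mx) * (mx * E ^ 2) = c.γ * c.a₂ / 8 * E ^ 2 := by field_simp
      linarith
    have h4 : 0 < c.γ * c.a₂ * E ^ 2 := by positivity
    linarith
  · refine le_trans ?_ ((le_max_left _ _).trans (le_max_right _ _))
    refine le_trans ?_ (le_max_left _ _)
    rw [not_lt, ← sq_rpow_half h.rate_mem.1, ← mul_pow] at hlarge
    set b := (1 - 3 * c.μ ^ 2 / (256 * c.L ^ 2)) ^ ((T : ℝ) / 2) with hb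
    have hb0 : 0 ≤ b := Real.rpow_nonneg h.rate_mem.1 _
    have h1 : c.C₃ * E ^ 2 ≤ b * c.L := le_of_sq_le_sq hlarge (by positivity)
    have h2 : E ^ 2 ≤ b * c.L / c.C₃ := by rw [le_div_iff₀ hC₃]; linarith
    have h3 : c.L * c.a₂ ^ 2 + c.β / 2 ≤ c.C₅ ^ 2 * c.L + c.β := by
      have : c.a₂ ^ 2 ≤ c.C₅ ^ 2 :=
        pow_le_pow_left₀ ha₂.le (by linarith [two_a₂_le_C₅ (c := c)]) 2
      nlinarith
    have h4 := mul_le_mul h3 h2 (sq_nonneg E) (by positivity)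
    have h5 : (c.C₅ ^ 2 * c.L + c.β) * (b * c.L / c.C₃) =
        (c.C₅ ^ 2 * c.L + c.β) * c.L / c.C₃ * b := by ring
    linarith

/-- If the distance to the manifold dominates, the output improves on `x` as soon as the loop of
`NDescent` at the right scale has ended. -/
theorem out_le_of_normal (h : Setting f xbar M U F c) (hx : ‖x - xbar‖ < c.δLS)
    (he : IsExecution f x g s G T td nd r ξ τ xt)
    (hτ : ∀ i < G, ∀ t < T, τ i t ∈ Icc (0 : ℝ) 1) (hg : g ∈ clarke f x)
    (hs0 : 0 < s) (hs : s ≤ c.L)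
    (hD : c.a₂ ^ 2 * ‖proj M x - xbar‖ ^ 2 < Metric.infDist x M) {i : ℕ} (hi : i < G)
    (hσ1 : c.a₁ * Metric.infDist x M / 2 < gridσ G i)
    (hσ2 : gridσ G i ≤ c.a₁ * Metric.infDist x M)
    (hend : ¬ LoopGoesOn f x (gridσ G i) (nd i T)) :
    f xt - f xbar ≤ c.ρ * (f x - f xbar) := by
  obtain ⟨-, hxb, hx2⟩ := h.mem_ball_of_lt_δLS hx
  have hμ := h.μ_pos
  have hL := h.L_pos
  have hβ := h.β_pos
  have ha₁ := h.a₁_pos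
  have ha₂ := h.a₂_pos
  have hgap0 := h.gap_nonneg hx
  have hgap := h.reg.gap x hxb
  have hDx := h.infDist_le (x := x)
  have hδ1 := (δLS_le (c := c)).2.2.2.2.2.2
  set E := ‖proj M x - xbar‖ with hE
  set D := Metric.infDist x M with hDdef
  have hD0 : 0 < D := lt_of_le_of_lt (by positivity) hD
  have hlow := h.D₂_le_norm hx hD0 (hσ2.trans (mul_le_mul_of_nonneg_right (a₁_le_D₁) hD0.le))
    ((he.mem_goldstein hτ hg i hi).2 T le_rfl)
  have hD₂ : c.D₂ = c.μ / 2 := rfl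
  have hndpos : 0 < ‖nd i T‖ := lt_of_lt_of_le (by rw [hD₂]; positivity) hlow
  -- Admissibility of the step: `σ_i s ≤ a₁ D L ≤ D₂ D ≤ D₂`, by the choice of `a₁` and since `D ≤
  -- 1`.
  have hdec := he.out_le_sub hi hndpos hend (by
    rw [le_div_iff₀ hs0]
    have e1 := mul_le_mul hσ2 hs hs0.le (by positivity)
    have e2 : c.a₁ * D * c.L ≤ c.D₂ * D := by
      have := mul_le_mul_of_nonneg_right h.a₁_mul_le hD0.le
      linarith
    have e3 : c.D₂ * D ≤ c.D₂ * 1 :=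
      mul_le_mul_of_nonneg_left (by linarith) (by rw [hD₂]; positivity)
    linarith)
  have hdec2 : c.a₁ * D / 2 * (c.μ / 2) ≤ gridσ G i * ‖nd i T‖ :=
    mul_le_mul hσ1.le hlow (by positivity) (gridσ_pos G i).le
  set mx := max (2 * c.L) (c.β / c.a₂ ^ 2) with hmx
  have hmx0 : 0 < mx := lt_max_of_lt_left (by positivity)
  have hgm : f x - f xbar ≤ mx * D := by
    have h1 : E ^ 2 ≤ D / c.a₂ ^ 2 := by
      rw [le_div_iff₀ (by positivity)]; linarith
    have h2 := mul_le_mul_of_nonneg_left h1 (show 0 ≤ c.β / 2 by positivity)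
    have e1 := mul_le_mul_of_nonneg_right (le_max_left (2 * c.L) (c.β / c.a₂ ^ 2)) hD0.le
    have e2 := mul_le_mul_of_nonneg_right (le_max_right (2 * c.L) (c.β / c.a₂ ^ 2)) hD0.le
    rw [← hmx] at e1 e2
    have e3 : c.β / 2 * (D / c.a₂ ^ 2) = c.β / c.a₂ ^ 2 * D / 2 := by ring
    linarith
  have hρ : (1 - 1 / 8 * (c.μ * c.a₁ / (4 * mx))) * (f x - f xbar) ≤
      c.ρ * (f x - f xbar) := by
    refine mul_le_mul_of_nonneg_right ?_ hgap0
    unfold Consts.ρ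
    linarith [min_le_right (c.γ * c.a₂ / (8 * max (4 * c.L * c.a₂ ^ 2) c.β))
      (c.μ * c.a₁ / (4 * max (2 * c.L) (c.β / c.a₂ ^ 2)))]
  refine le_trans ?_ hρ
  have h3 : c.μ * c.a₁ / (4 * mx) * (f x - f xbar) ≤ c.μ * c.a₁ / 4 * D := by
    have := mul_le_mul_of_nonneg_left hgm (show 0 ≤ c.μ * c.a₁ / (4 * mx) by positivity)
    have e : c.μ * c.a₁ / (4 * mx) * (mx * D) = c.μ * c.a₁ / 4 * D := by field_simp
    linarith
  linarith

/-- If the scale suited to the distance to the manifold is below the grid, the gap is already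
small. -/
theorem gap_le_ε₂ (h : Setting f xbar M U F c) (hx : ‖x - xbar‖ < c.δLS)
    (hD : c.a₂ ^ 2 * ‖proj M x - xbar‖ ^ 2 < Metric.infDist x M)
    (hsmall : c.a₁ * Metric.infDist x M < (1 / 2) ^ G) : f x - f xbar ≤ c.ε₂ G := by
  obtain ⟨-, hxb, hx2⟩ := h.mem_ball_of_lt_δLS hx
  have hL := h.L_pos
  have hβ := h.β_pos
  have ha₁ := h.a₁_pos
  have ha₂ := h.a₂_pos
  have hgap := h.reg.gap x hxb
  refine le_trans ?_ (h.le_ε₂ G).1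
  set E := ‖proj M x - xbar‖ with hE
  set D := Metric.infDist x M with hDdef
  have hD0 : 0 < D := lt_of_le_of_lt (by positivity) hD
  have hm : 0 < min 1 c.a₁ := lt_min one_pos ha₁
  have h1 : E ^ 2 ≤ D / c.a₂ ^ 2 := by
    rw [le_div_iff₀ (by positivity)]; linarith
  have h2 := mul_le_mul_of_nonneg_left h1 (show 0 ≤ c.β / 2 by positivity)
  have h3 : min 1 c.a₁ * D ≤ (1 / 2) ^ G :=
    (mul_le_mul_of_nonneg_right (min_le_right _ _) hD0.le).trans hsmall.le
  have h4 := mul_le_mul_of_nonneg_left h3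
    (show 0 ≤ c.L / min 1 c.a₁ + c.β / (2 * min 1 c.a₁ * c.a₂ ^ 2) by positivity)
  have h5 : (c.L / min 1 c.a₁ + c.β / (2 * min 1 c.a₁ * c.a₂ ^ 2)) * (min 1 c.a₁ * D) =
      c.L * D + c.β / 2 * (D / c.a₂ ^ 2) := by field_simp
  linarith

end Setting


/-! ### Average slope along a random segment. -/

section Sampling

variable {d : ℕ} {f : Vec d → ℝ} {x g : Vec d} {σ r L : ℝ}

/-- The law of the samples of `NDescent`. -/
noncomputable def sampleLaw (d : ℕ) : Measure (Vec d × ℝ) :=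
  (ProbabilityTheory.cond volume (Metric.ball (0 : Vec d) 1)).prod (volume.restrict (Icc (0 : ℝ) 1))

instance : IsProbabilityMeasure
    (ProbabilityTheory.cond volume (Metric.ball (0 : EuclideanSpace ℝ (Fin d)) 1)) :=
  ProbabilityTheory.cond_isProbabilityMeasure_of_finite
    (Metric.measure_ball_pos volume _ one_pos).ne' measure_ball_lt_top.ne

lemma ae_mem_ball :
    ∀ᵐ ξ ∂(ProbabilityTheory.cond volume (Metric.ball (0 : Vec d) 1)), ‖ξ‖ < 1 := by
  have : ∀ᵐ ξ ∂(ProbabilityTheory.cond volume (Metric.ball (0 : Vec d) 1)),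
      ξ ∈ Metric.ball (0 : Vec d) 1 :=
    ProbabilityTheory.ae_cond_mem measurableSet_ball
  simpa using this

lemma ae_cond_of_ae {p : Vec d → Prop} (hr : r ≠ 0) (hp : ∀ᵐ ζ, p ζ) (g : Vec d) :
    ∀ᵐ ξ ∂(ProbabilityTheory.cond volume (Metric.ball (0 : Vec d) 1)), p (g + r • ξ) := by
  have h1 : ∀ᵐ ζ : Vec d, p (g + ζ) := by
    rw [ae_iff] at hp ⊢
    have := measure_preimage_add (volume : Measure (Vec d)) g {ζ | ¬ p ζ}
    rwa [hp] at this
  have h2 : ∀ᵐ ζ : Vec d, p (g + r • ζ) := by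
    rw [ae_iff] at h1 ⊢
    have := Measure.addHaar_preimage_smul (volume : Measure (Vec d)) hr {ζ | ¬ p (g + ζ)}
    rw [h1, mul_zero] at this
    exact this
  exact ProbabilityTheory.cond_absolutelyContinuous.ae_le h2

lemma samplePoint_eq (ξ : Vec d) (τ : ℝ) :
    samplePoint x σ r ξ τ g = x + τ • (-(σ / ‖g + r • ξ‖)) • (g + r • ξ) := by
  rw [samplePoint, smul_smul, sub_eq_add_neg, ← neg_smul]
  congr 2
  ring

lemma ae_differentiableAt_samplePoint (hf : LocallyLipschitz f) (hσ : 0 < σ) (hr : 0 < r)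
    (hrg : r < ‖g‖) :
    ∀ᵐ ξ ∂(ProbabilityTheory.cond volume (Metric.ball (0 : Vec d) 1)),
      ∀ᵐ τ : ℝ, DifferentiableAt ℝ f (samplePoint x σ r ξ τ g) := by
  filter_upwards [ae_cond_of_ae hr.ne' (ae_differentiableAt_line hf x) g, ae_mem_ball]
    with ξ hξ hξ1
  have h0 : 0 < ‖g + r • ξ‖ := by
    have h1 := norm_sub_le_norm_add g (r • ξ)
    rw [norm_smul, Real.norm_of_nonneg hr.le] at h1
    nlinarith
  simp only [samplePoint_eq]
  exact ae_differentiableAt_smul_line (neg_ne_zero.2 (div_pos hσ h0).ne') hξ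

lemma norm_sub_smul_le {g ζ : Vec d} (hζ : ζ ≠ 0) : ‖g - (‖g‖ / ‖ζ‖) • ζ‖ ≤ 2 * ‖g - ζ‖ := by
  have h0 : ‖ζ‖ ≠ 0 := norm_ne_zero_iff.2 hζ
  have h1 : g - (‖g‖ / ‖ζ‖) • ζ = (g - ζ) + ((‖ζ‖ - ‖g‖) / ‖ζ‖) • ζ := by
    rw [sub_div, sub_smul, div_self h0, one_smul]; abel
  rw [h1]
  refine (norm_add_le _ _).trans ?_
  rw [norm_smul, norm_div, norm_norm, div_mul_cancel₀ _ h0, Real.norm_eq_abs, abs_sub_comm]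
  linarith [abs_norm_sub_norm_le g ζ]

/-- The mean slope along a random segment, if the step along `g` does not give much descent. -/
lemma integral_samplePoint_le (hf : LocallyLipschitz f) (hσ0 : 0 < σ) (hσ1 : σ ≤ 1)
    (hL : 0 ≤ L) (hgrad : ∀ z, ‖z - x‖ ≤ σ → ‖gradient f z‖ ≤ L)
    (hlip : ∀ y z, ‖y - x‖ ≤ σ → ‖z - x‖ ≤ σ → |f y - f z| ≤ L * ‖y - z‖)
    (hgo : LoopGoesOn f x σ g) (hr0 : 0 < r) (hr : r < σ * ‖g‖) (hLσ : L * σ ≤ 3 / 32 * ‖g‖)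
    {ξ : Vec d} (hξ1 : ‖ξ‖ < 1)
    (hξ : ∀ᵐ τ : ℝ, DifferentiableAt ℝ f (samplePoint x σ r ξ τ g)) :
    ∫ τ in (0 : ℝ)..1, inner ℝ (gradient f (samplePoint x σ r ξ τ g)) g ≤ ‖g‖ ^ 2 / 2 := by
  have hg0 := hgo.1
  have hrg : r < ‖g‖ := hr.trans_le (by nlinarith)
  have hζg : ‖g - (g + r • ξ)‖ ≤ r := by
    rw [sub_add_cancel_left, norm_neg, norm_smul, Real.norm_of_nonneg hr0.le]
    nlinarith
  simp only [samplePoint_eq] at hξ ⊢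
  set ζ := g + r • ξ with hζ
  have hζ0 : 0 < ‖ζ‖ := by
    have := norm_sub_norm_le g ζ
    linarith
  set w := (-(σ / ‖ζ‖)) • ζ with hw
  have hwn : ‖w‖ = σ := by
    rw [hw, norm_smul, norm_neg, norm_div, norm_norm, Real.norm_of_nonneg hσ0.le]
    field_simp
  set e := g - (‖g‖ / ‖ζ‖) • ζ with he
  have hen : ‖e‖ ≤ 2 * r := (norm_sub_smul_le (norm_pos_iff.1 hζ0)).trans (by linarith)
  -- The vector `g` is split along the direction of the segment, where the fundamental theorem
  -- applies, and an error of length at most `2 * r`.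
  have hge : g = (-(‖g‖ / σ)) • w + e := by
    rw [hw, smul_smul, neg_mul_neg, he, show ‖g‖ / σ * (σ / ‖ζ‖) = ‖g‖ / ‖ζ‖ by field_simp]
    abel
  have hii := intervalIntegrable_inner_gradient hf hξ
  have hpt : ∀ τ ∈ Icc (0 : ℝ) 1, inner ℝ (gradient f (x + τ • w)) g ≤
      -(‖g‖ / σ) * inner ℝ (gradient f (x + τ • w)) w + L * (2 * r) := by
    intro τ hτ
    have h1 : ‖x + τ • w - x‖ ≤ σ := by
      rw [add_sub_cancel_left, norm_smul, hwn, Real.norm_of_nonneg hτ.1]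
      nlinarith [hτ.2]
    have h2 : inner ℝ (gradient f (x + τ • w)) g =
        -(‖g‖ / σ) * inner ℝ (gradient f (x + τ • w)) w + inner ℝ (gradient f (x + τ • w)) e := by
      conv_lhs => rw [hge]
      rw [inner_add_right, inner_smul_right]
    rw [h2]
    have := (real_inner_le_norm (gradient f (x + τ • w)) e).trans
      (mul_le_mul (hgrad _ h1) hen (norm_nonneg _) hL)
    linarith
  have hint : ∫ τ in (0 : ℝ)..1, inner ℝ (gradient f (x + τ • w)) g ≤
      ∫ τ in (0 : ℝ)..1, (-(‖g‖ / σ) * inner ℝ (gradient f (x + τ • w)) w + L * (2 * r)) := by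
    have hmeas : Measurable fun τ : ℝ => inner ℝ (gradient f (x + τ • w)) g :=
      (((measurable_gradient f).comp (by fun_prop)).inner measurable_const)
    refine intervalIntegral.integral_mono_on zero_le_one ?_
      ((hii.const_mul _).add intervalIntegrable_const) hpt
    rw [intervalIntegrable_iff_integrableOn_Ioc_of_le zero_le_one]
    refine Measure.integrableOn_of_bounded (M := L * ‖g‖) (by simp)
      hmeas.aestronglyMeasurable ?_
    filter_upwards [ae_restrict_mem measurableSet_Ioc] with τ hτ
    have h1 : ‖x + τ • w - x‖ ≤ σ := by
      rw [add_sub_cancel_left, norm_smul, hwn, Real.norm_of_nonneg hτ.1.le]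
      nlinarith [hτ.2]
    exact (norm_inner_le_norm _ _).trans (mul_le_mul_of_nonneg_right (hgrad _ h1) hg0.le)
  refine hint.trans ?_
  rw [intervalIntegral.integral_add (hii.const_mul _) intervalIntegrable_const,
    intervalIntegral.integral_const_mul, integral_inner_gradient hf hξ,
    intervalIntegral.integral_const, sub_zero, one_smul]
  -- The loop condition speaks of the unperturbed endpoint. Moving the endpoint and splitting `g`
  -- each cost `2 * r * L`, together at most `3 / 8 * ‖g‖ ^ 2`, which is added to `‖g‖ ^ 2 / 8`.
  have h1 := hlip (x - (σ / ‖g‖) • g) (x + w) (norm_step_sub x hg0 hσ0.le).le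
    (by rw [add_sub_cancel_left, hwn])
  have h2 : x - (σ / ‖g‖) • g - (x + w) = (-(σ / ‖g‖)) • e := by
    conv_lhs => rw [show (σ / ‖g‖) • g = (σ / ‖g‖) • ((-(‖g‖ / σ)) • w + e) by rw [← hge]]
    rw [smul_add, smul_smul, show σ / ‖g‖ * -(‖g‖ / σ) = -1 by field_simp]
    simp only [neg_smul, one_smul]; abel
  rw [h2, norm_smul, norm_neg, Real.norm_of_nonneg (by positivity)] at h1
  have h3 := (abs_le.1 h1).2
  have h4 : L * (σ / ‖g‖ * ‖e‖) ≤ L * (σ / ‖g‖ * (2 * r)) := by gcongr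
  have h5 : f x - f (x + w) ≤ σ / 8 * ‖g‖ + L * (σ / ‖g‖ * (2 * r)) := by linarith [hgo.2]
  have h6 := mul_le_mul_of_nonneg_left h5 (show 0 ≤ ‖g‖ / σ by positivity)
  have h7 : ‖g‖ / σ * (σ / 8 * ‖g‖ + L * (σ / ‖g‖ * (2 * r))) = ‖g‖ ^ 2 / 8 + L * (2 * r) := by
    field_simp
  have h8 : L * (4 * r) ≤ 3 / 8 * ‖g‖ ^ 2 := by
    have e1 := mul_le_mul_of_nonneg_left hr.le hL
    have e2 := mul_le_mul_of_nonneg_right hLσ hg0.le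
    nlinarith
  rw [h7] at h6
  linarith

end Sampling

/-! ### Growth of the reciprocal squared norm. -/

section Potential

variable {d : ℕ} {a b z : Vec d} {μ L : ℝ}

/-- Compare with the parameter `‖a‖² / (8 L²)` and use the tangent line of `1 / Z` at `‖a‖²`. The
new vector then enters linearly, so the bound can be averaged over the sample. -/
lemma IsMinNorm.inv_sq_ge (h : IsMinNorm a b z) (ha0 : a ≠ 0) (hz0 : z ≠ 0) (hL : 0 < L)
    (ha : ‖a‖ ≤ L) (hb : ‖b‖ ≤ L) :
    1 / ‖a‖ ^ 2 + 3 / (16 * L ^ 2) - 1 / (4 * L ^ 2) * (inner ℝ b a / ‖a‖ ^ 2) ≤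
      1 / ‖z‖ ^ 2 := by
  have hA : 0 < ‖a‖ ^ 2 := pow_pos (norm_pos_iff.2 ha0) 2
  have hZ : 0 < ‖z‖ ^ 2 := pow_pos (norm_pos_iff.2 hz0) 2
  have hAL : ‖a‖ ^ 2 ≤ L ^ 2 := pow_le_pow_left₀ (norm_nonneg _) ha 2
  have h2 : ‖a - b‖ ^ 2 ≤ 4 * L ^ 2 := by
    have := pow_le_pow_left₀ (norm_nonneg _) ((norm_sub_le a b).trans (add_le_add ha hb)) 2
    linarith
  have h1 := h.norm_sq_le (t := ‖a‖ ^ 2 / (8 * L ^ 2))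
    ⟨by positivity, by rw [div_le_one (by positivity)]; nlinarith⟩
  rw [inner_sub_left, real_inner_self_eq_norm_sq] at h1
  set A := ‖a‖ ^ 2
  set Z := ‖z‖ ^ 2
  set I : ℝ := inner ℝ b a
  have h3 := mul_le_mul_of_nonneg_left h2 (sq_nonneg (A / (8 * L ^ 2)))
  have h4 : Z / A ^ 2 ≤ (A - 2 * (A / (8 * L ^ 2)) * (A - I) +
      (A / (8 * L ^ 2)) ^ 2 * (4 * L ^ 2)) / A ^ 2 := by
    gcongr; linarith
  have h5 : (A - 2 * (A / (8 * L ^ 2)) * (A - I) +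
      (A / (8 * L ^ 2)) ^ 2 * (4 * L ^ 2)) / A ^ 2 =
      1 / A - 3 / (16 * L ^ 2) + 1 / (4 * L ^ 2) * (I / A) := by
    field_simp; ring
  have h6 : 2 / A - Z / A ^ 2 ≤ 1 / Z := by
    have : 1 / Z - (2 / A - Z / A ^ 2) = (A - Z) ^ 2 / (Z * A ^ 2) := by field_simp; ring
    have h7 : 0 ≤ (A - Z) ^ 2 / (Z * A ^ 2) := by positivity
    linarith
  have h7 : 2 / A = 1 / A + 1 / A := by ring
  linarith

end Potential

/-! ### Averaging over fresh samples. -/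

section Independence

variable {α β Ω : Type*} [MeasurableSpace α] [MeasurableSpace β] [MeasurableSpace Ω]

/-- Independence makes the joint law a product, so Fubini lets the past be frozen while the sample
is averaged; this replaces conditional expectations. -/
lemma integral_le_of_indepFun {P : Measure Ω} [IsProbabilityMeasure P] {X : Ω → α} {Y : Ω → β}
    (hX : Measurable X) (hY : Measurable Y) (hXY : IndepFun X Y P) {K : α × β → ℝ}
    (hK : Measurable K) {C : ℝ} (hKC : ∀ p, ‖K p‖ ≤ C) {k : α → ℝ} (hk : Measurable k)
    (hkC : ∀ a, ‖k a‖ ≤ C) (h : ∀ a, ∫ y, K (a, y) ∂(P.map Y) ≤ k a) :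
    ∫ ω, K (X ω, Y ω) ∂P ≤ ∫ ω, k (X ω) ∂P := by
  have : IsProbabilityMeasure (P.map X) := Measure.isProbabilityMeasure_map hX.aemeasurable
  have : IsProbabilityMeasure (P.map Y) := Measure.isProbabilityMeasure_map hY.aemeasurable
  have hKi : Integrable K ((P.map X).prod (P.map Y)) :=
    Integrable.of_bound hK.aestronglyMeasurable C (Eventually.of_forall hKC)
  rw [← integral_map (φ := fun ω => (X ω, Y ω)) (hX.prodMk hY).aemeasurable
    hK.aestronglyMeasurable,
    (indepFun_iff_map_prod_eq_prod_map_map hX.aemeasurable hY.aemeasurable).1 hXY,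
    integral_prod _ hKi, ← integral_map hX.aemeasurable hk.aestronglyMeasurable]
  exact integral_mono hKi.integral_prod_left
    (Integrable.of_bound hk.aestronglyMeasurable C (Eventually.of_forall hkC)) h

end Independence


variable {d m : ℕ} {f : Vec d → ℝ} {x : Vec d} {σ : ℝ}

lemma measurableSet_loopGoesOn (hf : LocallyLipschitz f) (x : Vec d) (σ : ℝ) :
    MeasurableSet {g : Vec d | LoopGoesOn f x σ g} := by
  have hfm : Measurable f := hf.continuous.measurable
  have h1 : Measurable fun g : Vec d => f x - f (x - (σ / ‖g‖) • g) :=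
    measurable_const.sub (hfm.comp (by fun_prop))
  have h2 : Measurable fun g : Vec d => σ / 8 * ‖g‖ := by fun_prop
  exact (measurableSet_lt measurable_const measurable_norm).inter (measurableSet_le h1 h2)

/-- The slope at the sampled point in the direction of the current vector, per squared length. -/
noncomputable def slope (f : Vec d → ℝ) (x : Vec d) (σ : ℝ) (q : (Vec d × ℝ) × (Vec d × ℝ)) : ℝ :=
  inner ℝ (gradient f (samplePoint x σ q.1.2 q.2.1 q.2.2 q.1.1)) q.1.1 / ‖q.1.1‖ ^ 2

lemma measurable_slope (f : Vec d → ℝ) (x : Vec d) (σ : ℝ) : Measurable (slope f x σ) := by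
  have h1 : Measurable fun q : (Vec d × ℝ) × (Vec d × ℝ) =>
      samplePoint x σ q.1.2 q.2.1 q.2.2 q.1.1 := by
    unfold samplePoint; fun_prop
  unfold slope
  exact (((measurable_gradient f).comp h1).inner (by fun_prop)).div (by fun_prop)

/-- The vectors and radii for which a pass of `NDescent` is analysed. -/
def passStates (f : Vec d → ℝ) (x : Vec d) (σ b : ℝ) : Set (Vec d × ℝ) :=
  {q | LoopGoesOn f x σ q.1 ∧ b ≤ ‖q.1‖ ∧ 0 < q.2 ∧ q.2 < σ * ‖q.1‖}

lemma measurableSet_passStates (hf : LocallyLipschitz f) (x : Vec d) (σ b : ℝ) :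
    MeasurableSet (passStates f x σ b) := by
  refine ((measurableSet_loopGoesOn hf x σ).preimage measurable_fst).inter
    (.inter ?_ (.inter ?_ ?_))
  · exact measurableSet_le measurable_const measurable_fst.norm
  · exact measurableSet_lt measurable_const measurable_snd
  · exact measurableSet_lt measurable_snd (by fun_prop)

/-- `slope` on the relevant states and samples, and zero elsewhere. -/
noncomputable def slopeOn (f : Vec d → ℝ) (x : Vec d) (σ b : ℝ) :
    (Vec d × ℝ) × (Vec d × ℝ) → ℝ :=
  (passStates f x σ b ×ˢ (univ ×ˢ Icc (0 : ℝ) 1)).indicator (slope f x σ)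

/-! ### Bounds for the normalized slope. -/

section Slope

variable {b L : ℝ} (hf : LocallyLipschitz f) (hσ0 : 0 < σ) (hσ1 : σ ≤ 1) (hb : 0 < b)
  (hL : 0 ≤ L) (hgrad : ∀ z, ‖z - x‖ ≤ σ → ‖gradient f z‖ ≤ L)
include hf hσ0 hσ1 hb hL hgrad

omit hf hσ1 in
lemma norm_slopeOn_le (q : (Vec d × ℝ) × (Vec d × ℝ)) : ‖slopeOn f x σ b q‖ ≤ L / b := by
  by_cases hq : q ∈ passStates f x σ b ×ˢ (univ ×ˢ Icc (0 : ℝ) 1)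
  · rw [slopeOn, indicator_of_mem hq, slope, norm_div, norm_pow, norm_norm]
    have hg0 : 0 < ‖q.1.1‖ := hq.1.1.1
    rw [div_le_div_iff₀ (by positivity) hb]
    have h1 := (norm_inner_le_norm (𝕜 := ℝ) _ q.1.1).trans (mul_le_mul_of_nonneg_right
      (hgrad _ (norm_samplePoint_sub_le x q.2.1 q.1.1 hσ0.le (r := q.1.2) hq.2.2))
      (norm_nonneg _))
    have h2 := mul_le_mul h1 hq.1.2.1 hb.le (by positivity)
    linarith
  · rw [slopeOn, indicator_of_notMem hq, norm_zero]
    positivity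

/-- For almost every direction the average over the position on the segment is at most 1/2;
averaging over directions preserves this. -/
lemma integral_slopeOn_le (hlip : ∀ y z, ‖y - x‖ ≤ σ → ‖z - x‖ ≤ σ → |f y - f z| ≤ L * ‖y - z‖)
    (hLσ : L * σ ≤ 3 / 32 * b) (q : Vec d × ℝ) :
    ∫ y, slopeOn f x σ b (q, y) ∂(sampleLaw d) ≤
      (passStates f x σ b).indicator (fun _ => 1 / 2) q := by
  by_cases hq : q ∈ passStates f x σ b
  swap
  · rw [indicator_of_notMem hq]
    refine (integral_eq_zero_of_ae (Eventually.of_forall fun y => ?_)).le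
    exact indicator_of_notMem (fun hm => hq hm.1) _
  rw [indicator_of_mem hq]
  have hmeas : Measurable (slopeOn f x σ b) :=
    (measurable_slope f x σ).indicator ((measurableSet_passStates hf x σ b).prod
      (MeasurableSet.univ.prod measurableSet_Icc))
  have hbd := norm_slopeOn_le (f := f) (x := x) hσ0 hb hL hgrad
  obtain ⟨hgo, hbg, hr0, hr⟩ := hq
  have hg0 := hgo.1
  have hfin : IsFiniteMeasure (sampleLaw d) := by unfold sampleLaw; infer_instance
  have hint : Integrable (fun y => slopeOn f x σ b (q, y)) (sampleLaw d) :=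
    Integrable.of_bound (hmeas.comp measurable_prodMk_left).aestronglyMeasurable _
      (Eventually.of_forall fun y => hbd (q, y))
  rw [sampleLaw] at hint ⊢
  rw [integral_prod _ hint]
  calc _ ≤ ∫ _ : Vec d, (1 / 2 : ℝ)
        ∂(ProbabilityTheory.cond volume (Metric.ball (0 : Vec d) 1)) := ?_
    _ = 1 / 2 := by simp
  refine integral_mono_ae hint.integral_prod_left (integrable_const _) ?_
  filter_upwards [ae_differentiableAt_samplePoint (x := x) (g := q.1) hf hσ0 hr0
    (hr.trans_le (by nlinarith)), ae_mem_ball] with ξ hξ hξ1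
  have h1 := integral_samplePoint_le hf hσ0 hσ1 hL hgrad hlip hgo hr0 hr
    (hLσ.trans (by linarith)) hξ1 hξ
  rw [intervalIntegral.integral_of_le zero_le_one, ← integral_Icc_eq_integral_Ioc] at h1
  have h2 : ∫ τ in Icc (0 : ℝ) 1, slopeOn f x σ b (q, (ξ, τ)) =
      (∫ τ in Icc (0 : ℝ) 1, inner ℝ (gradient f (samplePoint x σ q.2 ξ τ q.1)) q.1) /
        ‖q.1‖ ^ 2 := by
    rw [← integral_div]
    refine setIntegral_congr_fun measurableSet_Icc fun τ hτ => ?_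
    exact indicator_of_mem (show (q, (ξ, τ)) ∈ passStates f x σ b ×ˢ (univ ×ˢ Icc (0 : ℝ) 1) from
      ⟨⟨hgo, hbg, hr0, hr⟩, trivial, hτ⟩) _
  rw [h2, div_le_iff₀ (by positivity)]
  linarith

end Slope

/-! ### Measurability and independence in a random run. -/

section Run

variable {Ω : Type*} [mΩ : MeasurableSpace Ω] {P : Measure Ω} [IsProbabilityMeasure P]
  {xbar g : Vec d} {s : ℝ} {G T : ℕ} {ℱ : Filtration ℕ mΩ} {td nd : ℕ → ℕ → Ω → Vec d}
  {r : ℕ → ℕ → Ω → ℝ} {ξ : ℕ → ℕ → Ω → Vec d} {τ : ℕ → ℕ → Ω → ℝ} {xt : Ω → Vec d}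

namespace IsRandomRun

variable (hr : IsRandomRun P f x g s G T ℱ td nd r ξ τ xt) {i t : ℕ} (hi : i < G)
include hr hi

omit [IsProbabilityMeasure P] in
lemma measurable_nd (ht : t ≤ T) : Measurable (nd i t) :=
  (hr.nd_adapted i hi t ht).mono (ℱ.le _) le_rfl

omit [IsProbabilityMeasure P] in
lemma measurable_sample (ht : t < T) : Measurable fun ω => (ξ i t ω, τ i t ω) :=
  (hr.sample_meas i hi t ht).mono (ℱ.le _) le_rfl

omit [IsProbabilityMeasure P] in
lemma measurable_state (ht : t < T) : Measurable fun ω => (nd i t ω, r i t ω) :=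
  (hr.measurable_nd hi ht.le).prodMk ((hr.r_adapted i hi t ht).mono (ℱ.le _) le_rfl)

omit [IsProbabilityMeasure P] in
lemma indepFun_state_sample (ht : t < T) :
    IndepFun (fun ω => (nd i t ω, r i t ω)) (fun ω => (ξ i t ω, τ i t ω)) P := by
  rw [IndepFun_iff_Indep]
  refine indep_of_indep_of_le_left (hr.sample_indep i hi t ht).symm ?_
  exact ((hr.nd_adapted i hi t ht.le).prodMk (hr.r_adapted i hi t ht)).comap_le

omit hi [IsProbabilityMeasure P] in
lemma ae_mem_Icc : ∀ᵐ ω ∂P, ∀ i < G, ∀ t < T, τ i t ω ∈ Icc (0 : ℝ) 1 := by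
  simp only [ae_all_iff]
  intro i hi t ht
  have h1 : ∀ᵐ y ∂(P.map fun ω => (ξ i t ω, τ i t ω)), y.2 ∈ Icc (0 : ℝ) 1 := by
    rw [hr.sample_law i hi t ht]
    exact Measure.quasiMeasurePreserving_snd.ae (ae_restrict_mem measurableSet_Icc)
  exact ae_of_ae_map (hr.measurable_sample hi ht).aemeasurable h1

end IsRandomRun

end Run


/-- The potential of a vector of norm at least `b`, while the loop goes on. -/
noncomputable def potential {d : ℕ} (f : Vec d → ℝ) (x : Vec d) (σ b : ℝ) : Vec d → ℝ :=
  {g | LoopGoesOn f x σ g}.indicator fun g => 2 / b ^ 2 - 1 / ‖g‖ ^ 2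

/-! ### The potential of the `NDescent` loop. -/

section Potential

variable {d : ℕ} {f : Vec d → ℝ} {x g : Vec d} {σ b L : ℝ}

lemma measurable_potential (hf : LocallyLipschitz f) (x : Vec d) (σ b : ℝ) :
    Measurable (potential f x σ b) :=
  Measurable.indicator (by fun_prop) (measurableSet_loopGoesOn hf x σ)

lemma le_potential (hb : 0 < b) (hg : b ≤ ‖g‖) :
    1 / b ^ 2 ≤ 2 / b ^ 2 - 1 / ‖g‖ ^ 2 ∧ 2 / b ^ 2 - 1 / ‖g‖ ^ 2 ≤ 2 / b ^ 2 := by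
  have h1 : 1 / ‖g‖ ^ 2 ≤ 1 / b ^ 2 := by gcongr
  have h2 : 0 ≤ 1 / ‖g‖ ^ 2 := by positivity
  have h3 : 2 / b ^ 2 = 1 / b ^ 2 + 1 / b ^ 2 := by ring
  constructor <;> linarith

lemma potential_mem (hb : 0 < b) (hg : b ≤ ‖g‖) :
    {g | LoopGoesOn f x σ g}.indicator (fun _ => 1 / b ^ 2) g ≤ potential f x σ b g ∧
    potential f x σ b g ≤ {g | LoopGoesOn f x σ g}.indicator (fun _ => 2 / b ^ 2) g :=
  ⟨indicator_le_indicator (le_potential hb hg).1, indicator_le_indicator (le_potential hb hg).2⟩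

lemma norm_potential_le (hb : 0 < b) (hg : b ≤ ‖g‖) : ‖potential f x σ b g‖ ≤ 2 / b ^ 2 := by
  obtain ⟨h1, h2⟩ := potential_mem (f := f) (x := x) (σ := σ) hb hg
  have h3 : 0 ≤ {g : Vec d | LoopGoesOn f x σ g}.indicator (fun _ => 1 / b ^ 2) g :=
    indicator_nonneg (fun _ _ => by positivity) g
  rw [Real.norm_of_nonneg (h3.trans h1)]
  exact h2.trans (indicator_le_self' (fun _ _ => by positivity) g)

/-- The decrease of the potential in one pass of `NDescent`. -/
lemma potential_step_le (hb : 0 < b) (hL : 0 < L) {r τ : ℝ} {ξ g' : Vec d}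
    (hstep : NDescentStep f x σ r ξ τ g g') (hτ : τ ∈ Icc (0 : ℝ) 1)
    (hdiff : LoopGoesOn f x σ g → DifferentiableAt ℝ f (samplePoint x σ r ξ τ g))
    (hbg : b ≤ ‖g‖) (hgL : ‖g‖ ≤ L) (hbg' : b ≤ ‖g'‖) (hσ : 0 ≤ σ)
    (hgrad : ∀ z, ‖z - x‖ ≤ σ → ‖gradient f z‖ ≤ L) :
    potential f x σ b g' ≤ potential f x σ b g -
      {g | LoopGoesOn f x σ g}.indicator (fun _ => 3 / (16 * L ^ 2)) g +
      1 / (4 * L ^ 2) * slopeOn f x σ b ((g, r), (ξ, τ)) := by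
  by_cases hgo : LoopGoesOn f x σ g
  · obtain ⟨⟨hr0, hr⟩, v, -, hv, hmin⟩ := hstep.1 hgo
    rw [hv (hdiff hgo)] at hmin
    have h1 := hmin.inv_sq_ge (norm_pos_iff.1 hgo.1) (norm_pos_iff.1 (hb.trans_le hbg')) hL hgL
      (hgrad _ (norm_samplePoint_sub_le x ξ g hσ hτ))
    have h2 : potential f x σ b g' ≤ 2 / b ^ 2 - 1 / ‖g'‖ ^ 2 := by
      have h3 : 0 ≤ 2 / b ^ 2 - 1 / ‖g'‖ ^ 2 :=
        le_trans (by positivity) (le_potential hb hbg').1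
      exact indicator_apply_le' (fun _ => le_rfl) (fun _ => h3)
    rw [slopeOn, indicator_of_mem (show ((g, r), (ξ, τ)) ∈
      passStates f x σ b ×ˢ (univ ×ˢ Icc (0 : ℝ) 1) from ⟨⟨hgo, hbg, hr0, hr⟩, trivial, hτ⟩),
      potential, indicator_of_mem (show g ∈ {g | LoopGoesOn f x σ g} from hgo),
      indicator_of_mem (show g ∈ {g | LoopGoesOn f x σ g} from hgo)]
    rw [potential] at h2
    simp only [slope]
    linarith
  -- A loop that has ended keeps its vector, so its potential remains zero.
  · have h1 : ((g, r), (ξ, τ)) ∉ passStates f x σ b ×ˢ (univ ×ˢ Icc (0 : ℝ) 1) :=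
      fun hm => hgo hm.1.1
    rw [hstep.2 hgo, slopeOn, indicator_of_notMem h1,
      indicator_of_notMem (show g ∉ {g | LoopGoesOn f x σ g} from hgo)]
    simp

end Potential

/-! ### Probability that `NDescent` has not ended. -/

section Run

variable {d : ℕ} {f : Vec d → ℝ} {x g : Vec d} {b L : ℝ}
  {Ω : Type*} [mΩ : MeasurableSpace Ω] {P : Measure Ω} [IsProbabilityMeasure P]
  {s : ℝ} {G T : ℕ} {ℱ : Filtration ℕ mΩ} {td nd : ℕ → ℕ → Ω → Vec d}
  {r : ℕ → ℕ → Ω → ℝ} {ξ : ℕ → ℕ → Ω → Vec d} {τ : ℕ → ℕ → Ω → ℝ} {xt : Ω → Vec d}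

namespace IsRandomRun

variable (hr : IsRandomRun P f x g s G T ℱ td nd r ξ τ xt) {i : ℕ} (hi : i < G)
  (hf : LocallyLipschitz f) (hσ1 : gridσ G i ≤ 1) (hb : 0 < b)
  (hbd : ∀ᵐ ω ∂P, ∀ t ≤ T, b ≤ ‖nd i t ω‖ ∧ ‖nd i t ω‖ ≤ L)
include hr hi hf

/-- For every fixed state the bad samples form a null set, and state and sample are independent.
Hence the chosen subgradient is almost surely the gradient, a measurable function of state and
sample, whatever the selection rule. -/
lemma ae_differentiableAt (hσ1 : gridσ G i ≤ 1) {t : ℕ} (ht : t < T) : ∀ᵐ ω ∂P,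
    LoopGoesOn f x (gridσ G i) (nd i t ω) →
      DifferentiableAt ℝ f (samplePoint x (gridσ G i) (r i t ω) (ξ i t ω) (τ i t ω) (nd i t ω)) := by
  set σ := gridσ G i with hσ
  have hσ0 : 0 < σ := gridσ_pos G i
  have hXm := hr.measurable_state hi ht
  have hYm := hr.measurable_sample hi ht
  have : IsProbabilityMeasure (P.map fun ω => (nd i t ω, r i t ω)) :=
    Measure.isProbabilityMeasure_map hXm.aemeasurable
  set N : Set ((Vec d × ℝ) × (Vec d × ℝ)) := {q | q.1 ∈ passStates f x σ 0 ∧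
    ¬ DifferentiableAt ℝ f (samplePoint x σ q.1.2 q.2.1 q.2.2 q.1.1)} with hN
  have hNm : MeasurableSet N := by
    refine ((measurableSet_passStates hf x σ 0).preimage measurable_fst).inter ?_
    have h1 : Measurable fun q : (Vec d × ℝ) × (Vec d × ℝ) =>
        samplePoint x σ q.1.2 q.2.1 q.2.2 q.1.1 := by
      unfold samplePoint; fun_prop
    exact (h1 (measurableSet_of_differentiableAt ℝ f)).compl
  have h0 : P.map (fun ω => ((nd i t ω, r i t ω), (ξ i t ω, τ i t ω))) N = 0 := by
    rw [(indepFun_iff_map_prod_eq_prod_map_map hXm.aemeasurable hYm.aemeasurable).1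
      (hr.indepFun_state_sample hi ht), hr.sample_law i hi t ht, Measure.measure_prod_null hNm]
    refine Eventually.of_forall fun q => ?_
    by_cases hq : q ∈ passStates f x σ 0
    swap
    · have h1 : Prod.mk q ⁻¹' N = ∅ := eq_empty_of_forall_notMem fun y hy => hq hy.1
      simp only [h1, measure_empty, Pi.zero_apply]
    rw [Pi.zero_apply, Measure.measure_prod_null (hNm.preimage measurable_prodMk_left)]
    filter_upwards [ae_differentiableAt_samplePoint (x := x) (g := q.1) hf hσ0 hq.2.2.1
      (hq.2.2.2.trans_le (by nlinarith [norm_nonneg q.1]))] with ξ hξ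
    refine measure_mono_null (fun y hy => hy.2) (ae_iff.1 (ae_restrict_of_ae hξ))
  rw [Measure.map_apply (hXm.prodMk hYm) hNm] at h0
  filter_upwards [hr.execution, measure_eq_zero_iff_ae_notMem.1 h0] with ω he hω hgo
  by_contra hcon
  obtain ⟨hr0, hr1⟩ := ((he.normal_steps i hi t ht).1 hgo).1
  exact hω ⟨⟨hgo, norm_nonneg _, hr0, hr1⟩, hcon⟩

include hb hbd

omit [IsProbabilityMeasure P] in
lemma integrable_potential [IsFiniteMeasure P] {t : ℕ} (ht : t ≤ T) :
    Integrable (fun ω => potential f x (gridσ G i) b (nd i t ω)) P := by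
  refine Integrable.of_bound ((measurable_potential hf x _ b).comp
    (hr.measurable_nd hi ht)).aestronglyMeasurable (2 / b ^ 2) ?_
  filter_upwards [hbd] with ω hω
  exact norm_potential_le hb (hω t ht).1

variable (hL : 0 < L) (hgrad : ∀ z, ‖z - x‖ ≤ gridσ G i → ‖gradient f z‖ ≤ L)
  (hlip : ∀ y z, ‖y - x‖ ≤ gridσ G i → ‖z - x‖ ≤ gridσ G i → |f y - f z| ≤ L * ‖y - z‖)
  (hLσ : L * gridσ G i ≤ 3 / 32 * b)
include hσ1 hL hgrad hlip hLσ

/-- While the loop runs the mean drop is at least 3/(16L²) - (1/(4L²))(1/2) = 1/(16L²). The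
potential is at most 2/b² on that event, so this drop is at least b²/(32L²) times its mean. -/
lemma integral_potential_step_le {t : ℕ} (ht : t < T) :
    ∫ ω, potential f x (gridσ G i) b (nd i (t + 1) ω) ∂P ≤
      (1 - b ^ 2 / (32 * L ^ 2)) * ∫ ω, potential f x (gridσ G i) b (nd i t ω) ∂P := by
  set σ := gridσ G i with hσ
  have hσ0 : 0 < σ := gridσ_pos G i
  set A : Set Ω := {ω | LoopGoesOn f x σ (nd i t ω)} with hA
  have hAm : MeasurableSet A :=
    (measurableSet_loopGoesOn hf x σ).preimage (hr.measurable_nd hi ht.le)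
  have hKm : Measurable (slopeOn f x σ b) :=
    (measurable_slope f x σ).indicator ((measurableSet_passStates hf x σ b).prod
      (MeasurableSet.univ.prod measurableSet_Icc))
  have hKb := norm_slopeOn_le (f := f) (x := x) hσ0 hb hL.le hgrad
  have hXm := hr.measurable_state hi ht
  have hYm := hr.measurable_sample hi ht
  have hKi : Integrable (fun ω => slopeOn f x σ b ((nd i t ω, r i t ω), (ξ i t ω, τ i t ω))) P :=
    Integrable.of_bound (hKm.comp (hXm.prodMk hYm)).aestronglyMeasurable _
      (Eventually.of_forall fun ω => hKb _)
  have hK : ∫ ω, slopeOn f x σ b ((nd i t ω, r i t ω), (ξ i t ω, τ i t ω)) ∂P ≤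
      1 / 2 * P.real A := by
    have h1 := integral_le_of_indepFun hXm hYm (hr.indepFun_state_sample hi ht) hKm
      (C := max (L / b) (1 / 2)) (fun q => (hKb q).trans (le_max_left _ _))
      (k := (passStates f x σ b).indicator fun _ => 1 / 2)
      (measurable_const.indicator (measurableSet_passStates hf x σ b))
      (fun q => ((norm_indicator_le_norm_self _ q).trans (by norm_num)).trans (le_max_right _ _))
      (fun q => by
        rw [hr.sample_law i hi t ht]
        exact integral_slopeOn_le hf hσ0 hσ1 hb hL.le hgrad hlip hLσ q)
    refine h1.trans ?_
    calc _ ≤ ∫ ω, A.indicator (fun _ => (1 / 2 : ℝ)) ω ∂P := by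
          refine integral_mono ?_ ((integrable_const _).indicator hAm) fun ω => ?_
          · exact Integrable.of_bound ((measurable_const.indicator
              (measurableSet_passStates hf x σ b)).comp hXm).aestronglyMeasurable (1 / 2)
              (Eventually.of_forall fun ω =>
                (norm_indicator_le_norm_self _ _).trans (by norm_num))
          · by_cases hω : (nd i t ω, r i t ω) ∈ passStates f x σ b
            · simp only [indicator_of_mem hω]
              rw [indicator_of_mem (show ω ∈ A from hω.1)]
            · simp only [indicator_of_notMem hω]
              exact indicator_nonneg (fun _ _ => by norm_num) ω
      _ = 1 / 2 * P.real A := by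
          rw [integral_indicator_const _ hAm, smul_eq_mul, mul_comm]
  have hZi := hr.integrable_potential hi hf hb hbd ht.le
  have hIi : Integrable (A.indicator fun _ => 3 / (16 * L ^ 2)) P :=
    (integrable_const _).indicator hAm
  have hmain : ∫ ω, potential f x σ b (nd i (t + 1) ω) ∂P ≤
      ∫ ω, (potential f x σ b (nd i t ω) - A.indicator (fun _ => 3 / (16 * L ^ 2)) ω +
        1 / (4 * L ^ 2) * slopeOn f x σ b ((nd i t ω, r i t ω), (ξ i t ω, τ i t ω))) ∂P := by
    refine integral_mono_ae (hr.integrable_potential hi hf hb hbd ht)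
      ((hZi.sub hIi).add (hKi.const_mul _)) ?_
    filter_upwards [hr.execution, hr.ae_mem_Icc, hbd,
      hr.ae_differentiableAt hi hf hσ1 ht] with ω he hτ hω hdiff
    exact potential_step_le hb hL (he.normal_steps i hi t ht) (hτ i hi t ht) hdiff
      (hω t ht.le).1 (hω t ht.le).2 (hω (t + 1) ht).1 hσ0.le hgrad
  have hsplit := integral_add (hZi.sub hIi) (hKi.const_mul (1 / (4 * L ^ 2)))
  simp only [Pi.sub_apply] at hsplit
  rw [hsplit, integral_sub hZi hIi,
    integral_indicator_const _ hAm, smul_eq_mul, integral_const_mul] at hmain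
  have hZA : ∫ ω, potential f x σ b (nd i t ω) ∂P ≤ 2 / b ^ 2 * P.real A := by
    calc _ ≤ ∫ ω, A.indicator (fun _ => 2 / b ^ 2) ω ∂P := by
          refine integral_mono_ae hZi ((integrable_const _).indicator hAm) ?_
          filter_upwards [hbd] with ω hω
          exact (potential_mem hb (hω t ht.le).1).2
      _ = _ := by rw [integral_indicator_const _ hAm, smul_eq_mul, mul_comm]
  set Z := ∫ ω, potential f x σ b (nd i t ω) ∂P
  have h1 := mul_le_mul_of_nonneg_left hK (show 0 ≤ 1 / (4 * L ^ 2) by positivity)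
  have h2 := mul_le_mul_of_nonneg_left hZA (show 0 ≤ b ^ 2 / (32 * L ^ 2) by positivity)
  have h3 : b ^ 2 / (32 * L ^ 2) * (2 / b ^ 2 * P.real A) = P.real A * (1 / (16 * L ^ 2)) := by
    field_simp; ring
  have h4 : P.real A * (3 / (16 * L ^ 2)) =
      P.real A * (1 / (16 * L ^ 2)) + 1 / (4 * L ^ 2) * (1 / 2 * P.real A) := by ring
  linarith

/-- `NDescent` succeeds with high probability. -/
theorem measureReal_goesOn_le (hbL : b ≤ L) :
    P.real {ω | LoopGoesOn f x (gridσ G i) (nd i T ω)} ≤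
      2 * (1 - b ^ 2 / (32 * L ^ 2)) ^ T := by
  set σ := gridσ G i with hσ
  have hq : 0 ≤ 1 - b ^ 2 / (32 * L ^ 2) := by
    rw [sub_nonneg, div_le_one (by positivity)]; nlinarith
  have hpow : ∀ t ≤ T, ∫ ω, potential f x σ b (nd i t ω) ∂P ≤
      (1 - b ^ 2 / (32 * L ^ 2)) ^ t * (2 / b ^ 2) := by
    intro t ht
    induction t with
    | zero =>
      rw [pow_zero, one_mul]
      calc _ ≤ ∫ _, 2 / b ^ 2 ∂P := by
            refine integral_mono_ae (hr.integrable_potential hi hf hb hbd ht)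
              (integrable_const _) ?_
            filter_upwards [hbd] with ω hω
            exact (le_abs_self _).trans (norm_potential_le hb (hω 0 ht).1)
        _ = _ := by simp
    | succ k ih =>
      refine (hr.integral_potential_step_le hi hf hσ1 hb hbd hL hgrad hlip hLσ ht).trans ?_
      rw [pow_succ' (1 - b ^ 2 / (32 * L ^ 2)), mul_assoc]
      exact mul_le_mul_of_nonneg_left (ih (by omega)) hq
  have hAm : MeasurableSet {ω | LoopGoesOn f x σ (nd i T ω)} :=
    (measurableSet_loopGoesOn hf x σ).preimage (hr.measurable_nd hi le_rfl)
  -- Markov's inequality: the potential is at least `1 / b ^ 2` on the event of failure and starts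
  -- at most at `2 / b ^ 2`, whence the factor 2.
  have h1 : P.real {ω | LoopGoesOn f x σ (nd i T ω)} * (1 / b ^ 2) ≤
      ∫ ω, potential f x σ b (nd i T ω) ∂P := by
    rw [← smul_eq_mul, ← integral_indicator_const _ hAm]
    refine integral_mono_ae ((integrable_const _).indicator hAm)
      (hr.integrable_potential hi hf hb hbd le_rfl) ?_
    filter_upwards [hbd] with ω hω
    exact (potential_mem hb (hω T le_rfl).1).1
  have h2 := h1.trans (hpow T le_rfl)
  rw [mul_one_div, ← mul_div_assoc, div_le_div_iff_of_pos_right (by positivity)] at h2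
  linarith

end IsRandomRun

end Run


/-- Here `θ * T` is at least twice the rounded logarithm, which is enough for log(1/p) and for the
factor 2, bounded by e. It is applied with θ = D₂²/(32L²), for which 2/θ = 256L²/μ². -/
lemma two_mul_pow_le {θ p : ℝ} (hθ0 : 0 < θ) (hθ1 : θ ≤ 1) (hp : p ∈ Ioo (0 : ℝ) 1) {N T : ℕ}
    (hN : 2 / θ ≤ N) (hT : N * ⌈2 * Real.log (1 / p)⌉₊ ≤ T) : 2 * (1 - θ) ^ T ≤ p := by
  set n := ⌈2 * Real.log (1 / p)⌉₊ with hn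
  have hlog : 0 < Real.log (1 / p) := Real.log_pos ((one_lt_div hp.1).2 hp.2)
  have hn1 : (1 : ℝ) ≤ n := by exact_mod_cast Nat.ceil_pos.2 (by positivity)
  have hnl : 2 * Real.log (1 / p) ≤ n := Nat.le_ceil _
  have hTr : (N : ℝ) * n ≤ T := by exact_mod_cast hT
  have h1 : 2 * n ≤ θ * T := by
    rw [div_le_iff₀ hθ0] at hN
    nlinarith
  have h2 : (1 - θ) ^ T ≤ Real.exp (-(θ * T)) := by
    rw [show -(θ * T) = T * (-θ) by ring, Real.exp_nat_mul]
    exact pow_le_pow_left₀ (by linarith) (by linarith [Real.add_one_le_exp (-θ)]) T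
  have h3 : (2 : ℝ) ≤ Real.exp 1 := by linarith [Real.exp_one_gt_d9]
  calc 2 * (1 - θ) ^ T ≤ Real.exp 1 * Real.exp (-(θ * T)) :=
        mul_le_mul h3 h2 (pow_nonneg (by linarith) _) (Real.exp_nonneg _)
    _ = Real.exp (1 - θ * T) := by rw [← Real.exp_add, sub_eq_add_neg]
    _ ≤ Real.exp (Real.log p) := by
        rw [Real.exp_le_exp]
        rw [one_div, Real.log_inv] at hnl
        linarith
    _ = p := Real.exp_log hp.1

/-! ### Success with high probability and the one step estimate. -/

section Run

variable {d m : ℕ} {f : Vec d → ℝ} {xbar : Vec d} {M U : Set (Vec d)} {F : Vec d → Vec m}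
  {c : Consts} {x g : Vec d} {Ω : Type*} [mΩ : MeasurableSpace Ω] {P : Measure Ω}
  [IsProbabilityMeasure P]
  {s slb : ℝ} {G T : ℕ} {ℱ : Filtration ℕ mΩ} {td nd : ℕ → ℕ → Ω → Vec d}
  {r : ℕ → ℕ → Ω → ℝ} {ξ : ℕ → ℕ → Ω → Vec d} {τ : ℕ → ℕ → Ω → ℝ} {xt : Ω → Vec d}

namespace Setting

/-- `NDescent` at the scale of `dist(x, M)` finds descent with high probability. -/
theorem measureReal_goesOn_le (h : Setting f xbar M U F c) (hx : ‖x - xbar‖ < c.δLS)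
    (hr : IsRandomRun P f x g s G T ℱ td nd r ξ τ xt) (hg : g ∈ clarke f x) {i : ℕ} (hi : i < G)
    (hD : 0 < Metric.infDist x M) (hσ : gridσ G i ≤ c.D₁ * Metric.infDist x M) {p : ℝ}
    (hp : p ∈ Ioo (0 : ℝ) 1)
    (hT : ⌈256 * c.L ^ 2 / c.μ ^ 2⌉₊ * ⌈2 * Real.log (1 / p)⌉₊ ≤ T) :
    P.real {ω | LoopGoesOn f x (gridσ G i) (nd i T ω)} ≤ p := by
  obtain ⟨hxh, hxb, -⟩ := h.mem_ball_of_lt_δLS hx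
  obtain ⟨hδ1, -, hδ3, -, -, -, hδ7⟩ := δLS_le (c := c)
  have hμ := h.μ_pos
  have hL := h.L_pos
  have hμL := h.μ_le
  have hD₁ := h.D₁_pos
  have hD₁' := h.D₁_le
  have hDx := h.infDist_le (x := x)
  have hσD : gridσ G i ≤ c.D₁ * c.δLS := hσ.trans (by gcongr; linarith)
  have hσ0 := gridσ_pos G i
  have hδ0 : 0 < c.δLS := (norm_nonneg _).trans_lt hx
  have hσδ : gridσ G i ≤ c.δLS := hσD.trans (by nlinarith)
  have hδA := h.δA_pos
  have hball : ∀ z, ‖z - x‖ ≤ gridσ G i → z ∈ Metric.ball xbar c.δA := fun z hz =>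
    mem_ball_of_norm_sub_le hxh (by linarith) hz
  have hb : 0 < c.D₂ := by unfold Consts.D₂; positivity
  -- This is the purpose of the factor `√128` in `δND`: it exceeds 32/3.
  have hLσ : c.L * gridσ G i ≤ 3 / 32 * c.D₂ := by
    have h1 : (32 / 3 : ℝ) ≤ √128 := Real.le_sqrt_of_sq_le (by norm_num)
    rw [le_div_iff₀ (by positivity)] at hδ3
    have h2 : c.δLS * (c.D₁ * c.L * (32 / 3)) ≤ c.D₂ := le_trans (by gcongr) hδ3
    have h3 := mul_le_mul_of_nonneg_left hσD hL.le
    linarith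
  have hmain := hr.measureReal_goesOn_le hi h.locLip (hσδ.trans hδ7) (b := c.D₂) (L := c.L) hb
    ?_ hL ?_ ?_ hLσ (by unfold Consts.D₂; linarith)
  · refine hmain.trans (two_mul_pow_le ?_ ?_ hp (N := ⌈256 * c.L ^ 2 / c.μ ^ 2⌉₊) ?_ hT)
    · positivity
    · rw [div_le_one (by positivity)]
      unfold Consts.D₂
      nlinarith
    · refine le_trans (le_of_eq ?_) (Nat.le_ceil _)
      unfold Consts.D₂
      field_simp; ring
  · filter_upwards [hr.execution, hr.ae_mem_Icc] with ω he hτ t ht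
    have hmem := (he.mem_goldstein hτ hg i hi).2 t ht
    exact ⟨h.D₂_le_norm hx hD hσ hmem, h.norm_le_of_mem_goldstein hxb (by linarith) hmem⟩
  · intro z hz
    -- Where `f` is not differentiable the gradient takes its default value zero, so the bound holds
    -- at every point.
    by_cases hdz : DifferentiableAt ℝ f z
    · exact h.norm_le_of_mem_clarke (hball z hz) (gradient_mem_clarke hdz)
    · rw [gradient, fderiv_zero_of_not_differentiableAt hdz, map_zero, norm_zero]
      exact hL.le
  · exact fun y z hy hz => h.abs_sub_le (hball y hy) (hball z hz)

/-- One step of improvement, with high probability. -/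
theorem one_step_improvement (h : Setting f xbar M U F c) (hx : ‖x - xbar‖ < c.δLS)
    (hr : IsRandomRun P f x g s G T ℱ td nd r ξ τ xt) (hg : g ∈ clarke f x)
    (hslb : 0 < slb) (hs : s ∈ Icc slb c.L) (hG : (1 / 2 : ℝ) ^ G ≤ c.δGrid) {p : ℝ}
    (hp : p ∈ Ioo (0 : ℝ) 1)
    (hT : ⌈256 * c.L ^ 2 / c.μ ^ 2⌉₊ * ⌈2 * Real.log (1 / p)⌉₊ ≤ T) :
    ENNReal.ofReal (1 - p) ≤ P {ω |
      f (xt ω) - f xbar ≤ max (c.ρ * (f x - f xbar)) (max (c.ε₁ T) (c.ε₂ G)) ∧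
      ‖xt ω - x‖ ≤ c.C₆ slb * max (max (c.ε₁ T / slb) (c.ε₂ G / slb))
        √(2 * (f x - f xbar) / min slb c.γ)} := by
  have hs0 : 0 < s := hslb.trans_le hs.1
  have hgood : ∀ᵐ ω ∂P, ‖xt ω - x‖ ≤ c.C₆ slb * max (max (c.ε₁ T / slb) (c.ε₂ G / slb))
      √(2 * (f x - f xbar) / min slb c.γ) := by
    filter_upwards [hr.execution, hr.ae_mem_Icc] with ω he hτ
    exact h.norm_out_sub_le hx he hτ hg hslb hs hG
  have hone : (∀ᵐ ω ∂P, f (xt ω) - f xbar ≤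
      max (c.ρ * (f x - f xbar)) (max (c.ε₁ T) (c.ε₂ G))) →
      ENNReal.ofReal (1 - p) ≤ P {ω |
        f (xt ω) - f xbar ≤ max (c.ρ * (f x - f xbar)) (max (c.ε₁ T) (c.ε₂ G)) ∧
        ‖xt ω - x‖ ≤ c.C₆ slb * max (max (c.ε₁ T / slb) (c.ε₂ G / slb))
          √(2 * (f x - f xbar) / min slb c.γ)} := by
    intro hall
    rw [measure_congr (eventuallyEq_univ.2 (hall.and hgood)), measure_univ]
    exact ENNReal.ofReal_le_one.2 (by linarith [hp.1])
  -- The tangential regime and a fitting scale below the grid are settled almost surely. Only the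
  -- normal regime has a chance of failure, and it concerns a single round fixed in advance by `x`,
  -- so no union over rounds is taken.
  rcases le_or_gt (Metric.infDist x M) (c.a₂ ^ 2 * ‖proj M x - xbar‖ ^ 2) with hD | hD
  · refine hone ?_
    filter_upwards [hr.execution, hr.ae_mem_Icc] with ω he hτ
    exact h.out_le_of_tangent hx he hτ hg hs0 hs.2 hD
  rcases lt_or_ge (c.a₁ * Metric.infDist x M) ((1 / 2) ^ G) with hsmall | hlarge
  · refine hone ?_
    filter_upwards [hr.execution] with ω he
    exact le_max_of_le_right (le_max_of_le_right
      (le_trans (by linarith [he.out_le]) (h.gap_le_ε₂ hx hD hsmall)))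
  have hD0 : 0 < Metric.infDist x M := lt_of_le_of_lt (by positivity) hD
  have hDx := h.infDist_le (x := x)
  have hδ7 := (δLS_le (c := c)).2.2.2.2.2.2
  obtain ⟨i, hi, hσ1, hσ2⟩ := exists_gridσ hlarge
    (by nlinarith [a₁_le_D₁ (c := c), h.D₁_le, h.a₁_pos])
  have hprob := h.measureReal_goesOn_le hx hr hg hi hD0
    (hσ2.trans (mul_le_mul_of_nonneg_right a₁_le_D₁ hD0.le)) hp hT
  have hAm : MeasurableSet {ω | LoopGoesOn f x (gridσ G i) (nd i T ω)} :=
    (measurableSet_loopGoesOn h.locLip x _).preimage (hr.measurable_nd hi le_rfl)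
  calc ENNReal.ofReal (1 - p)
      ≤ ENNReal.ofReal (P.real {ω | LoopGoesOn f x (gridσ G i) (nd i T ω)}ᶜ) := by
        rw [probReal_compl_eq_one_sub hAm]
        exact ENNReal.ofReal_le_ofReal (by linarith)
    _ = P {ω | LoopGoesOn f x (gridσ G i) (nd i T ω)}ᶜ := ofReal_measureReal
    _ ≤ _ := by
        refine measure_mono_ae ?_
        filter_upwards [hr.execution, hr.ae_mem_Icc, hgood] with ω he hτ hd hω
        exact ⟨le_max_of_le_left (h.out_le_of_normal hx he hτ hg hs0 hs.2 hD hi hσ1 hσ2 hω), hd⟩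

end Setting

end Run

lemma pow_half_le_of_logb_lt {δ : ℝ} (hδ : 0 < δ) {G : ℕ}
    (hG : ⌈Real.logb 2 (1 / δ)⌉ < (G : ℤ)) : (1 / 2 : ℝ) ^ G ≤ δ := by
  have h1 : Real.logb 2 (1 / δ) ≤ (G : ℝ) :=
    (Int.le_ceil _).trans (by exact_mod_cast hG.le)
  rw [Real.logb_le_iff_le_rpow one_lt_two (by positivity), Real.rpow_natCast] at h1
  rw [div_pow, one_pow, div_le_iff₀ (by positivity)]
  rwa [div_le_iff₀ hδ, mul_comm] at h1

end NTDescent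

theorem mainTheorem10 {d m : ℕ} (f : EuclideanSpace ℝ (Fin d) → ℝ)
    (xbar : EuclideanSpace ℝ (Fin d)) (M U : Set (EuclideanSpace ℝ (Fin d)))
    (F : EuclideanSpace ℝ (Fin d) → EuclideanSpace ℝ (Fin m)) (γ Ca β CM : ℝ)
    (hf : NTDescent.MainAssumption f xbar M U F γ Ca)
    (hM : M ∉ 𝓝 xbar)
    (hβ : NTDescent.lipMod (gradient (NTDescent.extension f M)) xbar < ENNReal.ofReal β)
    (hCM : NTDescent.lipMod (fderiv ℝ (NTDescent.proj M)) xbar < ENNReal.ofReal CM)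
    (x₀ g₀ : EuclideanSpace ℝ (Fin d)) (hg₀ : g₀ ∈ NTDescent.clarke f x₀) (hg₀' : g₀ ≠ 0)
    (c₀ : ℝ) (hc₀ : c₀ ∈ Ioc (0 : ℝ) 1) :
    (∃ δA : ℝ,
      NTDescent.IsRegularityRadius f xbar M U F (NTDescent.consts f xbar M γ Ca β CM δA)) ∧
    ∀ (δA : ℝ) (c : NTDescent.Consts), c = NTDescent.consts f xbar M γ Ca β CM δA →
      NTDescent.IsRegularityRadius f xbar M U F c →
      ∀ x ∈ Metric.ball xbar c.δLS, ∀ g ∈ NTDescent.clarke f x,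
      ∀ G : ℕ, ⌈Real.logb 2 (1 / c.δGrid)⌉ < (G : ℤ) →
      ∀ s ∈ Icc (c₀ * ‖g₀‖) c.L, ∀ p ∈ Ioo (0 : ℝ) 1,
      ∀ T : ℕ, ⌈256 * c.L ^ 2 / c.μ ^ 2⌉₊ * ⌈2 * Real.log (1 / p)⌉₊ ≤ T →
      ∀ (Ω : Type*) (mΩ : MeasurableSpace Ω) (P : Measure Ω), IsProbabilityMeasure P →
      ∀ (ℱ : Filtration ℕ mΩ) (td nd : ℕ → ℕ → Ω → EuclideanSpace ℝ (Fin d))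
        (r : ℕ → ℕ → Ω → ℝ) (ξ : ℕ → ℕ → Ω → EuclideanSpace ℝ (Fin d)) (τ : ℕ → ℕ → Ω → ℝ)
        (xt : Ω → EuclideanSpace ℝ (Fin d)),
      NTDescent.IsRandomRun P f x g s G T ℱ td nd r ξ τ xt →
      ENNReal.ofReal (1 - p) ≤ P {ω |
        f (xt ω) - f xbar ≤ max (c.ρ * (f x - f xbar)) (max (c.ε₁ T) (c.ε₂ G)) ∧
        ‖xt ω - x‖ ≤ c.C₆ (c₀ * ‖g₀‖) *
          max (max (c.ε₁ T / (c₀ * ‖g₀‖)) (c.ε₂ G / (c₀ * ‖g₀‖)))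
            √(2 * (f x - f xbar) / min (c₀ * ‖g₀‖) γ)} := by
  refine ⟨NTDescent.exists_isRegularityRadius hf hM hβ hCM, ?_⟩
  rintro δA c hc hreg x hx g hg G hG s hs p hp T hT Ω mΩ P hP ℱ td nd r ξ τ xt hr
  have hsetting : NTDescent.Setting f xbar M U F c := by
    subst hc
    exact {
      reg := hreg
      locLip := hf.locLip
      mem := hf.active.mem
      γ_pos := hf.γ_pos
      Ca_pos := hf.Ca_pos
      β_pos := ENNReal.ofReal_pos.1 (pos_of_gt hβ)
      CM_pos := ENNReal.ofReal_pos.1 (pos_of_gt hCM)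
      μ_pos := NTDescent.sharpConst_pos_of_mainAssumption hf hM
      μ_le := NTDescent.eight_mul_sharpConst_le hf.locLip hM }
  have hγ : c.γ = γ := by rw [hc]; rfl
  rw [← hγ]
  exact hsetting.one_step_improvement (mem_ball_iff_norm.1 hx) hr hg
    (mul_pos hc₀.1 (norm_pos_iff.2 hg₀')) hs
    (NTDescent.pow_half_le_of_logb_lt hsetting.δGrid_pos hG) hp hT
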